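/- **Theorem 3.2 (Lower bounds).** *Plate.* Let $\Omega\subset\mathbb R^2$ be a polygonal domain, i.e. a bounded connected open set with $\Omega=\operatorname{int}\overline\Omega$ whose boundary is a finite union of segments, and let $\partial\Omega=\Gamma_c\cup\Gamma_s\cup\Gamma_f$ (clamped, simply supported, free), where each part is a finite, possibly empty, union of nondegenerate closed segments and any two parts meet in finitely many points. Let the plate have thickness $d>0$, Young's modulus $E_Y>0$ and Poisson ratio $-1<\nu<1$. Put $$\kappa(w)=-\nabla^2w,\qquad M(w)=\tfrac{d^3}{12}\,\tfrac{E_Y}{1+\nu}\Big(\kappa(w)+\tfrac{\nu}{1-\nu}\operatorname{tr}\kappa(w)\,I\Big),\qquad Q(w)=\operatorname{Div}M(w),$$ $$\mathcal A(w)=D\,\Delta^2w,\quad D=\tfrac{E_Yd^3}{12(1-\nu^2)},\qquad a(w,v)=\int_\Omega M(w):\kappa(v)\,dx,$$ and, for a unit normal $n$ with unit tangent $s$ on a segment, $$M_{nn}(w)=n\cdot M(w)n,\quad M_{ns}(w)=s\cdot M(w)n,\quad V_n(w)=Q(w)\cdot n+\partial_sM_{ns}(w).$$ Let $V=\{v\in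 H^2(\Omega): v=0 \text{ on }\Gamma_c\cup\Gamma_s,\ \nabla v\cdot n=0\text{ on }\Gamma_c\}$ (in the sense of traces). Given $S\subset\overline\Omega$, $f\in L^2(\Omega)$, $g\in L^2(S)$, $F\in\mathbb R$ and $x_0\in\Omega$, let $u\in V$ satisfy $$a(u,v)=\int_\Omega fv\,dx+\int_Sgv\,ds+F\,v(x_0)\qquad\text{for all }v\in V .$$ *Mesh.* Let $\mathcal C_h$ be a conforming triangulation of $\overline\Omega$ that is shape regular with constant $\kappa_0$: $h_K\le\kappa_0\rho_K$ for every triangle $K$, where $h_K$ is the diameter of $K$ and $\rho_K$ the diameter of the largest disc contained in $K$. Assume that $S$ is a (possibly empty) union of interior edges (edges shared by two triangles), and that $x_0$ is a node of the mesh if $F\ne0$. Let $\mathcal E_h^i$ be the set of interior edges, $\mathcal E_h^S\subset\mathcal E_h^i$ the set of those contained in $S$, and $\mathcal E_h^s,\mathcal E_h^f$ the sets of edges contained in $\Gamma_s$ and $\Gamma_f$. Let $h_E$ be the length of the edge $E$ and $\omega_E$ the union of the triangles having $E$ as an edge. For an interior edge $E=K\cap K'$ with outer unit normals $n,n'$ of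 $K,K'$, put $[\![M_{nn}(v)]\!]=M_{nn}(v|_K)-M_{n'n'}(v|_{K'})$ and $[\![V_n(v)]\!]=V_n(v|_K)+V_{n'}(v|_{K'})$. Let $k,r\in\mathbb N$. Let the conforming finite element space $V_h$ be any subset of $\{v\in V: v|_K\in P_k(K)\ \text{for all } K\in\mathcal C_h\}$. Let $f_h$ be any function with $f_h|_K\in P_k(K)$ for all $K\in\mathcal C_h$ (for instance, an interpolant of $f$ in $V_h$) and let $g_h$ be any function with $g_h|_E\in P_r(E)$ for all $E\in\mathcal E_h^S$. Put $$\operatorname{osc}_K(f)=h_K^2\|f-f_h\|_{0,K},\qquad \operatorname{osc}_E(g)=h_E^{3/2}\|g-g_h\|_{0,E}.$$ *Claim.* There is a constant $C>0$, depending only on $d,E_Y,\nu,\kappa_0,k,r$ (in particular, not on the mesh), such that for all $v_h\in V_h$: 1. $h_K^2\|\mathcal A(v_h)-f\|_{0,K}\le C\big(\|u-v_h\|_{2,K}+\operatorname{osc}_K(f)\big)$ for $K\in\mathcal C_h$; 2. $h_E^{1/2}\|[\![M_{nn}(v_h)]\!]\|_{0,E}\le C\big(\|u-v_h\|_{2,\omega_E}+\sum_{K\subset\omega_E}\operatorname{osc}_K(f)\big)$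 for $E\in\mathcal E_h^i$; 3. $h_E^{3/2}\|[\![V_n(v_h)]\!]\|_{0,E}\le C\big(\|u-v_h\|_{2,\omega_E}+\sum_{K\subset\omega_E}\operatorname{osc}_K(f)\big)$ for $E\in\mathcal E_h^i\setminus\mathcal E_h^S$; 4. $h_E^{3/2}\|[\![V_n(v_h)]\!]-g\|_{0,E}\le C\big(\|u-v_h\|_{2,\omega_E}+\sum_{K\subset\omega_E}\operatorname{osc}_K(f)+\operatorname{osc}_E(g)\big)$ for $E\in\mathcal E_h^S$; 5. $h_E^{1/2}\|M_{nn}(v_h)\|_{0,E}\le C\big(\|u-v_h\|_{2,\omega_E}+\sum_{K\subset\omega_E}\operatorname{osc}_K(f)\big)$ for $E\in\mathcal E_h^f\cup\mathcal E_h^s$; 6. $h_E^{3/2}\|V_n(v_h)\|_{0,E}\le C\big(\|u-v_h\|_{2,\omega_E}+\sum_{K\subset\omega_E}\operatorname{osc}_K(f)\big)$ for $E\in\mathcal E_h^f$. -/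

import Mathlib

open MeasureTheory Topology Filter
open scoped ContDiff

noncomputable section

namespace Kirchhoff

/-- The plane, with its Euclidean norm and Lebesgue measure. The length measure on curves is the
one-dimensional Hausdorff measure `μH[1]`. -/
abbrev Plane := EuclideanSpace ℝ (Fin 2)

/-- Classical partial derivative `∂w/∂xᵢ`. -/
def pd (i : Fin 2) (w : Plane → ℝ) (x : Plane) : ℝ :=
  fderiv ℝ w x (EuclideanSpace.single i 1)

/-! ### Polygonal domains -/

/-- A finite union of nondegenerate closed line segments (possibly empty). -/
def IsSegmentUnion (Γ : Set Plane) : Prop :=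
  ∃ s : Finset (Plane × Plane), (∀ p ∈ s, p.1 ≠ p.2) ∧ Γ = ⋃ p ∈ s, segment ℝ p.1 p.2

/-- Polygonal domain: a bounded connected open set, equal to the interior of its closure (so there
are no slits), whose boundary is a finite union of segments. -/
structure IsPolygonalDomain (Ω : Set Plane) : Prop where
  isOpen : IsOpen Ω
  isConnected : IsConnected Ω
  isBounded : Bornology.IsBounded Ω
  interior_closure : interior (closure Ω) = Ω
  frontier_segments : IsSegmentUnion (frontier Ω)

/-- A plate: a polygonal domain `Ω` whose boundary is split into a clamped part `Γc`, a simply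
supported part `Γs` and a free part `Γf` (any of which may be empty). -/
structure Plate where
  Ω : Set Plane
  Γc : Set Plane
  Γs : Set Plane
  Γf : Set Plane
  domain : IsPolygonalDomain Ω
  segments_c : IsSegmentUnion Γc
  segments_s : IsSegmentUnion Γs
  segments_f : IsSegmentUnion Γf
  boundary : Γc ∪ Γs ∪ Γf = frontier Ω
  finite_cs : (Γc ∩ Γs).Finite
  finite_cf : (Γc ∩ Γf).Finite
  finite_sf : (Γs ∩ Γf).Finite

/-! ### Sobolev functions and traces -/

/-- `g` is the weak derivative `∂w/∂xᵢ` on the open set `Ω`. -/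
def HasWeakDeriv (Ω : Set Plane) (i : Fin 2) (w g : Plane → ℝ) : Prop :=
  ∀ φ : Plane → ℝ, ContDiff ℝ ∞ φ → HasCompactSupport φ → tsupport φ ⊆ Ω →
    ∫ x in Ω, w x * pd i φ x = - ∫ x in Ω, g x * φ x

/-- `w` belongs to `H¹(Ω)`, with weak gradient `dw`. -/
structure IsH1 (Ω : Set Plane) (w : Plane → ℝ) (dw : Fin 2 → Plane → ℝ) : Prop where
  memLp : MemLp w 2 (volume.restrict Ω)
  memLp_grad : ∀ i, MemLp (dw i) 2 (volume.restrict Ω)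
  weak : ∀ i, HasWeakDeriv Ω i w (dw i)

/-- An element of `H²(Ω)`, carried together with its weak gradient and weak Hessian
(`hess i j` is `∂ⱼ∂ᵢ`). In two dimensions every class in `H²(Ω)` has exactly one representative that
is continuous on `Ω`, and `val` is that representative, so that point values make sense. -/
structure H2Function (Ω : Set Plane) where
  val : Plane → ℝ
  grad : Fin 2 → Plane → ℝ
  hess : Fin 2 → Fin 2 → Plane → ℝ
  continuousOn : ContinuousOn val Ω
  isH1 : IsH1 Ω val grad
  isH1_grad : ∀ i, IsH1 Ω (grad i) (hess i)

/-- The trace of `w ∈ H¹(Ω)` (with weak gradient `dw`) vanishes on `Γ ⊆ ∂Ω`. The trace is the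
continuous extension to `H¹(Ω)` of the restriction `φ ↦ φ|_Γ ∈ L²(Γ)`, defined for
`φ ∈ H¹(Ω) ∩ C(Ω̄)`; so the trace is zero iff there are such `φₙ → w` in `H¹(Ω)` with
`φₙ|_Γ → 0` in `L²(Γ)`. -/
def HasZeroTrace (Ω Γ : Set Plane) (w : Plane → ℝ) (dw : Fin 2 → Plane → ℝ) : Prop :=
  ∃ (φ : ℕ → Plane → ℝ) (dφ : ℕ → Fin 2 → Plane → ℝ),
    (∀ n, ContinuousOn (φ n) (closure Ω)) ∧
    (∀ n, IsH1 Ω (φ n) (dφ n)) ∧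
    Tendsto (fun n => ∫ x in Ω, ((φ n x - w x) ^ 2 + ∑ i, (dφ n i x - dw i x) ^ 2)) atTop (𝓝 0) ∧
    Tendsto (fun n => ∫ x in Γ, φ n x ^ 2 ∂μH[1]) atTop (𝓝 0)

/-- The space `V` of kinematically admissible deflections: `v ∈ H²(Ω)` with `v = 0` on `Γc ∪ Γs`
and `∇v · n = 0` on `Γc`, the latter being imposed on each segment contained in `Γc`, with `n` a
unit normal of that segment. -/
structure MemV (P : Plate) (v : H2Function P.Ω) : Prop where
  zero : HasZeroTrace P.Ω (P.Γc ∪ P.Γs) v.val v.grad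
  normal_zero : ∀ a b n : Plane, a ≠ b → segment ℝ a b ⊆ P.Γc → ‖n‖ = 1 → inner ℝ n (b - a) = 0 →
    HasZeroTrace P.Ω (segment ℝ a b) (fun x => ∑ i, n i * v.grad i x)
      (fun j x => ∑ i, n i * v.hess i j x)

/-! ### The Kirchhoff plate model -/

/-- Thickness `d`, Young's modulus `E` and Poisson ratio `ν` of an isotropic plate. -/
structure Material where
  d : ℝ
  E : ℝ
  ν : ℝ
  d_pos : 0 < d
  E_pos : 0 < E
  ν_gt : -1 < ν
  ν_lt : ν < 1

namespace Material

variable (m : Material)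

/-- The constitutive map `A ↦ E/(1+ν) (A + ν/(1-ν) (tr A) I)`. -/
def constRel (A : Matrix (Fin 2) (Fin 2) ℝ) : Matrix (Fin 2) (Fin 2) ℝ :=
  (m.E / (1 + m.ν)) • (A + (m.ν / (1 - m.ν) * A.trace) • (1 : Matrix (Fin 2) (Fin 2) ℝ))

/-- The bending stiffness `D = E d³ / (12 (1-ν²))`. -/
def stiffness : ℝ := m.E * m.d ^ 3 / (12 * (1 - m.ν ^ 2))

end Material

/-- The curvature `-ε(∇w)` in terms of the Hessian of `w`. -/
def curvature (H : Matrix (Fin 2) (Fin 2) ℝ) : Matrix (Fin 2) (Fin 2) ℝ :=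
  -((1 / 2 : ℝ) • (H + H.transpose))

/-- The moment tensor `d³/12 C(κ(w))` in terms of the Hessian of `w`. -/
def momentOfHessian (m : Material) (H : Matrix (Fin 2) (Fin 2) ℝ) : Matrix (Fin 2) (Fin 2) ℝ :=
  (m.d ^ 3 / 12) • m.constRel (curvature H)

/-- The Hessian matrix of an `H²` function at a point. -/
def H2Function.hessian {Ω : Set Plane} (w : H2Function Ω) (x : Plane) :
    Matrix (Fin 2) (Fin 2) ℝ :=
  Matrix.of fun i j => w.hess i j x

/-- The bilinear form `a(w,v) = ∫_Ω M(w) : κ(v)`. -/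
def bilin (m : Material) {Ω : Set Plane} (w v : H2Function Ω) : ℝ :=
  ∫ x in Ω, ∑ i, ∑ j, momentOfHessian m (w.hessian x) i j * curvature (v.hessian x) i j

/-- The loading: a distributed load `f`, a line load `g` along `S`, and a point load of size `F`
at the point `x₀`. -/
structure Load where
  f : Plane → ℝ
  S : Set Plane
  g : Plane → ℝ
  F : ℝ
  x₀ : Plane

/-- `f ∈ L²(Ω)`, `g ∈ L²(S)`, `S ⊆ Ω̄` and `x₀ ∈ Ω`. -/
structure Load.Admissible (L : Load) (Ω : Set Plane) : Prop where
  memLp_f : MemLp L.f 2 (volume.restrict Ω)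
  memLp_g : MemLp L.g 2 (μH[1].restrict L.S)
  S_subset : L.S ⊆ closure Ω
  x₀_mem : L.x₀ ∈ Ω

/-- The load functional `l(v) = ∫_Ω f v dx + ∫_S g v ds + F v(x₀)`. -/
def Load.functional (L : Load) {Ω : Set Plane} (v : H2Function Ω) : ℝ :=
  (∫ x in Ω, L.f x * v.val x) + (∫ x in L.S, L.g x * v.val x ∂μH[1]) + L.F * v.val L.x₀

/-- `u` solves the variational formulation: `u ∈ V` and `a(u,v) = l(v)` for all `v ∈ V`. -/
structure IsWeakSolution (m : Material) (P : Plate) (L : Load) (u : H2Function P.Ω) : Prop where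
  memV : MemV P u
  eq : ∀ v : H2Function P.Ω, MemV P v → bilin m u v = L.functional v

/-! ### Classical force quantities of a smooth deflection -/

/-- The Hessian matrix of a smooth function, with entries `∂ⱼ∂ᵢw`. -/
def hessianAt (w : Plane → ℝ) (x : Plane) : Matrix (Fin 2) (Fin 2) ℝ :=
  Matrix.of fun i j => pd j (pd i w) x

/-- The moment tensor `M(w)`. -/
def moment (m : Material) (w : Plane → ℝ) (x : Plane) : Matrix (Fin 2) (Fin 2) ℝ :=
  momentOfHessian m (hessianAt w x)

/-- The shear force `Q(w) = Div M(w)`. -/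
def shear (m : Material) (w : Plane → ℝ) (x : Plane) (i : Fin 2) : ℝ :=
  ∑ j, pd j (fun y => moment m w y i j) x

/-- The Laplacian. -/
def lap (w : Plane → ℝ) (x : Plane) : ℝ := ∑ i, pd i (pd i w) x

/-- The plate operator `A(w) = D Δ² w`. -/
def plateOp (m : Material) (w : Plane → ℝ) (x : Plane) : ℝ := m.stiffness * lap (lap w) x

/-- The tangent belonging to the normal `n`: its rotation by a right angle. -/
def tangent (n : Plane) : Plane := !₂[-(n 1), n 0]

/-- The normal shear force `Qₙ(w) = Q(w) · n`. -/
def Qn (m : Material) (n : Plane) (w : Plane → ℝ) (x : Plane) : ℝ := ∑ i, shear m w x i * n i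

/-- The normal moment `Mₙₙ(w) = n · M(w) n`. -/
def Mnn (m : Material) (n : Plane) (w : Plane → ℝ) (x : Plane) : ℝ :=
  ∑ i, ∑ j, n i * moment m w x i j * n j

/-- The twisting moment `Mₙₛ(w) = s · M(w) n`. -/
def Mns (m : Material) (n : Plane) (w : Plane → ℝ) (x : Plane) : ℝ :=
  ∑ i, ∑ j, tangent n i * moment m w x i j * n j

/-- The Kirchhoff (effective) shear force `Vₙ(w) = Qₙ(w) + ∂Mₙₛ(w)/∂s`. -/
def Vn (m : Material) (n : Plane) (w : Plane → ℝ) (x : Plane) : ℝ :=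
  Qn m n w x + fderiv ℝ (Mns m n w) x (tangent n)

/-! ### Meshes -/

/-- The closed simplex with the given vertices. -/
abbrev hull (K : Finset Plane) : Set Plane := convexHull ℝ (K : Set Plane)

/-- A conforming triangulation of `Ω`: a finite simplicial complex (two simplices meet in a common
face or not at all) in which every simplex is a face of a triangle, and which covers `Ω̄`. -/
structure Mesh (Ω : Set Plane) where
  complex : Geometry.SimplicialComplex ℝ Plane
  finite : complex.faces.Finite
  pure : ∀ s ∈ complex.faces, ∃ t ∈ complex.faces, s ⊆ t ∧ t.card = 3
  cover : complex.space = closure Ω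

namespace Mesh

variable {Ω : Set Plane} (T : Mesh Ω)

/-- The triangles, given by their three vertices. -/
def elements : Set (Finset Plane) := {K | K ∈ T.complex.faces ∧ K.card = 3}

/-- The edges, given by their two endpoints. -/
def edges : Set (Finset Plane) := {E | E ∈ T.complex.faces ∧ E.card = 2}

/-- The triangles sharing the edge `E`. -/
def patch (E : Finset Plane) : Set (Finset Plane) := {K | K ∈ T.elements ∧ E ⊆ K}

/-- `ω_E`, the union of the triangles sharing the edge `E`. -/
def omega (E : Finset Plane) : Set Plane := ⋃ K ∈ T.patch E, hull K

/-- The interior edges: those shared by two different triangles. -/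
def interiorEdges : Set (Finset Plane) :=
  {E | E ∈ T.edges ∧ ∃ K ∈ T.patch E, ∃ K' ∈ T.patch E, K ≠ K'}

/-- The interior edges lying on `S`. -/
def lineEdges (S : Set Plane) : Set (Finset Plane) := {E | E ∈ T.interiorEdges ∧ hull E ⊆ S}

/-- The edges lying on the part `Γ` of the boundary. -/
def edgesOn (Γ : Set Plane) : Set (Finset Plane) := {E | E ∈ T.edges ∧ hull E ⊆ Γ}

/-- Shape regularity with constant `κ`: each triangle `K` satisfies `h_K ≤ κ ρ_K`, where
`h_K = diam K` and `ρ_K` is the diameter of the largest disc contained in `K`. -/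
def ShapeRegular (κ : ℝ) : Prop :=
  ∀ K ∈ T.elements, ∃ (c : Plane) (R : ℝ), 0 < R ∧ Metric.closedBall c R ⊆ hull K ∧
    Metric.diam (hull K) ≤ κ * (2 * R)

/-- The mesh fits the load: the line `S` consists of interior edges of the mesh and the point load
(if there is one) sits at a node. -/
structure Fits (L : Load) : Prop where
  line : L.S = ⋃ E ∈ T.lineEdges L.S, hull E
  node : L.F ≠ 0 → L.x₀ ∈ T.complex.vertices

end Mesh

/-- `n` is the unit normal on the edge `E` pointing out of the triangle `K`. -/
structure IsOuterNormal (K E : Finset Plane) (n : Plane) : Prop where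
  norm : ‖n‖ = 1
  orthogonal : ∀ a ∈ E, ∀ b ∈ E, inner ℝ n (b - a) = 0
  outward : ∀ a ∈ E, ∀ x ∈ K, inner ℝ n (x - a) ≤ 0

/-! ### Finite element functions, norms, oscillations -/

/-- The function on the plane defined by a polynomial in two variables. -/
def polyFun (p : MvPolynomial (Fin 2) ℝ) (x : Plane) : ℝ := MvPolynomial.eval (fun i => x i) p

/-- `v` is a function of the conforming finite element space of degree `k` on the mesh: `v ∈ V`, and
on each triangle `K` it coincides with the polynomial `q K`, of degree at most `k`. -/
structure IsFEFunction (P : Plate) (T : Mesh P.Ω) (k : ℕ) (v : H2Function P.Ω)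
    (q : Finset Plane → MvPolynomial (Fin 2) ℝ) : Prop where
  memV : MemV P v
  degree : ∀ K ∈ T.elements, (q K).totalDegree ≤ k
  eq : ∀ K ∈ T.elements, ∀ x ∈ interior (hull K), v.val x = polyFun (q K) x

/-- `‖w‖_{0,A}` for a plane region `A`. -/
def l2Norm (A : Set Plane) (w : Plane → ℝ) : ℝ := √(∫ x in A, w x ^ 2)

/-- `‖w‖_{0,E}` for an edge `E`. -/
def edgeNorm (E : Finset Plane) (w : Plane → ℝ) : ℝ := √(∫ x in hull E, w x ^ 2 ∂μH[1])

/-- `‖u - v‖_{2,A}`, the full `H²(A)` norm of the difference. -/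
def h2Dist {Ω : Set Plane} (A : Set Plane) (u v : H2Function Ω) : ℝ :=
  √(∫ x in A, ((u.val x - v.val x) ^ 2 + ∑ i, (u.grad i x - v.grad i x) ^ 2
    + ∑ i, ∑ j, (u.hess i j x - v.hess i j x) ^ 2))

/-- The size `h_K` of a triangle, or the length `h_E` of an edge. -/
def size (K : Finset Plane) : ℝ := Metric.diam (hull K)

/-- `osc_K(f) = h_K² ‖f - f_h‖_{0,K}`, where `f_h` is the polynomial `fh K` on `K`. -/
def oscElem (f : Plane → ℝ) (fh : Finset Plane → MvPolynomial (Fin 2) ℝ) (K : Finset Plane) : ℝ :=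
  size K ^ 2 * l2Norm (hull K) (fun x => f x - polyFun (fh K) x)

/-- `osc_E(g) = h_E^{3/2} ‖g - g_h‖_{0,E}`, where `g_h` is the polynomial `gh E` on `E`. -/
def oscEdge (g : Plane → ℝ) (gh : Finset Plane → MvPolynomial (Fin 2) ℝ) (E : Finset Plane) : ℝ :=
  size E ^ (3 / 2 : ℝ) * edgeNorm E (fun x => g x - polyFun (gh E) x)

/-- `∑_{K ⊆ ω_E} osc_K(f)`. -/
def oscPatch {Ω : Set Plane} (T : Mesh Ω) (f : Plane → ℝ)
    (fh : Finset Plane → MvPolynomial (Fin 2) ℝ) (E : Finset Plane) : ℝ :=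
  ∑ᶠ K ∈ T.patch E, oscElem f fh K

/-- The jump `Mₙₙ(v) - M_{n'n'}(v)` across an edge; `w`, `w'` are the polynomials of `v` on the two
triangles and `n`, `n'` the outer normals. -/
def jumpM (m : Material) (n n' : Plane) (w w' : Plane → ℝ) (x : Plane) : ℝ :=
  Mnn m n w x - Mnn m n' w' x

/-- The jump `Vₙ(v) + V_{n'}(v)` across an edge, with the same conventions. -/
def jumpV (m : Material) (n n' : Plane) (w w' : Plane → ℝ) (x : Plane) : ℝ :=
  Vn m n w x + Vn m n' w' x

end Kirchhoff

end

/-!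
Efficiency of the residual a posteriori error estimator for Kirchhoff plates. The classical proof
tests the weak formulation with polynomial bubble functions on triangles and edge patches; here all
test functions are restrictions of smooth, compactly supported functions on the plane, of the form
`testFun`: a tensor product cut-off times a polynomial, in coordinates that are scaled to the length
of an edge (or to the radius of a disc inside a triangle) and rotated into its frame. Such functions
belong to `V` without any gluing (`memV_smoothH2`), and their derivatives scale explicitly
(`exists_testFun_bound`).

Subtracting Green's formula on the triangles from the weak formulation gives the residual identity
`IsWeakSolution.residual_eq`. For a test function supported well inside a triangle it reads
`∫ (f - A v) w = ∫ M(u - v) : κ(w)`. If the coefficients of `w` are those of the polynomial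
`A v - f_h`, then the norm of this polynomial is controlled by its integral against `w`, because on
a fixed finite dimensional space all norms are equivalent (`exists_coeff_bound`); this gives the
element estimate `exists_element_bound`.

For an edge, shape regularity makes the adjacent triangles fill their half-planes in a disc around
the midpoint, of radius a fixed multiple of the edge length (`RegularAt.mem_hull`). Hence on a test
function supported in that disc, Green's formula is the one on a half-plane
(`green_halfPlane`), with no contributions from vertices or other edges, and only the two boundary
terms `V w - M ∂ₙw` on the edge are left. A test function that is even in the normal direction near
the edge has `∂ₙw = 0` on it and isolates the effective shear forces (`exists_shear_bound`); one that
is odd vanishes on the edge and isolates the normal moments (`exists_moment_bound`). Again the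
tangential coefficients are those of the jump itself.

At a boundary edge, other parts of the domain may come arbitrarily close to the outer side of the
edge, so there the test function is multiplied by a second smooth cut-off, which separates the
triangle from all others (`RegularAt.boundary_hasLocalTest`). This cut-off is not controlled by the
mesh size, but on the closure of the domain it is locally constant wherever the test function lives,
and so it does not enter the estimates.
-/

noncomputable section

namespace Kirchhoff

/-! ### Partial derivatives of smooth functions -/

theorem contDiff_pd {w : Plane → ℝ} (hw : ContDiff ℝ ∞ w) (i : Fin 2) : ContDiff ℝ ∞ (pd i w) :=
  (hw.fderiv_right (m := ∞) (by norm_num)).clm_apply contDiff_const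

theorem differentiable_of_smooth {w : Plane → ℝ} (hw : ContDiff ℝ ∞ w) : Differentiable ℝ w :=
  hw.differentiable (by norm_num)

theorem pd_add {v w : Plane → ℝ} (hv : ContDiff ℝ ∞ v) (hw : ContDiff ℝ ∞ w) (i : Fin 2) :
    pd i (fun x => v x + w x) = fun x => pd i v x + pd i w x := by
  funext x
  simp only [pd]
  rw [fderiv_fun_add (differentiable_of_smooth hv x) (differentiable_of_smooth hw x)]
  rfl

theorem pd_const_mul {w : Plane → ℝ} (hw : ContDiff ℝ ∞ w) (c : ℝ) (i : Fin 2) :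
    pd i (fun x => c * w x) = fun x => c * pd i w x := by
  funext x
  simp only [pd]
  rw [fderiv_const_mul (differentiable_of_smooth hw x)]
  rfl

theorem pd_mul {v w : Plane → ℝ} (hv : ContDiff ℝ ∞ v) (hw : ContDiff ℝ ∞ w) (i : Fin 2) :
    pd i (fun x => v x * w x) = fun x => v x * pd i w x + pd i v x * w x := by
  funext x
  simp only [pd]
  rw [fderiv_fun_mul (differentiable_of_smooth hv x) (differentiable_of_smooth hw x)]
  simp [mul_comm]

theorem pd_comm {w : Plane → ℝ} (hw : ContDiff ℝ ∞ w) (i j : Fin 2) :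
    pd i (pd j w) = pd j (pd i w) := by
  have key : ∀ (i j : Fin 2) (x : Plane), pd i (pd j w) x
      = fderiv ℝ (fderiv ℝ w) x (EuclideanSpace.single i 1) (EuclideanSpace.single j 1) := by
    intro i j x
    have h : DifferentiableAt ℝ (fderiv ℝ w) x :=
      ((hw.fderiv_right (m := ∞) (by norm_num)).differentiable (by norm_num)) x
    change fderiv ℝ (fun y => fderiv ℝ w y (EuclideanSpace.single j 1)) x _ = _
    rw [fderiv_clm_apply h (differentiableAt_const _)]
    simp
  funext x
  rw [key, key]
  exact (hw.contDiffAt.isSymmSndFDerivAt (by simp; exact WithTop.coe_le_coe.2 (le_top : (2 : ℕ∞) ≤ ⊤))).eq _ _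

theorem pd_congr {v w : Plane → ℝ} {x : Plane} (h : v =ᶠ[𝓝 x] w) (i : Fin 2) :
    pd i v =ᶠ[𝓝 x] pd i w := by
  filter_upwards [h.fderiv (𝕜 := ℝ)] with y hy
  simp only [pd, hy]

theorem pd_eq_zero_of_notMem_tsupport {w : Plane → ℝ} {x : Plane} (h : x ∉ tsupport w)
    (i : Fin 2) : pd i w x = 0 := by
  simp [pd, fderiv_of_notMem_tsupport ℝ h]

theorem tsupport_pd_subset (w : Plane → ℝ) (i : Fin 2) : tsupport (pd i w) ⊆ tsupport w :=
  closure_minimal (fun x hx => by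
    by_contra h
    exact hx (pd_eq_zero_of_notMem_tsupport h i)) (isClosed_tsupport w)

theorem hasCompactSupport_pd {w : Plane → ℝ} (hw : HasCompactSupport w) (i : Fin 2) :
    HasCompactSupport (pd i w) :=
  hw.of_isClosed_subset (isClosed_tsupport _) (tsupport_pd_subset w i)

theorem eq_sum_single (v : Plane) : v = ∑ i, v i • EuclideanSpace.single i (1 : ℝ) := by
  ext j
  fin_cases j <;> simp [Fin.sum_univ_two]

theorem fderiv_eq_sum_pd (w : Plane → ℝ) (x v : Plane) :
    fderiv ℝ w x v = ∑ i, v i * pd i w x := by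
  conv_lhs => rw [eq_sum_single v]
  simp [pd]

theorem inner_eq (v w : Plane) : inner ℝ v w = v 0 * w 0 + v 1 * w 1 := by
  simp [PiLp.inner_apply, Fin.sum_univ_two, mul_comm]

theorem norm_sq_eq (v : Plane) : ‖v‖ ^ 2 = v 0 ^ 2 + v 1 ^ 2 := by
  rw [EuclideanSpace.norm_sq_eq]
  simp [Fin.sum_univ_two]

/-! ### Polynomial functions -/

theorem contDiff_polyFun (p : MvPolynomial (Fin 2) ℝ) : ContDiff ℝ ∞ (polyFun p) := by
  induction p using MvPolynomial.induction_on with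
  | C a =>
    have : polyFun (MvPolynomial.C a) = fun _ => a := by funext x; simp [polyFun]
    rw [this]; exact contDiff_const
  | add p q hp hq =>
    have : polyFun (p + q) = fun x => polyFun p x + polyFun q x := by
      funext x; simp [polyFun]
    rw [this]; exact hp.add hq
  | mul_X p i hp =>
    have : polyFun (p * MvPolynomial.X i) = fun x => polyFun p x * x i := by
      funext x; simp [polyFun]
    rw [this]
    exact hp.mul (contDiff_piLp_apply 2)

theorem pd_coord (i j : Fin 2) (x : Plane) : pd i (fun y : Plane => y j) x = if i = j then 1 else 0 := by
  have : fderiv ℝ (fun y : Plane => y j) x = EuclideanSpace.proj j :=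
    (EuclideanSpace.proj j : Plane →L[ℝ] ℝ).hasFDerivAt.fderiv
  simp only [pd, this]
  simp [eq_comm]

theorem pd_polyFun (p : MvPolynomial (Fin 2) ℝ) (i : Fin 2) :
    pd i (polyFun p) = polyFun (MvPolynomial.pderiv i p) := by
  induction p using MvPolynomial.induction_on with
  | C a =>
    have : polyFun (MvPolynomial.C a) = fun _ => a := by funext x; simp [polyFun]
    funext x
    rw [this]; simp [polyFun, pd]
  | add p q hp hq =>
    have : polyFun (p + q) = fun x => polyFun p x + polyFun q x := by
      funext x; simp [polyFun]
    rw [this, pd_add (contDiff_polyFun p) (contDiff_polyFun q), hp, hq]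
    funext x; simp [polyFun]
  | mul_X p j hp =>
    have : polyFun (p * MvPolynomial.X j) = fun x => polyFun p x * x j := by
      funext x; simp [polyFun]
    rw [this, pd_mul (contDiff_polyFun p) (contDiff_piLp_apply 2), hp]
    funext x
    rw [pd_coord]
    by_cases h : i = j
    · subst h; simp [polyFun]; ring
    · have h' : j ≠ i := Ne.symm h
      simp [polyFun, MvPolynomial.pderiv_X_of_ne h', h, mul_comm]

/-- `F` is a polynomial function on the plane, of degree at most `k`. -/
def IsPolyFun (k : ℕ) (F : Plane → ℝ) : Prop :=
  ∃ p : MvPolynomial (Fin 2) ℝ, p.totalDegree ≤ k ∧ F = polyFun p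

namespace IsPolyFun

variable {k : ℕ} {F G : Plane → ℝ}

theorem smooth (hF : IsPolyFun k F) : ContDiff ℝ ∞ F := by
  obtain ⟨p, -, rfl⟩ := hF
  exact contDiff_polyFun p

theorem mono {l : ℕ} (hF : IsPolyFun k F) (h : k ≤ l) : IsPolyFun l F := by
  obtain ⟨p, hp, rfl⟩ := hF
  exact ⟨p, hp.trans h, rfl⟩

theorem add (hF : IsPolyFun k F) (hG : IsPolyFun k G) : IsPolyFun k (fun x => F x + G x) := by
  obtain ⟨p, hp, rfl⟩ := hF
  obtain ⟨q, hq, rfl⟩ := hG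
  exact ⟨p + q, (MvPolynomial.totalDegree_add p q).trans (max_le hp hq), by funext x; simp [polyFun]⟩

theorem const_mul (hF : IsPolyFun k F) (c : ℝ) : IsPolyFun k (fun x => c * F x) := by
  obtain ⟨p, hp, rfl⟩ := hF
  refine ⟨c • p, (MvPolynomial.totalDegree_smul_le c p).trans hp, ?_⟩
  funext x; simp [polyFun]

theorem sub (hF : IsPolyFun k F) (hG : IsPolyFun k G) : IsPolyFun k (fun x => F x - G x) := by
  simpa [sub_eq_add_neg] using hF.add (hG.const_mul (-1))

theorem sum {ι : Type*} [Fintype ι] {F : ι → Plane → ℝ} (hF : ∀ i, IsPolyFun k (F i)) :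
    IsPolyFun k (fun x => ∑ i, F i x) := by
  choose p hp hF using hF
  refine ⟨∑ i, p i, MvPolynomial.totalDegree_finsetSum_le fun i _ => hp i, ?_⟩
  funext x; simp [polyFun, hF]

theorem pd (hF : IsPolyFun k F) (i : Fin 2) : IsPolyFun k (pd i F) := by
  obtain ⟨p, hp, rfl⟩ := hF
  refine ⟨MvPolynomial.pderiv i p, ?_, pd_polyFun p i⟩
  refine le_trans ?_ hp
  refine Finset.sup_le fun a ha => ?_
  rw [MvPolynomial.mem_support_iff, MvPolynomial.coeff_pderiv] at ha
  have h := MvPolynomial.le_totalDegree (MvPolynomial.mem_support_iff.2 (left_ne_zero_of_mul ha))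
  rw [Finsupp.sum_add_index' (fun _ => rfl) (fun _ _ _ => rfl)] at h
  exact le_trans (Nat.le_add_right _ _) h

end IsPolyFun

/-! ### Force quantities of smooth deflections -/

namespace Material

/-- The factor `d³/12 · E/(1+ν)` of the moment tensor. -/
def momentCoeff (m : Material) : ℝ := m.d ^ 3 / 12 * (m.E / (1 + m.ν))

/-- The ratio `ν/(1-ν)` in front of the trace in the constitutive relation. -/
def traceCoeff (m : Material) : ℝ := m.ν / (1 - m.ν)

theorem momentCoeff_mul (m : Material) : m.momentCoeff * (1 + m.traceCoeff) = m.stiffness := by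
  have h1 : 1 + m.ν ≠ 0 := by linarith [m.ν_gt]
  have h2 : 1 - m.ν ≠ 0 := by linarith [m.ν_lt]
  have h3 : 1 - m.ν ^ 2 ≠ 0 := by
    have : 1 - m.ν ^ 2 = (1 + m.ν) * (1 - m.ν) := by ring
    rw [this]; exact mul_ne_zero h1 h2
  have h4 : 1 - m.ν ^ 2 = (1 + m.ν) * (1 - m.ν) := by ring
  rw [momentCoeff, traceCoeff, stiffness, h4]
  field_simp
  ring

end Material

theorem curvature_apply (H : Matrix (Fin 2) (Fin 2) ℝ) (i j : Fin 2) :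
    curvature H i j = -(1 / 2 * (H i j + H j i)) := by
  simp [curvature]; ring

theorem momentOfHessian_apply (m : Material) (H : Matrix (Fin 2) (Fin 2) ℝ) (i j : Fin 2) :
    momentOfHessian m H i j = -m.momentCoeff *
      (1 / 2 * (H i j + H j i) + m.traceCoeff * (H 0 0 + H 1 1) * if i = j then 1 else 0) := by
  simp only [momentOfHessian, Material.constRel, Material.momentCoeff, Material.traceCoeff,
    Matrix.smul_apply, Matrix.add_apply, smul_eq_mul, Matrix.trace, Matrix.diag, Fin.sum_univ_two,
    curvature_apply, Matrix.one_apply]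
  ring

theorem moment_apply (m : Material) {w : Plane → ℝ} (hw : ContDiff ℝ ∞ w) (x : Plane)
    (i j : Fin 2) :
    moment m w x i j = -m.momentCoeff *
      (pd j (pd i w) x + m.traceCoeff * lap w x * if i = j then 1 else 0) := by
  have h : pd i (pd j w) x = pd j (pd i w) x := by rw [pd_comm hw]
  simp only [moment, momentOfHessian_apply, hessianAt, Matrix.of_apply, lap, Fin.sum_univ_two]
  rw [h]; ring

theorem moment_symm (m : Material) {w : Plane → ℝ} (hw : ContDiff ℝ ∞ w) (x : Plane)
    (i j : Fin 2) : moment m w x i j = moment m w x j i := by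
  rw [moment_apply m hw, moment_apply m hw, pd_comm hw i j]
  simp [eq_comm]

theorem contDiff_lap {w : Plane → ℝ} (hw : ContDiff ℝ ∞ w) : ContDiff ℝ ∞ (lap w) :=
  ContDiff.sum fun i _ => contDiff_pd (contDiff_pd hw i) i

theorem contDiff_moment (m : Material) {w : Plane → ℝ} (hw : ContDiff ℝ ∞ w) (i j : Fin 2) :
    ContDiff ℝ ∞ (fun x => moment m w x i j) := by
  simp only [moment_apply m hw]
  exact contDiff_const.mul ((contDiff_pd (contDiff_pd hw i) j).add
    ((contDiff_const.mul (contDiff_lap hw)).mul contDiff_const))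

theorem contDiff_shear (m : Material) {w : Plane → ℝ} (hw : ContDiff ℝ ∞ w) (i : Fin 2) :
    ContDiff ℝ ∞ (fun x => shear m w x i) :=
  ContDiff.sum fun j _ => contDiff_pd (contDiff_moment m hw i j) j

theorem contDiff_plateOp (m : Material) {w : Plane → ℝ} (hw : ContDiff ℝ ∞ w) :
    ContDiff ℝ ∞ (plateOp m w) :=
  contDiff_const.mul (contDiff_lap (contDiff_lap hw))

theorem pd_lap {w : Plane → ℝ} (hw : ContDiff ℝ ∞ w) (i : Fin 2) :
    pd i (lap w) = lap (pd i w) := by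
  have h : ∀ j, ContDiff ℝ ∞ (pd j (pd j w)) := fun j => contDiff_pd (contDiff_pd hw j) j
  have : lap w = fun x => pd 0 (pd 0 w) x + pd 1 (pd 1 w) x := by
    funext x; simp [lap, Fin.sum_univ_two]
  rw [this, pd_add (h 0) (h 1)]
  funext x
  simp only [lap, Fin.sum_univ_two]
  rw [pd_comm (contDiff_pd hw 0) i 0, pd_comm hw i 0, pd_comm (contDiff_pd hw 1) i 1, pd_comm hw i 1]

theorem shear_apply (m : Material) {w : Plane → ℝ} (hw : ContDiff ℝ ∞ w) (x : Plane)
    (i : Fin 2) : shear m w x i = -m.stiffness * pd i (lap w) x := by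
  have h2 : ∀ j, pd j (fun y => moment m w y i j) x = -m.momentCoeff *
      (pd j (pd j (pd i w)) x + m.traceCoeff * (if i = j then 1 else 0) * pd j (lap w) x) := by
    intro j
    have e : (fun y => moment m w y i j) = fun y => -m.momentCoeff *
      (pd j (pd i w) y + (m.traceCoeff * (if i = j then 1 else 0)) * lap w y) := by
      funext y; rw [moment_apply m hw]; ring
    have s1 := contDiff_pd (contDiff_pd hw i) j
    have s2 := contDiff_lap hw
    rw [e, pd_const_mul (s1.add (contDiff_const.mul s2)), pd_add s1 (contDiff_const.mul s2),
      pd_const_mul s2]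
  have h3 : pd i (lap w) x = pd 0 (pd 0 (pd i w)) x + pd 1 (pd 1 (pd i w)) x := by
    rw [pd_lap hw]; simp [lap, Fin.sum_univ_two]
  simp only [shear, Fin.sum_univ_two, h2]
  rw [← m.momentCoeff_mul]
  fin_cases i <;> simp at h3 ⊢ <;> rw [h3] <;> ring

/-- The plate operator is minus the divergence of the shear force. -/
theorem plateOp_eq (m : Material) {w : Plane → ℝ} (hw : ContDiff ℝ ∞ w) (x : Plane) :
    plateOp m w x = -∑ i, pd i (fun y => shear m w y i) x := by
  have s := contDiff_lap hw
  have h : ∀ i, pd i (fun y => shear m w y i) x = -m.stiffness * pd i (pd i (lap w)) x := by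
    intro i
    have e : (fun y => shear m w y i) = fun y => -m.stiffness * pd i (lap w) y := by
      funext y; exact shear_apply m hw y i
    rw [e, pd_const_mul (contDiff_pd s i)]
  simp only [h, plateOp, lap, Fin.sum_univ_two]
  ring

namespace IsPolyFun

variable {k : ℕ} {F : Plane → ℝ}

theorem lap (hF : IsPolyFun k F) : IsPolyFun k (lap F) := IsPolyFun.sum fun i => (hF.pd i).pd i

theorem plateOp (hF : IsPolyFun k F) (m : Material) : IsPolyFun k (plateOp m F) :=
  hF.lap.lap.const_mul _

theorem moment (hF : IsPolyFun k F) (m : Material) (i j : Fin 2) :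
    IsPolyFun k (fun x => moment m F x i j) := by
  have h := (((hF.pd i).pd j).add
    (hF.lap.const_mul (m.traceCoeff * if i = j then 1 else 0))).const_mul (-m.momentCoeff)
  refine (congrArg (IsPolyFun k) ?_).mp h
  funext x
  rw [moment_apply m hF.smooth]; ring

theorem mnn (hF : IsPolyFun k F) (m : Material) (n : Plane) : IsPolyFun k (Mnn m n F) := by
  refine IsPolyFun.sum fun i => IsPolyFun.sum fun j => ?_
  refine (congrArg (IsPolyFun k) ?_).mp ((hF.moment m i j).const_mul (n i * n j))
  funext x; ring

theorem mns (hF : IsPolyFun k F) (m : Material) (n : Plane) : IsPolyFun k (Mns m n F) := by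
  refine IsPolyFun.sum fun i => IsPolyFun.sum fun j => ?_
  refine (congrArg (IsPolyFun k) ?_).mp ((hF.moment m i j).const_mul (tangent n i * n j))
  funext x; ring

theorem qn (hF : IsPolyFun k F) (m : Material) (n : Plane) : IsPolyFun k (Qn m n F) := by
  refine IsPolyFun.sum fun i => ?_
  have h : IsPolyFun k (fun x => shear m F x i) :=
    IsPolyFun.sum fun j => (hF.moment m i j).pd j
  refine (congrArg (IsPolyFun k) ?_).mp (h.const_mul (n i))
  funext x; ring

theorem vn (hF : IsPolyFun k F) (m : Material) (n : Plane) : IsPolyFun k (Vn m n F) := by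
  refine (hF.qn m n).add ?_
  simp only [fderiv_eq_sum_pd]
  exact IsPolyFun.sum fun i => ((hF.mns m n).pd i).const_mul _

end IsPolyFun

/-! ### Smooth test functions as elements of `V` -/

theorem hasWeakDeriv_of_contDiff (Ω : Set Plane) {w : Plane → ℝ} (hw : ContDiff ℝ ∞ w)
    (i : Fin 2) : HasWeakDeriv Ω i w (pd i w) := by
  intro φ hφ hc hΩ
  have hz : ∀ x, x ∉ Ω → φ x = 0 := fun x hx => image_eq_zero_of_notMem_tsupport fun h => hx (hΩ h)
  have hz' : ∀ x, x ∉ Ω → pd i φ x = 0 := fun x hx =>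
    pd_eq_zero_of_notMem_tsupport (fun h => hx (hΩ h)) i
  rw [setIntegral_eq_integral_of_forall_compl_eq_zero (fun x hx => by rw [hz' x hx, mul_zero]),
    setIntegral_eq_integral_of_forall_compl_eq_zero (fun x hx => by rw [hz x hx, mul_zero])]
  refine integral_mul_fderiv_eq_neg_fderiv_mul_of_integrable ?_ ?_ ?_
    (fun x _ => differentiable_of_smooth hw x) (fun x _ => differentiable_of_smooth hφ x)
  · exact ((contDiff_pd hw i).continuous.mul hφ.continuous).integrable_of_hasCompactSupport
      hc.mul_left
  · exact (hw.continuous.mul (contDiff_pd hφ i).continuous).integrable_of_hasCompactSupport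
      (hasCompactSupport_pd hc i).mul_left
  · exact (hw.continuous.mul hφ.continuous).integrable_of_hasCompactSupport hc.mul_left

theorem isH1_of_contDiff (Ω : Set Plane) {w : Plane → ℝ} (hw : ContDiff ℝ ∞ w)
    (hc : HasCompactSupport w) : IsH1 Ω w (fun i => pd i w) where
  memLp := (hw.continuous.memLp_of_hasCompactSupport hc).restrict Ω
  memLp_grad i := ((contDiff_pd hw i).continuous.memLp_of_hasCompactSupport
    (hasCompactSupport_pd hc i)).restrict Ω
  weak := hasWeakDeriv_of_contDiff Ω hw

/-- A smooth compactly supported function on the plane, as an element of `H²(Ω)`. -/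
def smoothH2 (Ω : Set Plane) {w : Plane → ℝ} (hw : ContDiff ℝ ∞ w) (hc : HasCompactSupport w) :
    H2Function Ω where
  val := w
  grad i := pd i w
  hess i j := pd j (pd i w)
  continuousOn := hw.continuous.continuousOn
  isH1 := isH1_of_contDiff Ω hw hc
  isH1_grad i := isH1_of_contDiff Ω (contDiff_pd hw i) (hasCompactSupport_pd hc i)

theorem hasZeroTrace_of_finite {Ω Γ : Set Plane} {w : Plane → ℝ} {dw : Fin 2 → Plane → ℝ}
    (hw : Continuous w) (h1 : IsH1 Ω w dw) (hΓ : (Γ ∩ {x | w x ≠ 0}).Finite) :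
    HasZeroTrace Ω Γ w dw := by
  refine ⟨fun _ => w, fun _ => dw, fun _ => hw.continuousOn, fun _ => h1, by simp, ?_⟩
  have : ∫ x in Γ, w x ^ 2 ∂μH[1] = 0 := by
    refine integral_eq_zero_of_ae ?_
    have := Measure.nullSingletonClass_hausdorff Plane (d := 1) one_pos
    have h0 : (μH[1] : Measure Plane) (Γ ∩ {x | w x ≠ 0}) = 0 :=
      Set.Finite.measure_zero hΓ _
    have hm : MeasurableSet {x : Plane | ¬ w x ^ 2 = 0} :=
      (isClosed_singleton.preimage (hw.pow 2)).measurableSet.compl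
    rw [Filter.EventuallyEq, ae_iff]
    simp only [Pi.zero_apply]
    rw [Measure.restrict_apply hm]
    refine measure_mono_null ?_ h0
    rintro x ⟨hx, hxΓ⟩
    exact ⟨hxΓ, fun h => hx (by simp [h])⟩
  simp [this]

/-- A smooth test function is admissible as soon as it satisfies the essential boundary conditions
up to finitely many points, which carry no length. -/
theorem memV_smoothH2 (P : Plate) {w : Plane → ℝ} (hw : ContDiff ℝ ∞ w)
    (hc : HasCompactSupport w) (h0 : ((P.Γc ∪ P.Γs) ∩ {x | w x ≠ 0}).Finite)
    (h1 : (P.Γc ∩ tsupport w).Finite) : MemV P (smoothH2 P.Ω hw hc) where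
  zero := hasZeroTrace_of_finite hw.continuous (isH1_of_contDiff _ hw hc) h0
  normal_zero a b n _ hab _ _ := by
    let W : Plane → ℝ := fun x => ∑ i, n i * pd i w x
    have hW : ContDiff ℝ ∞ W := ContDiff.sum fun i _ => contDiff_const.mul (contDiff_pd hw i)
    have hz : ∀ x, x ∉ tsupport w → W x = 0 := fun x hx =>
      Finset.sum_eq_zero fun i _ => by rw [pd_eq_zero_of_notMem_tsupport hx, mul_zero]
    have hWc : HasCompactSupport W := HasCompactSupport.intro hc fun x hx => hz x hx
    have e : (fun j x => ∑ i, n i * (smoothH2 P.Ω hw hc).hess i j x) = fun j => pd j W := by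
      funext j x
      have c0 := contDiff_pd hw 0
      have c1 := contDiff_pd hw 1
      have : W = fun x => n 0 * pd 0 w x + n 1 * pd 1 w x := by
        funext x; simp [W, Fin.sum_univ_two]
      rw [this, pd_add (contDiff_const.mul c0) (contDiff_const.mul c1), pd_const_mul c0,
        pd_const_mul c1]
      simp [smoothH2, Fin.sum_univ_two]
    rw [e]
    refine hasZeroTrace_of_finite hW.continuous (isH1_of_contDiff _ hW hWc) ?_
    refine h1.subset ?_
    rintro x ⟨hx, hne⟩
    exact ⟨hab hx, by_contra fun h => hne (hz x h)⟩

/-! ### Weak derivatives of finite element functions -/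

/-- Weak derivatives on `Ω` are unique on every open subset: where the function is smooth, they
are the classical ones. -/
theorem HasWeakDeriv.ae_eq_pd {Ω U : Set Plane} {i : Fin 2} {w g p : Plane → ℝ}
    (h : HasWeakDeriv Ω i w g) (hΩ : IsOpen Ω) (hU : IsOpen U) (hUΩ : U ⊆ Ω)
    (hp : ContDiff ℝ ∞ p) (hwp : ∀ᵐ x ∂volume.restrict U, w x = p x)
    (hg : MemLp g 2 (volume.restrict Ω)) :
    ∀ᵐ x ∂volume.restrict U, g x = pd i p x := by
  have hgU : LocallyIntegrableOn (fun x => g x - pd i p x) U := by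
    have h1 : LocallyIntegrable g (volume.restrict U) :=
      (hg.mono_measure (Measure.restrict_mono hUΩ le_rfl)).locallyIntegrable (by norm_num)
    have h2 : LocallyIntegrableOn g U :=
      locallyIntegrableOn_of_locallyIntegrable_restrict h1
    exact h2.sub ((contDiff_pd hp i).continuous.locallyIntegrable.locallyIntegrableOn U)
  have key := hU.ae_eq_zero_of_integral_contDiff_smul_eq_zero hgU (μ := volume) ?_
  · rw [ae_restrict_iff' hU.measurableSet]
    filter_upwards [key] with x hx hxU
    linarith [hx hxU]
  intro φ hφ hc hφU
  have hz : ∀ x, x ∉ U → φ x = 0 := fun x hx => image_eq_zero_of_notMem_tsupport fun h => hx (hφU h)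
  have hz' : ∀ x, x ∉ U → pd i φ x = 0 := fun x hx =>
    pd_eq_zero_of_notMem_tsupport (fun h => hx (hφU h)) i
  have e1 := h φ hφ hc (hφU.trans hUΩ)
  have e2 := hasWeakDeriv_of_contDiff U hp i φ hφ hc hφU
  have r1 : ∫ x in Ω, w x * pd i φ x = ∫ x in U, w x * pd i φ x :=
    setIntegral_eq_of_subset_of_forall_sdiff_eq_zero hΩ.measurableSet hUΩ
      (fun x hx => by rw [hz' x hx.2, mul_zero])
  have r2 : ∫ x in Ω, g x * φ x = ∫ x in U, g x * φ x :=
    setIntegral_eq_of_subset_of_forall_sdiff_eq_zero hΩ.measurableSet hUΩ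
      (fun x hx => by rw [hz x hx.2, mul_zero])
  have r3 : ∫ x in U, w x * pd i φ x = ∫ x in U, p x * pd i φ x :=
    integral_congr_ae (hwp.mono fun x hx => by simp only [hx])
  have hgφ : IntegrableOn (fun x => g x * φ x) U :=
    MemLp.integrable_mul (p := 2) (q := 2) (hg.mono_measure (Measure.restrict_mono hUΩ le_rfl))
      ((hφ.continuous.memLp_of_hasCompactSupport hc).restrict U)
  have hpφ : IntegrableOn (fun x => pd i p x * φ x) U :=
    (((contDiff_pd hp i).continuous.mul hφ.continuous).integrable_of_hasCompactSupport
      hc.mul_left).integrableOn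
  have : ∫ x, φ x • (g x - pd i p x) = ∫ x in U, (g x * φ x - pd i p x * φ x) := by
    rw [setIntegral_eq_integral_of_forall_compl_eq_zero (fun x hx => by rw [hz x hx]; ring)]
    congr 1; funext x; simp only [smul_eq_mul]; ring
  rw [this, integral_sub hgφ hpφ]
  linarith

/-! ### Orthonormal frames and the half-plane -/

theorem norm_tangent (n : Plane) : ‖tangent n‖ = ‖n‖ := by
  have h : ‖tangent n‖ ^ 2 = ‖n‖ ^ 2 := by
    rw [norm_sq_eq, norm_sq_eq]; simp [tangent]; ring
  exact (pow_left_inj₀ (norm_nonneg _) (norm_nonneg _) two_ne_zero).1 h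

theorem inner_tangent_self (n : Plane) : inner ℝ (tangent n) n = 0 := by
  rw [inner_eq]; simp [tangent]; ring

theorem unit_sq {n : Plane} (hn : ‖n‖ = 1) : n 0 ^ 2 + n 1 ^ 2 = 1 := by
  rw [← norm_sq_eq, hn, one_pow]

/-- The point with coordinates `(t, y)` in the frame with origin `m` and axes `tangent n`, `n`. -/
def frameMap (n m : Plane) (z : ℝ × ℝ) : Plane := m + z.1 • tangent n + z.2 • n

theorem continuous_frameMap (n m : Plane) : Continuous (frameMap n m) := by
  unfold frameMap; fun_prop

theorem contDiff_frameMap (n m : Plane) : ContDiff ℝ ∞ (frameMap n m) := by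
  unfold frameMap; fun_prop

theorem inner_frameMap {n : Plane} (hn : ‖n‖ = 1) (m : Plane) (z : ℝ × ℝ) :
    inner ℝ n (frameMap n m z - m) = z.2 := by
  have h := unit_sq hn
  rw [inner_eq]; simp [frameMap, tangent]; linear_combination z.2 * h

theorem inner_tangent_frameMap {n : Plane} (hn : ‖n‖ = 1) (m : Plane) (z : ℝ × ℝ) :
    inner ℝ (tangent n) (frameMap n m z - m) = z.1 := by
  have h := unit_sq hn
  rw [inner_eq]; simp [frameMap, tangent]; linear_combination z.1 * h

theorem frameMap_inner {n : Plane} (hn : ‖n‖ = 1) (m x : Plane) :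
    frameMap n m (inner ℝ (tangent n) (x - m), inner ℝ n (x - m)) = x := by
  have h := unit_sq hn
  ext i
  fin_cases i
  · simp [frameMap, tangent, inner_eq]; linear_combination (x 0 - m 0) * h
  · simp [frameMap, tangent, inner_eq]; linear_combination (x 1 - m 1) * h

theorem norm_frameMap_sub {n : Plane} (hn : ‖n‖ = 1) (m : Plane) (z : ℝ × ℝ) :
    ‖frameMap n m z - m‖ ^ 2 = z.1 ^ 2 + z.2 ^ 2 := by
  have h := unit_sq hn
  rw [norm_sq_eq]; simp [frameMap, tangent]; linear_combination (z.1 ^ 2 + z.2 ^ 2) * h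

theorem norm_sub_sq {n : Plane} (hn : ‖n‖ = 1) (m x : Plane) :
    ‖x - m‖ ^ 2 = inner ℝ (tangent n) (x - m) ^ 2 + inner ℝ n (x - m) ^ 2 := by
  conv_lhs => rw [← frameMap_inner hn m x]
  rw [norm_frameMap_sub hn]

theorem frameMap_injective {n : Plane} (hn : ‖n‖ = 1) (m : Plane) :
    Function.Injective (frameMap n m) := fun z z' h => by
  ext
  · rw [← inner_tangent_frameMap hn m z, h, inner_tangent_frameMap hn]
  · rw [← inner_frameMap hn m z, h, inner_frameMap hn]

theorem measurableEmbedding_frameMap {n : Plane} (hn : ‖n‖ = 1) (m : Plane) :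
    MeasurableEmbedding (frameMap n m) :=
  (continuous_frameMap n m).measurableEmbedding (frameMap_injective hn m)

theorem measurePreserving_frameMap {n : Plane} (hn : ‖n‖ = 1) (m : Plane) :
    MeasurePreserving (frameMap n m) := by
  have ho : Orthonormal ℝ ![tangent n, n] := by
    rw [orthonormal_iff_ite]
    intro i j
    fin_cases i <;> fin_cases j <;>
      simp [hn, norm_tangent, inner_tangent_self, real_inner_comm (tangent n) n]
  let b : OrthonormalBasis (Fin 2) ℝ Plane :=
    (basisOfOrthonormalOfCardEqFinrank ho (by simp)).toOrthonormalBasis (by simpa using ho)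
  have hb : ⇑b = ![tangent n, n] := by simp [b]
  have h1 := (volume_preserving_finTwoArrow ℝ).symm
  have h2 := EuclideanSpace.volume_preserving_symm_measurableEquiv_toLp (Fin 2)
  have h3 := b.measurePreserving_repr_symm
  have h4 := measurePreserving_add_left (volume : Measure Plane) m
  have h := h4.comp (h3.comp (h2.symm.comp h1))
  convert! h using 1
  funext z
  simp [frameMap, ← b.sum_repr_symm, hb, Fin.sum_univ_two, add_assoc]

theorem integral_frameMap {n : Plane} (hn : ‖n‖ = 1) (m : Plane) (F : Plane → ℝ) :
    ∫ z, F (frameMap n m z) = ∫ x, F x :=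
  (measurePreserving_frameMap hn m).integral_comp (measurableEmbedding_frameMap hn m) F

/-- The closed half-plane through `m` with outer normal `n`. -/
def halfPlane (n m : Plane) : Set Plane := {x | inner ℝ n (x - m) ≤ 0}

theorem isClosed_halfPlane (n m : Plane) : IsClosed (halfPlane n m) :=
  isClosed_le (by fun_prop) continuous_const

theorem convex_halfPlane (n m : Plane) : Convex ℝ (halfPlane n m) := by
  intro x hx y hy a b ha hb hab
  simp only [halfPlane, Set.mem_ofPred_eq] at *
  have : a • x + b • y - m = a • (x - m) + b • (y - m) := by
    calc a • x + b • y - m = a • x + b • y - (a + b) • m := by rw [hab, one_smul]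
      _ = _ := by module
  rw [this, inner_add_right, inner_smul_right, inner_smul_right]
  nlinarith

theorem setIntegral_halfPlane {n : Plane} (hn : ‖n‖ = 1) (m : Plane) {F : Plane → ℝ}
    (hF : Continuous F) (hc : HasCompactSupport F) :
    ∫ x in halfPlane n m, F x = ∫ t : ℝ, ∫ y in Set.Iic (0 : ℝ), F (frameMap n m (t, y)) := by
  have hpre : frameMap n m ⁻¹' halfPlane n m = Set.univ ×ˢ Set.Iic 0 := by
    ext z; simp [halfPlane, inner_frameMap hn]
  rw [← (measurePreserving_frameMap hn m).setIntegral_preimage_emb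
    (measurableEmbedding_frameMap hn m), hpre, Measure.volume_eq_prod,
    setIntegral_prod (fun z => F (frameMap n m z)), Measure.restrict_univ]
  refine Integrable.integrableOn ?_
  exact (measurePreserving_frameMap hn m).integrable_comp_of_integrable
    (hF.integrable_of_hasCompactSupport hc)

theorem hasCompactSupport_frame {n : Plane} (hn : ‖n‖ = 1) (m : Plane) {F : Plane → ℝ}
    (hc : HasCompactSupport F) : HasCompactSupport (fun z => F (frameMap n m z)) := by
  refine HasCompactSupport.intro (K := (fun x : Plane => ((inner ℝ (tangent n) (x - m) : ℝ),
    (inner ℝ n (x - m) : ℝ))) '' tsupport F) (hc.isCompact.image (by fun_prop)) fun z hz => ?_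
  refine image_eq_zero_of_notMem_tsupport fun h => hz ⟨_, h, ?_⟩
  simp [inner_frameMap hn, inner_tangent_frameMap hn]

theorem hasDerivAt_frame_fst (n m : Plane) {F : Plane → ℝ} (hF : Differentiable ℝ F) (t y : ℝ) :
    HasDerivAt (fun t => F (frameMap n m (t, y))) (fderiv ℝ F (frameMap n m (t, y)) (tangent n)) t := by
  have h : HasDerivAt (fun t : ℝ => frameMap n m (t, y)) (tangent n) t := by
    simpa [frameMap] using! (((hasDerivAt_id t).smul_const (tangent n)).const_add m).add_const (y • n)
  exact (hF _).hasFDerivAt.comp_hasDerivAt t h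

theorem hasDerivAt_frame_snd (n m : Plane) {F : Plane → ℝ} (hF : Differentiable ℝ F) (t y : ℝ) :
    HasDerivAt (fun y => F (frameMap n m (t, y))) (fderiv ℝ F (frameMap n m (t, y)) n) y := by
  have h : HasDerivAt (fun y : ℝ => frameMap n m (t, y)) n y := by
    simpa [frameMap] using! ((hasDerivAt_id y).smul_const n).const_add (m + t • tangent n)
  exact (hF _).hasFDerivAt.comp_hasDerivAt y h

theorem hasCompactSupport_slice_fst {G : ℝ × ℝ → ℝ} (hc : HasCompactSupport G) (y : ℝ) :
    HasCompactSupport (fun t => G (t, y)) :=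
  HasCompactSupport.intro (hc.isCompact.image continuous_fst) fun _ ht =>
    image_eq_zero_of_notMem_tsupport fun h => ht ⟨_, h, rfl⟩

theorem hasCompactSupport_slice_snd {G : ℝ × ℝ → ℝ} (hc : HasCompactSupport G) (t : ℝ) :
    HasCompactSupport (fun y => G (t, y)) :=
  HasCompactSupport.intro (hc.isCompact.image continuous_snd) fun _ hy =>
    image_eq_zero_of_notMem_tsupport fun h => hy ⟨_, h, rfl⟩

/-- The integral over the line through `m` with normal `n`. -/
def lineIntegral (n m : Plane) (F : Plane → ℝ) : ℝ := ∫ t : ℝ, F (frameMap n m (t, 0))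

theorem setIntegral_halfPlane_normal {n : Plane} (hn : ‖n‖ = 1) (m : Plane) {G : Plane → ℝ}
    (hG : ContDiff ℝ ∞ G) (hc : HasCompactSupport G) :
    ∫ x in halfPlane n m, fderiv ℝ G x n = lineIntegral n m G := by
  have hd : HasCompactSupport (fun x => fderiv ℝ G x n) := hc.fderiv_apply ℝ n
  have hcd : Continuous (fun x => fderiv ℝ G x n) :=
    ((hG.fderiv_right (m := ∞) (by norm_num)).clm_apply contDiff_const).continuous
  rw [setIntegral_halfPlane hn m hcd hd, lineIntegral]
  congr 1
  funext t
  have h1 : ContDiff ℝ 1 (fun y => G (frameMap n m (t, y))) :=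
    ((hG.comp (contDiff_frameMap n m)).comp (contDiff_const.prodMk contDiff_id)).of_le (by norm_num)
  have h2 : HasCompactSupport (fun y => G (frameMap n m (t, y))) :=
    hasCompactSupport_slice_snd (hasCompactSupport_frame hn m hc) t
  rw [← h2.integral_Iic_deriv_eq h1 0]
  congr 1
  funext y
  exact (hasDerivAt_frame_snd n m (differentiable_of_smooth hG) t y).deriv.symm

theorem integral_deriv_eq_zero {g : ℝ → ℝ} (hg : ContDiff ℝ ∞ g) (hc : HasCompactSupport g) :
    ∫ t, deriv g t = 0 := by
  refine integral_eq_zero_of_hasDerivAt_of_integrable (f := g)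
    (fun t => (hg.differentiable (by norm_num) t).hasDerivAt) ?_ ?_
  · exact (hg.continuous_deriv (by norm_num)).integrable_of_hasCompactSupport hc.deriv
  · exact hg.continuous.integrable_of_hasCompactSupport hc

theorem integrable_frame_halfPlane {n : Plane} (hn : ‖n‖ = 1) (m : Plane) {F : Plane → ℝ}
    (hF : Continuous F) (hc : HasCompactSupport F) :
    Integrable (fun z : ℝ × ℝ => F (frameMap n m z))
      ((volume : Measure ℝ).prod (volume.restrict (Set.Iic 0))) := by
  have a : IntegrableOn (fun z => F (frameMap n m z)) (Set.univ ×ˢ Set.Iic (0 : ℝ)) :=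
    ((hF.comp (continuous_frameMap n m)).integrable_of_hasCompactSupport
      (hasCompactSupport_frame hn m hc)).integrableOn
  rwa [IntegrableOn, Measure.volume_eq_prod, ← Measure.prod_restrict, Measure.restrict_univ] at a

theorem setIntegral_halfPlane_tangent {n : Plane} (hn : ‖n‖ = 1) (m : Plane) {G : Plane → ℝ}
    (hG : ContDiff ℝ ∞ G) (hc : HasCompactSupport G) :
    ∫ x in halfPlane n m, fderiv ℝ G x (tangent n) = 0 := by
  have hd : HasCompactSupport (fun x => fderiv ℝ G x (tangent n)) := hc.fderiv_apply ℝ _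
  have hcd : Continuous (fun x => fderiv ℝ G x (tangent n)) :=
    ((hG.fderiv_right (m := ∞) (by norm_num)).clm_apply contDiff_const).continuous
  rw [setIntegral_halfPlane hn m hcd hd, integral_integral_swap]
  · refine integral_eq_zero_of_ae (Eventually.of_forall fun y => ?_)
    have h1 : ContDiff ℝ ∞ (fun t => G (frameMap n m (t, y))) :=
      (hG.comp (contDiff_frameMap n m)).comp (contDiff_id.prodMk contDiff_const)
    have h2 : HasCompactSupport (fun t => G (frameMap n m (t, y))) :=
      hasCompactSupport_slice_fst (hasCompactSupport_frame hn m hc) y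
    rw [Pi.zero_apply, ← integral_deriv_eq_zero h1 h2]
    refine integral_congr_ae (Eventually.of_forall fun t => ?_)
    exact (hasDerivAt_frame_fst n m (differentiable_of_smooth hG) t y).deriv.symm
  · exact integrable_frame_halfPlane hn m (F := fun x => fderiv ℝ G x (tangent n)) hcd hd

theorem setIntegral_halfPlane_pd {n : Plane} (hn : ‖n‖ = 1) (m : Plane) {G : Plane → ℝ}
    (hG : ContDiff ℝ ∞ G) (hc : HasCompactSupport G) (i : Fin 2) :
    ∫ x in halfPlane n m, pd i G x = n i * lineIntegral n m G := by
  have h := unit_sq hn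
  have e : ∀ x, pd i G x = tangent n i * fderiv ℝ G x (tangent n) + n i * fderiv ℝ G x n := by
    intro x
    simp only [fderiv_eq_sum_pd, Fin.sum_univ_two]
    fin_cases i
    · simp [tangent]; linear_combination (-pd 0 G x) * h
    · simp [tangent]; linear_combination (-pd 1 G x) * h
  have hi : ∀ v, IntegrableOn (fun x => fderiv ℝ G x v) (halfPlane n m) := fun v =>
    (((hG.fderiv_right (m := ∞) (by norm_num)).clm_apply
      contDiff_const).continuous.integrable_of_hasCompactSupport (hc.fderiv_apply ℝ v)).integrableOn
  simp only [e]
  rw [integral_add ((hi _).const_mul _) ((hi _).const_mul _), integral_const_mul, integral_const_mul,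
    setIntegral_halfPlane_tangent hn m hG hc, setIntegral_halfPlane_normal hn m hG hc]
  ring

/-! ### Green's formula -/

/-- The vector field whose divergence is the difference of the bending energy density and the
density of the work of `A(q)`. -/
def greenField (m : Material) (q w : Plane → ℝ) (j : Fin 2) (x : Plane) : ℝ :=
  shear m q x j * w x - ∑ i, moment m q x i j * pd i w x

theorem contDiff_greenField (m : Material) {q w : Plane → ℝ} (hq : ContDiff ℝ ∞ q)
    (hw : ContDiff ℝ ∞ w) (j : Fin 2) : ContDiff ℝ ∞ (greenField m q w j) :=
  ((contDiff_shear m hq j).mul hw).sub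
    (ContDiff.sum fun i _ => (contDiff_moment m hq i j).mul (contDiff_pd hw i))

theorem greenField_eq_zero (m : Material) (q : Plane → ℝ) {w : Plane → ℝ} {x : Plane}
    (hx : x ∉ tsupport w) (j : Fin 2) : greenField m q w j x = 0 := by
  simp [greenField, image_eq_zero_of_notMem_tsupport hx, pd_eq_zero_of_notMem_tsupport hx]

theorem hasCompactSupport_greenField (m : Material) (q : Plane → ℝ) {w : Plane → ℝ}
    (hc : HasCompactSupport w) (j : Fin 2) : HasCompactSupport (greenField m q w j) :=
  HasCompactSupport.intro hc fun _ hx => greenField_eq_zero m q hx j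

/-- The energy density `M(q) : κ(w)`. -/
def energyDensity (m : Material) (q w : Plane → ℝ) (x : Plane) : ℝ :=
  ∑ i, ∑ j, moment m q x i j * curvature (hessianAt w x) i j

theorem energyDensity_eq (m : Material) {q w : Plane → ℝ} (hq : ContDiff ℝ ∞ q)
    (hw : ContDiff ℝ ∞ w) (x : Plane) :
    energyDensity m q w x = plateOp m q x * w x + ∑ j, pd j (greenField m q w j) x := by
  have hM := fun i j => contDiff_moment m hq i j
  have hQ := fun j => contDiff_shear m hq j
  have hd := fun i => contDiff_pd hw i
  have e : ∀ j, pd j (greenField m q w j) x =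
      (shear m q x j * pd j w x + pd j (fun y => shear m q y j) x * w x)
      + (-1) * ((moment m q x 0 j * pd j (pd 0 w) x + pd j (fun y => moment m q y 0 j) x * pd 0 w x)
      + (moment m q x 1 j * pd j (pd 1 w) x + pd j (fun y => moment m q y 1 j) x * pd 1 w x)) := by
    intro j
    have : greenField m q w j = fun x => shear m q x j * w x
        + (-1) * (moment m q x 0 j * pd 0 w x + moment m q x 1 j * pd 1 w x) := by
      funext x; simp [greenField, Fin.sum_univ_two]; ring
    rw [this, pd_add ((hQ j).mul hw) (contDiff_const.mul
      (((hM 0 j).mul (hd 0)).add ((hM 1 j).mul (hd 1)))), pd_mul (hQ j) hw,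
      pd_const_mul (((hM 0 j).mul (hd 0)).add ((hM 1 j).mul (hd 1))),
      pd_add ((hM 0 j).mul (hd 0)) ((hM 1 j).mul (hd 1)), pd_mul (hM 0 j) (hd 0),
      pd_mul (hM 1 j) (hd 1)]
  have c : pd 0 (pd 1 w) x = pd 1 (pd 0 w) x := by rw [pd_comm hw]
  have c2 : moment m q x 1 0 = moment m q x 0 1 := moment_symm m hq x 1 0
  rw [plateOp_eq m hq]
  simp only [energyDensity, Fin.sum_univ_two, curvature_apply, hessianAt, Matrix.of_apply, e, c, c2]
  simp only [shear, Fin.sum_univ_two]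
  ring

theorem integrableOn_mul_smooth {q w : Plane → ℝ} (hq : ContDiff ℝ ∞ q) (hw : ContDiff ℝ ∞ w)
    (hc : HasCompactSupport w) (D : Set Plane) : IntegrableOn (fun x => q x * w x) D :=
  ((hq.continuous.mul hw.continuous).integrable_of_hasCompactSupport hc.mul_left).integrableOn

theorem setIntegral_energyDensity (m : Material) {q w : Plane → ℝ} (hq : ContDiff ℝ ∞ q)
    (hw : ContDiff ℝ ∞ w) (hc : HasCompactSupport w) (D : Set Plane) :
    ∫ x in D, energyDensity m q w x = (∫ x in D, plateOp m q x * w x)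
      + ∑ j, ∫ x in D, pd j (greenField m q w j) x := by
  have hi : ∀ j, IntegrableOn (pd j (greenField m q w j)) D := fun j =>
    ((contDiff_pd (contDiff_greenField m hq hw j) j).continuous.integrable_of_hasCompactSupport
      (hasCompactSupport_pd (hasCompactSupport_greenField m q hc j) j)).integrableOn
  simp only [energyDensity_eq m hq hw]
  rw [integral_add (integrableOn_mul_smooth (contDiff_plateOp m hq) hw hc D)
    (integrable_finsetSum _ fun j _ => hi j), integral_finsetSum _ fun j _ => hi j]

/-- Green's formula on a half-plane: two integrations by parts in the plane and one along the
boundary line, where the twisting moment is absorbed into the effective shear force. -/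
theorem green_halfPlane (m : Material) {n : Plane} (hn : ‖n‖ = 1) (o : Plane) {q w : Plane → ℝ}
    (hq : ContDiff ℝ ∞ q) (hw : ContDiff ℝ ∞ w) (hc : HasCompactSupport w) :
    ∫ x in halfPlane n o, energyDensity m q w x = (∫ x in halfPlane n o, plateOp m q x * w x)
      + lineIntegral n o (fun x => Vn m n q x * w x - Mnn m n q x * fderiv ℝ w x n) := by
  have hg := fun j => contDiff_greenField m hq hw j
  have hgc := fun j => hasCompactSupport_greenField m q hc j
  rw [setIntegral_energyDensity m hq hw hc]
  congr 1
  simp only [setIntegral_halfPlane_pd hn o (hg _) (hgc _), Fin.sum_univ_two, lineIntegral]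
  have hslice : ∀ {F : Plane → ℝ}, ContDiff ℝ ∞ F → ContDiff ℝ ∞ (fun t => F (frameMap n o (t, 0))) :=
    fun hF => (hF.comp (contDiff_frameMap n o)).comp (contDiff_id.prodMk contDiff_const)
  have hslicec : ∀ {F : Plane → ℝ}, HasCompactSupport F →
      HasCompactSupport (fun t => F (frameMap n o (t, 0))) :=
    fun hF => hasCompactSupport_slice_fst (hasCompactSupport_frame hn o hF) 0
  have hMns : ContDiff ℝ ∞ (Mns m n q) := ContDiff.sum fun i _ => ContDiff.sum fun j _ =>
    (contDiff_const.mul (contDiff_moment m hq i j)).mul contDiff_const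
  have hint : ∀ {F : Plane → ℝ}, ContDiff ℝ ∞ F → HasCompactSupport F →
      Integrable (fun t => F (frameMap n o (t, 0))) := fun h h' =>
    (hslice h).continuous.integrable_of_hasCompactSupport (hslicec h')
  have hP : ContDiff ℝ ∞ (fun x => Mns m n q x * w x) := hMns.mul hw
  have hPc : HasCompactSupport (fun x => Mns m n q x * w x) := hc.mul_left
  have h0 : ∫ t, fderiv ℝ (fun x => Mns m n q x * w x) (frameMap n o (t, 0)) (tangent n) = 0 := by
    refine Eq.trans (integral_congr_ae (Eventually.of_forall fun t => ?_))
      (integral_deriv_eq_zero (hslice hP) (hslicec hPc))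
    exact (hasDerivAt_frame_fst n o (differentiable_of_smooth hP) t 0).deriv.symm
  have hder : ContDiff ℝ ∞ (fun x => fderiv ℝ (fun x => Mns m n q x * w x) x (tangent n)) :=
    (hP.fderiv_right (m := ∞) (by norm_num)).clm_apply contDiff_const
  have hi : Integrable (fun t => n 0 * greenField m q w 0 (frameMap n o (t, 0))
      + n 1 * greenField m q w 1 (frameMap n o (t, 0))) := ((hint (hg 0) (hgc 0)).const_mul (n 0)).add ((hint (hg 1) (hgc 1)).const_mul (n 1))
  have hj := hint hder (hPc.fderiv_apply ℝ _)
  calc _ = ∫ t, (n 0 * greenField m q w 0 (frameMap n o (t, 0))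
          + n 1 * greenField m q w 1 (frameMap n o (t, 0))) := by
        rw [integral_add ((hint (hg 0) (hgc 0)).const_mul _) ((hint (hg 1) (hgc 1)).const_mul _),
          integral_const_mul, integral_const_mul]
    _ = (∫ t, (n 0 * greenField m q w 0 (frameMap n o (t, 0))
          + n 1 * greenField m q w 1 (frameMap n o (t, 0)))) +
        ∫ t, fderiv ℝ (fun x => Mns m n q x * w x) (frameMap n o (t, 0)) (tangent n) := by
        rw [h0, add_zero]
    _ = _ := by
        rw [← integral_add hi hj]
        refine integral_congr_ae (Eventually.of_forall fun t => ?_)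
        suffices h : ∀ x, n 0 * greenField m q w 0 x + n 1 * greenField m q w 1 x
            + fderiv ℝ (fun x => Mns m n q x * w x) x (tangent n)
            = Vn m n q x * w x - Mnn m n q x * fderiv ℝ w x n from h _
        intro x
        have hu := unit_sq hn
        have e : fderiv ℝ (fun x => Mns m n q x * w x) x (tangent n)
            = Mns m n q x * fderiv ℝ w x (tangent n)
              + fderiv ℝ (Mns m n q) x (tangent n) * w x := by
          rw [fderiv_fun_mul (differentiable_of_smooth hMns x) (differentiable_of_smooth hw x)]
          simp [mul_comm]
        have e2 : Mns m n q x * fderiv ℝ w x (tangent n) + Mnn m n q x * fderiv ℝ w x n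
            = n 0 * (moment m q x 0 0 * pd 0 w x + moment m q x 1 0 * pd 1 w x)
              + n 1 * (moment m q x 0 1 * pd 0 w x + moment m q x 1 1 * pd 1 w x) := by
          simp only [Mns, Mnn, fderiv_eq_sum_pd, Fin.sum_univ_two]
          simp [tangent]
          linear_combination (n 0 * (moment m q x 0 0 * pd 0 w x + moment m q x 1 0 * pd 1 w x)
              + n 1 * (moment m q x 0 1 * pd 0 w x + moment m q x 1 1 * pd 1 w x)) * hu
        simp only [Vn, e, greenField, Qn, Fin.sum_univ_two]
        linear_combination e2

theorem setIntegral_eq_halfPlane {D : Set Plane} {n o : Plane} {F : Plane → ℝ}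
    (hD : D ⊆ halfPlane n o) (hF : ∀ x ∈ halfPlane n o, F x ≠ 0 → x ∈ D) :
    ∫ x in halfPlane n o, F x = ∫ x in D, F x :=
  setIntegral_eq_of_subset_of_forall_sdiff_eq_zero (isClosed_halfPlane n o).measurableSet hD
    fun x hx => by_contra fun h => hx.2 (hF x hx.1 h)

/-- Green's formula for a test function supported away from the boundary. -/
theorem green_compactSupport (m : Material) {D : Set Plane} {q w : Plane → ℝ}
    (hq : ContDiff ℝ ∞ q) (hw : ContDiff ℝ ∞ w) (hc : HasCompactSupport w)
    (hD : tsupport w ⊆ D) :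
    ∫ x in D, energyDensity m q w x = ∫ x in D, plateOp m q x * w x := by
  rw [setIntegral_energyDensity m hq hw hc]
  have : ∀ j, ∫ x in D, pd j (greenField m q w j) x = 0 := by
    intro j
    have hg := contDiff_greenField m hq hw j
    have hgc := hasCompactSupport_greenField m q hc j
    rw [setIntegral_eq_integral_of_forall_compl_eq_zero]
    · have h1 := integral_mul_fderiv_eq_neg_fderiv_mul_of_integrable (𝕜 := ℝ)
        (μ := (volume : Measure Plane)) (f := fun _ => (1 : ℝ)) (g := greenField m q w j)
        (v := EuclideanSpace.single j 1) (by simp) ?_ ?_ (fun x _ => differentiableAt_const _)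
        (fun x _ => differentiable_of_smooth hg x)
      · simpa [pd] using h1
      · simpa using! (contDiff_pd hg j).continuous.integrable_of_hasCompactSupport
          (hasCompactSupport_pd hgc j)
      · simpa using hg.continuous.integrable_of_hasCompactSupport hgc
    · intro x hx
      refine pd_eq_zero_of_notMem_tsupport (fun h => hx (hD ?_)) j
      refine closure_minimal (fun y hy => ?_) (isClosed_tsupport w) h
      by_contra h'
      exact hy (greenField_eq_zero m q h' j)
  simp [this]

/-! ### Geometry of shape regular triangles -/

theorem isCompact_hull (K : Finset Plane) : IsCompact (hull K) :=
  K.finite_toSet.isCompact_convexHull ℝ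

theorem measurableSet_hull (K : Finset Plane) : MeasurableSet (hull K) :=
  (isCompact_hull K).isClosed.measurableSet

theorem hull_mono {E K : Finset Plane} (h : E ⊆ K) : hull E ⊆ hull K :=
  convexHull_mono (Finset.coe_subset.2 h)

theorem size_nonneg (K : Finset Plane) : 0 ≤ size K := Metric.diam_nonneg

theorem dist_le_size {K : Finset Plane} {x y : Plane} (hx : x ∈ hull K) (hy : y ∈ hull K) :
    ‖x - y‖ ≤ size K := by
  rw [← dist_eq_norm]
  exact Metric.dist_le_diam_of_mem (isCompact_hull K).isBounded hx hy

theorem size_mono {E K : Finset Plane} (h : E ⊆ K) : size E ≤ size K :=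
  Metric.diam_mono (hull_mono h) (isCompact_hull K).isBounded

theorem inner_le_of_mem_hull {F : Finset Plane} {v x : Plane} {γ : ℝ}
    (hF : ∀ y ∈ F, inner ℝ v y ≤ γ) (hx : x ∈ hull F) : inner ℝ v x ≤ γ := by
  have hc : Convex ℝ {x : Plane | inner ℝ v x ≤ γ} :=
    convex_halfSpace_le (isLinearMap_inner_right v) γ
  exact convexHull_min (fun y hy => hF y hy) hc hx
where
  isLinearMap_inner_right (v : Plane) : IsLinearMap ℝ fun x : Plane => (inner ℝ v x : ℝ) :=
    ⟨inner_add_right v, fun c x => inner_smul_right v x c⟩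

theorem convex_combination_three {s : Set Plane} (hs : Convex ℝ s) {x y z : Plane} (hx : x ∈ s)
    (hy : y ∈ s) (hz : z ∈ s) {a b c : ℝ} (ha : 0 ≤ a) (hb : 0 ≤ b) (hc : 0 ≤ c)
    (h : a + b + c = 1) : a • x + b • y + c • z ∈ s := by
  have := hs.sum_mem (t := Finset.univ) (w := ![a, b, c]) (z := ![x, y, z])
    (fun i _ => by fin_cases i <;> simpa) (by simpa [Fin.sum_univ_three] using h)
    (fun i _ => by fin_cases i <;> simpa)
  simpa [Fin.sum_univ_three] using this

/-- A proper face of a triangle contains no interior point of the triangle. -/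
theorem face_eq_of_mem_interior {K F : Finset Plane} (hK : K.card = 3) (hF : F ⊆ K) {x : Plane}
    (hx : x ∈ interior (hull K)) (hxF : x ∈ hull F) : K ⊆ F := by
  by_contra hne
  obtain ⟨z, hz, hzF⟩ := Finset.not_subset.1 hne
  have hc : (K.erase z).card = 2 := by rw [Finset.card_erase_of_mem hz, hK]
  obtain ⟨a, b, hab, hE⟩ := Finset.card_eq_two.1 hc
  have hFE : F ⊆ {a, b} := by
    rw [← hE]
    exact fun y hy => Finset.mem_erase.2 ⟨fun h => hzF (h ▸ hy), hF hy⟩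
  have hKE : ∀ y ∈ K, y = z ∨ y = a ∨ y = b := by
    intro y hy
    by_cases h : y = z
    · exact Or.inl h
    · have : y ∈ K.erase z := Finset.mem_erase.2 ⟨h, hy⟩
      rw [hE] at this
      simpa [h] using this
  -- a normal of the line through `a` and `b` has an extremum over the triangle at `x`
  have key : ∀ v : Plane, v ≠ 0 → inner ℝ v a = inner ℝ v b → ¬ inner ℝ v z ≤ inner ℝ v a := by
    intro v hv h1 h2
    have hxa : inner ℝ v x = inner ℝ v a := by
      refine le_antisymm (inner_le_of_mem_hull (fun y hy => ?_) hxF) ?_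
      · have := hFE hy
        simp only [Finset.mem_insert, Finset.mem_singleton] at this
        rcases this with rfl | rfl
        · exact le_rfl
        · exact h1.ge
      · have := inner_le_of_mem_hull (F := F) (v := -v) (x := x) (γ := - inner ℝ v a)
          (fun y hy => ?_) hxF
        · rw [inner_neg_left] at this; linarith
        · have := hFE hy
          simp only [Finset.mem_insert, Finset.mem_singleton] at this
          rw [inner_neg_left]
          rcases this with rfl | rfl
          · exact le_rfl
          · rw [h1]
    have hcont : Tendsto (fun ε : ℝ => x + ε • v) (𝓝[>] 0) (𝓝 x) := by
      have : Continuous (fun ε : ℝ => x + ε • v) := by fun_prop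
      simpa using (this.tendsto 0).mono_left nhdsWithin_le_nhds
    obtain ⟨ε, hε, hε0⟩ := ((hcont.eventually (mem_interior_iff_mem_nhds.1 hx)).and
      self_mem_nhdsWithin).exists
    have h3 : inner ℝ v (x + ε • v) ≤ inner ℝ v a := by
      refine inner_le_of_mem_hull (fun y hy => ?_) hε
      rcases hKE y hy with rfl | rfl | rfl
      · exact h2
      · exact le_rfl
      · exact h1.ge
    rw [inner_add_right, inner_smul_right, hxa, real_inner_self_eq_norm_sq] at h3
    have : 0 < ε * ‖v‖ ^ 2 := mul_pos hε0 (by positivity)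
    linarith
  have hv : tangent (b - a) ≠ 0 := by
    rw [← norm_pos_iff, norm_tangent, norm_pos_iff]
    exact sub_ne_zero.2 hab.symm
  have h0 : inner ℝ (tangent (b - a)) a = inner ℝ (tangent (b - a)) b := by
    have := inner_tangent_self (b - a)
    rw [inner_sub_right] at this
    linarith
  have k1 := key _ hv h0
  have k2 := key (-tangent (b - a)) (neg_ne_zero.2 hv) (by rw [inner_neg_left, inner_neg_left, h0])
  rw [inner_neg_left, inner_neg_left] at k2
  push Not at k1 k2
  linarith

/-- The edge `E` has midpoint `m`, length `h` and unit normal `n`. -/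
structure EdgeFrame (E : Finset Plane) (n m : Plane) (h : ℝ) : Prop where
  norm : ‖n‖ = 1
  pos : 0 < h
  eq : E = {m + (-(h / 2)) • tangent n, m + (h / 2) • tangent n}

theorem tangent_neg (n : Plane) : tangent (-n) = -tangent n := by
  ext i; fin_cases i <;> simp [tangent]

namespace EdgeFrame

variable {E : Finset Plane} {n m : Plane} {h : ℝ}

theorem neg (hE : EdgeFrame E n m h) : EdgeFrame E (-n) m h where
  norm := by rw [norm_neg, hE.norm]
  pos := hE.pos
  eq := by rw [hE.eq, tangent_neg, Finset.pair_comm]; simp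

theorem left_mem (hE : EdgeFrame E n m h) : m + (-(h / 2)) • tangent n ∈ E := by
  rw [hE.eq]; simp

theorem right_mem (hE : EdgeFrame E n m h) : m + (h / 2) • tangent n ∈ E := by
  rw [hE.eq]; simp

theorem exists_of_orthogonal (hc : E.card = 2) (hn : ‖n‖ = 1)
    (ho : ∀ a ∈ E, ∀ b ∈ E, inner ℝ n (b - a) = 0) : ∃ m h, EdgeFrame E n m h := by
  obtain ⟨a, b, hab, rfl⟩ := Finset.card_eq_two.1 hc
  have h0 : inner ℝ n (b - a) = 0 := ho a (by simp) b (by simp)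
  have hb := frameMap_inner hn a b
  rw [h0] at hb
  set c : ℝ := inner ℝ (tangent n) (b - a)
  have hb' : b = a + c • tangent n := by rw [← hb]; simp [frameMap]
  have hc0 : c ≠ 0 := by
    intro h; rw [h] at hb'; exact hab (by simp [hb'])
  rcases lt_or_gt_of_ne hc0 with hneg | hpos
  · refine ⟨a + (c / 2) • tangent n, -c, hn, by linarith, ?_⟩
    rw [Finset.pair_comm, hb']
    congr 1
    · module
    · congr 1; module
  · refine ⟨a + (c / 2) • tangent n, c, hn, hpos, ?_⟩
    rw [hb']
    congr 1
    · module
    · congr 1; module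

theorem size_eq (hE : EdgeFrame E n m h) : size E = h := by
  have e : (m + (-(h / 2)) • tangent n) - (m + (h / 2) • tangent n) = (-h) • tangent n := by module
  rw [size, convexHull_diam, hE.eq]
  push_cast
  rw [Metric.diam_pair, dist_eq_norm, e, norm_smul, norm_tangent, hE.norm]
  simp [abs_of_pos hE.pos]

theorem mem_hull_iff (hE : EdgeFrame E n m h) (x : Plane) :
    x ∈ hull E ↔ ∃ t ∈ Set.Icc (-(h / 2)) (h / 2), frameMap n m (t, 0) = x := by
  have hh := hE.pos
  rw [hull, hE.eq]
  push_cast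
  rw [convexHull_pair, segment_eq_image_lineMap]
  constructor
  · rintro ⟨θ, hθ, rfl⟩
    refine ⟨-(h / 2) + θ * h, ⟨by nlinarith [hθ.1], by nlinarith [hθ.2]⟩, ?_⟩
    simp only [frameMap, AffineMap.lineMap_apply_module]
    module
  · rintro ⟨t, ht, rfl⟩
    refine ⟨(t + h / 2) / h, ⟨by apply div_nonneg <;> linarith [ht.1], ?_⟩, ?_⟩
    · rw [div_le_one hh]; linarith [ht.2]
    · simp only [frameMap, AffineMap.lineMap_apply_module]
      match_scalars <;> field_simp <;> ring

theorem mid_mem (hE : EdgeFrame E n m h) : m ∈ hull E := by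
  rw [hE.mem_hull_iff]
  exact ⟨0, ⟨by linarith [hE.pos], by linarith [hE.pos]⟩, by simp [frameMap]⟩

theorem mem_hull_of_norm_le (hE : EdgeFrame E n m h) {x : Plane} (hx : ‖x - m‖ ≤ h / 2)
    (h0 : inner ℝ n (x - m) = 0) : x ∈ hull E := by
  rw [hE.mem_hull_iff]
  have h1 := frameMap_inner hE.norm m x
  rw [h0] at h1
  refine ⟨_, abs_le.1 ?_, h1⟩
  refine (abs_real_inner_le_norm _ _).trans ?_
  rwa [norm_tangent, hE.norm, one_mul]

theorem inner_eq_zero (hE : EdgeFrame E n m h) {x : Plane} (hx : x ∈ hull E) :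
    inner ℝ n (x - m) = 0 := by
  obtain ⟨t, -, rfl⟩ := (hE.mem_hull_iff x).1 hx
  rw [inner_frameMap hE.norm]

theorem isometry (hE : EdgeFrame E n m h) : Isometry (fun t : ℝ => frameMap n m (t, 0)) := by
  refine Isometry.of_dist_eq fun t t' => ?_
  have e : frameMap n m (t, 0) - frameMap n m (t', 0) = (t - t') • tangent n := by
    simp only [frameMap]; module
  rw [dist_eq_norm, e, norm_smul, norm_tangent, hE.norm, mul_one, Real.dist_eq, Real.norm_eq_abs]

theorem hull_eq_image (hE : EdgeFrame E n m h) :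
    hull E = (fun t : ℝ => frameMap n m (t, 0)) '' Set.Icc (-(h / 2)) (h / 2) := by
  ext x; rw [hE.mem_hull_iff]; simp

theorem hausdorffMeasure_hull (hE : EdgeFrame E n m h) :
    (μH[1] : Measure Plane) (hull E) = ENNReal.ofReal h := by
  rw [hE.hull_eq_image, hE.isometry.hausdorffMeasure_image (Or.inl zero_le_one),
    hausdorffMeasure_real, Real.volume_Icc]
  congr 1
  ring

/-- Arc length along an edge is Lebesgue measure in the coordinate along the edge. -/
theorem setIntegral_eq (hE : EdgeFrame E n m h) (F : Plane → ℝ) :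
    ∫ x in hull E, F x ∂μH[1] = ∫ t in Set.Icc (-(h / 2)) (h / 2), F (frameMap n m (t, 0)) := by
  have hi := hE.isometry
  have hm : MeasurableEmbedding (fun t : ℝ => frameMap n m (t, 0)) :=
    hi.isClosedEmbedding.measurableEmbedding
  have himg := hE.hull_eq_image
  have hmap := hi.map_hausdorffMeasure (d := 1) (Or.inl zero_le_one)
  rw [hausdorffMeasure_real] at hmap
  have h1 : (μH[1] : Measure Plane).restrict (hull E)
      = (Measure.map (fun t : ℝ => frameMap n m (t, 0)) volume).restrict (hull E) := by
    rw [hmap, Measure.restrict_restrict (measurableSet_hull E), himg,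
      Set.inter_eq_left.2 (Set.image_subset_range _ _)]
  rw [h1, hm.setIntegral_map, himg, Set.preimage_image_eq _ hi.injective]

end EdgeFrame

/-- The radius, relative to the length of an edge, of the discs around edge midpoints in which the
triangles adjacent to the edge fill their half-planes. -/
def discRadius (κ : ℝ) : ℝ := 1 / (4 * (1 + |κ|))

theorem discRadius_pos (κ : ℝ) : 0 < discRadius κ := by unfold discRadius; positivity

theorem discRadius_mul (κ : ℝ) : discRadius κ * (1 + |κ|) = 1 / 4 := by
  have : 0 < 1 + |κ| := by positivity
  unfold discRadius; field_simp

theorem discRadius_le (κ : ℝ) : discRadius κ ≤ 1 / 4 := by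
  have := discRadius_mul κ
  nlinarith [abs_nonneg κ, discRadius_pos κ]

/-- A triangle `K` with an edge `E`, whose outer normal is `n`, containing a disc of radius `R`
comparable to the diameter of `K`. -/
structure RegularAt (κ : ℝ) (K E : Finset Plane) (n m : Plane) (h : ℝ) : Prop where
  frame : EdgeFrame E n m h
  sub : E ⊆ K
  card : K.card = 3
  outer : ∀ a ∈ E, ∀ x ∈ K, inner ℝ n (x - a) ≤ 0
  disc : ∃ (c : Plane) (R : ℝ), 0 < R ∧ Metric.closedBall c R ⊆ hull K ∧ size K ≤ κ * (2 * R)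

namespace RegularAt

variable {κ : ℝ} {K E : Finset Plane} {n m : Plane} {h : ℝ}

theorem hull_subset (hK : RegularAt κ K E n m h) : hull K ⊆ halfPlane n m := by
  refine convexHull_min (fun x hx => ?_) (convex_halfPlane n m)
  have h1 := hK.outer _ hK.frame.right_mem x hx
  have h2 : x - m = (x - (m + (h / 2) • tangent n)) + (h / 2) • tangent n := by module
  have h3 : inner ℝ n (tangent n) = 0 := by rw [real_inner_comm]; exact inner_tangent_self n
  change inner ℝ n (x - m) ≤ 0
  rw [h2, inner_add_right, inner_smul_right, h3]
  linarith

/-- The opposite vertex in the frame of the edge: it lies at a height comparable to the diameter. -/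
theorem exists_apex (hK : RegularAt κ K E n m h) : ∃ τ η : ℝ, 0 < η ∧ size K ≤ |κ| * η ∧
    K = insert (frameMap n m (τ, -η)) E := by
  obtain ⟨c, R, hR, hball, hdiam⟩ := hK.disc
  have hn := hK.frame.norm
  obtain ⟨z, hzE, hz⟩ := Finset.exists_eq_insert_iff.2
    ⟨hK.sub, by rw [hK.card, hK.frame.eq, Finset.card_pair]; intro he
                have := congrArg (fun x => inner ℝ (tangent n) (x - m)) he
                simp [inner_smul_right, norm_tangent, hn] at this
                linarith [hK.frame.pos]⟩
  have h2R : 2 * R ≤ -inner ℝ n (z - m) := by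
    have hup : inner ℝ n (c + R • n - m) ≤ 0 := hK.hull_subset (hball (by
      simp [Metric.mem_closedBall, norm_smul, hn, abs_of_pos hR]))
    have hz0 : inner ℝ n (z - m) ≤ 0 :=
      hK.hull_subset (subset_convexHull ℝ _ (by rw [← hz]; simp))
    have hlo : inner ℝ (-n) (c - R • n) ≤ -inner ℝ n z := by
      refine inner_le_of_mem_hull (F := K) (fun y hy => ?_) (hball (by
        simp [Metric.mem_closedBall, norm_smul, hn, abs_of_pos hR]))
      rw [← hz, Finset.mem_insert] at hy
      rw [inner_neg_left]
      rcases hy with rfl | hy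
      · exact le_rfl
      · have := hK.frame.inner_eq_zero (subset_convexHull ℝ _ hy)
        rw [inner_sub_right] at this hz0
        linarith
    have hnn : inner ℝ n n = (1 : ℝ) := by rw [real_inner_self_eq_norm_sq, hn, one_pow]
    rw [inner_neg_left, inner_sub_right, inner_smul_right, hnn] at hlo
    rw [inner_sub_right, inner_add_right, inner_smul_right, hnn] at hup
    rw [inner_sub_right]
    linarith
  refine ⟨inner ℝ (tangent n) (z - m), -inner ℝ n (z - m), by linarith, ?_, ?_⟩
  · calc size K ≤ κ * (2 * R) := hdiam
      _ ≤ |κ| * (2 * R) := by gcongr; exact le_abs_self κ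
      _ ≤ _ := by gcongr
  · rw [neg_neg, frameMap_inner hn, hz]

/-- The estimate behind all statements on the disc around the midpoint: on it, the barycentric
coordinates of both endpoints are positive. The left-hand side is `-η * h` times the coordinate of one
endpoint, where the opposite vertex has frame coordinates `(τ, -η)`; the sign `σ` selects the
endpoint. -/
theorem coord_neg {τ η δ t y σ s : ℝ} (hh : 0 < h) (hη : 0 < η) (hs : s ≤ |κ| * η)
    (hσ : |σ * τ + h / 2| ≤ s) (hσ1 : |σ| = 1) (hδ : δ * (1 + |κ|) = 1 / 4)
    (ht : |t| ≤ δ * h) (hy : |y| ≤ δ * h) :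
    η * (-(σ * t) - h / 2) + y * (-(σ * τ) - h / 2) < 0 := by
  have h1 : -(σ * t) ≤ δ * h := by
    calc -(σ * t) ≤ |σ * t| := neg_le_abs _
      _ = |t| := by rw [abs_mul, hσ1, one_mul]
      _ ≤ _ := ht
  have h2 : y * (-(σ * τ) - h / 2) ≤ (δ * h) * (|κ| * η) := by
    calc y * (-(σ * τ) - h / 2) ≤ |y * (-(σ * τ) - h / 2)| := le_abs_self _
      _ = |y| * |σ * τ + h / 2| := by
        rw [abs_mul, ← abs_neg (-(σ * τ) - h / 2)]; congr 2; ring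
      _ ≤ _ := mul_le_mul hy (hσ.trans hs) (abs_nonneg _) ((abs_nonneg _).trans hy)
  have h3 : η * (-(σ * t) - h / 2) ≤ η * (δ * h - h / 2) := by gcongr
  have h4 : η * (δ * h - h / 2) + (δ * h) * (|κ| * η) = η * h * (δ * (1 + |κ|) - 1 / 2) := by ring
  rw [hδ] at h4
  nlinarith [mul_pos hη hh]

theorem abs_coords_le {n m x : Plane} (hn : ‖n‖ = 1) {ρ : ℝ} (hx : ‖x - m‖ ≤ ρ) :
    |inner ℝ (tangent n) (x - m)| ≤ ρ ∧ |inner ℝ n (x - m)| ≤ ρ := by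
  constructor
  · refine (abs_real_inner_le_norm _ _).trans ?_
    rwa [norm_tangent, hn, one_mul]
  · refine (abs_real_inner_le_norm _ _).trans ?_
    rwa [hn, one_mul]

theorem apex_dist (hK : RegularAt κ K E n m h) {τ η σ : ℝ} (hσ : σ = 1 ∨ σ = -1)
    (hz : frameMap n m (τ, -η) ∈ K) : |σ * τ + h / 2| ≤ size K := by
  have hn := hK.frame.norm
  have hp : m + (-(σ * (h / 2))) • tangent n ∈ E := by
    rcases hσ with rfl | rfl
    · simpa using hK.frame.left_mem
    · simpa using hK.frame.right_mem
  have h1 := dist_le_size (subset_convexHull ℝ _ hz) (subset_convexHull ℝ _ (hK.sub hp))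
  have h2 := abs_real_inner_le_norm (tangent n)
    (frameMap n m (τ, -η) - (m + (-(σ * (h / 2))) • tangent n))
  rw [norm_tangent, hn, one_mul] at h2
  have e : inner ℝ (tangent n) (frameMap n m (τ, -η) - (m + (-(σ * (h / 2))) • tangent n))
      = τ + σ * (h / 2) := by
    have : frameMap n m (τ, -η) - (m + (-(σ * (h / 2))) • tangent n)
      = (τ + σ * (h / 2)) • tangent n + (-η) • n := by simp only [frameMap]; module
    rw [this, inner_add_right, inner_smul_right, inner_smul_right, inner_tangent_self,
      real_inner_self_eq_norm_sq, norm_tangent, hn]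
    ring
  rw [e] at h2
  refine le_trans (le_of_eq ?_) (h2.trans h1)
  rcases hσ with rfl | rfl
  · ring_nf
  · rw [← abs_neg]; ring_nf

/-- In the disc around the midpoint of `E`, the triangle fills the half-plane. -/
theorem mem_hull (hK : RegularAt κ K E n m h) {x : Plane} (hx : ‖x - m‖ ≤ discRadius κ * h)
    (hx0 : x ∈ halfPlane n m) : x ∈ hull K := by
  obtain ⟨τ, η, hη, hs, hKz⟩ := hK.exists_apex
  have hn := hK.frame.norm
  have hh := hK.frame.pos
  have hzK : frameMap n m (τ, -η) ∈ K := by rw [hKz]; simp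
  obtain ⟨ht, hy⟩ := abs_coords_le hn hx
  set t := inner ℝ (tangent n) (x - m) with ht_def
  set y := inner ℝ n (x - m) with hy_def
  have c1 := coord_neg hh hη hs (hK.apex_dist (Or.inl rfl) hzK) (by simp) (discRadius_mul κ) ht hy
  have c2 := coord_neg hh hη hs (hK.apex_dist (Or.inr rfl) hzK) (by simp) (discRadius_mul κ) ht hy
  have hy0 : y ≤ 0 := hx0
  have hx' : x = ((η * h)⁻¹ * -(η * (-(-1 * t) - h / 2) + y * (-(-1 * τ) - h / 2))) •
        (m + (-(h / 2)) • tangent n)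
      + ((η * h)⁻¹ * -(η * (-(1 * t) - h / 2) + y * (-(1 * τ) - h / 2))) •
        (m + (h / 2) • tangent n)
      + (-y / η) • frameMap n m (τ, -η) := by
    conv_lhs => rw [← frameMap_inner hn m x, ← ht_def, ← hy_def]
    simp only [frameMap]
    match_scalars <;> field_simp <;> ring
  rw [hx']
  have hc := convex_convexHull ℝ (K : Set Plane)
  have hpos : 0 < (η * h)⁻¹ := by positivity
  refine convex_combination_three hc (subset_convexHull ℝ _ (hK.sub hK.frame.left_mem))
    (subset_convexHull ℝ _ (hK.sub hK.frame.right_mem)) (subset_convexHull ℝ _ hzK)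
    (mul_nonneg hpos.le (by linarith)) (mul_nonneg hpos.le (by linarith))
    (div_nonneg (by linarith) hη.le) ?_
  field_simp
  ring

theorem mem_interior (hK : RegularAt κ K E n m h) {x : Plane} (hx : ‖x - m‖ < discRadius κ * h)
    (hx0 : inner ℝ n (x - m) < 0) : x ∈ interior (hull K) := by
  have o1 : IsOpen {x : Plane | ‖x - m‖ < discRadius κ * h} :=
    isOpen_lt (by fun_prop) continuous_const
  have o2 : IsOpen {x : Plane | inner ℝ n (x - m) < 0} :=
    isOpen_lt (by fun_prop) continuous_const
  have ho := o1.and o2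
  exact interior_maximal (fun y hy => hK.mem_hull hy.1.le hy.2.le) ho ⟨hx, hx0⟩

/-- A face of `K` that meets the disc around the midpoint of `E` contains `E`. -/
theorem edge_subset_face (hK : RegularAt κ K E n m h) {x : Plane}
    (hx : ‖x - m‖ ≤ discRadius κ * h) {F : Finset Plane} (hF : F ⊆ K) (hxF : x ∈ hull F) :
    E ⊆ F := by
  obtain ⟨τ, η, hη, hs, hKz⟩ := hK.exists_apex
  have hn := hK.frame.norm
  have hh := hK.frame.pos
  have hzK : frameMap n m (τ, -η) ∈ K := by rw [hKz]; simp
  obtain ⟨ht, hy⟩ := abs_coords_le hn hx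
  have key : ∀ σ : ℝ, (σ = 1 ∨ σ = -1) → m + (σ * (h / 2)) • tangent n ∈ F := by
    intro σ hσ
    by_contra hnot
    have c := coord_neg hh hη hs (hK.apex_dist hσ hzK)
      (by rcases hσ with rfl | rfl <;> simp) (discRadius_mul κ) ht hy
    have hσ2 : σ * σ = 1 := by rcases hσ with rfl | rfl <;> norm_num
    let v : Plane := (η * σ) • tangent n + (σ * τ + h / 2) • n
    have hv : ∀ p : Plane, inner ℝ v (p - m)
        = η * σ * inner ℝ (tangent n) (p - m) + (σ * τ + h / 2) * inner ℝ n (p - m) := by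
      intro p; simp only [v, inner_add_left, inner_smul_left]; simp
    have hle : inner ℝ v x ≤ -(η * h / 2) + inner ℝ v m := by
      refine inner_le_of_mem_hull (fun p hp => ?_) hxF
      have hpK := hF hp
      rw [hKz, Finset.mem_insert, hK.frame.eq] at hpK
      have hvp := hv p
      rw [inner_sub_right] at hvp
      suffices η * σ * inner ℝ (tangent n) (p - m) + (σ * τ + h / 2) * inner ℝ n (p - m)
          ≤ -(η * h / 2) by linarith
      have hpe : p = frameMap n m (τ, -η) ∨ p = frameMap n m (-(σ * (h / 2)), 0) := by
        rcases hpK with h1 | h1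
        · exact Or.inl h1
        · right
          simp only [Finset.mem_insert, Finset.mem_singleton] at h1
          rcases hσ with rfl | rfl
          · rcases h1 with h1 | h1
            · rw [h1]; simp [frameMap]
            · exact absurd hp (by rw [h1]; simpa using hnot)
          · rcases h1 with h1 | h1
            · exact absurd hp (by rw [h1]; simpa using hnot)
            · rw [h1]; simp [frameMap]
      rcases hpe with rfl | rfl
      · rw [inner_frameMap hn, inner_tangent_frameMap hn]
        apply le_of_eq; ring
      · rw [inner_frameMap hn, inner_tangent_frameMap hn]
        apply le_of_eq; linear_combination (-(η * h / 2)) * hσ2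
    have hvx := hv x
    rw [inner_sub_right] at hvx
    nlinarith
  have k1 := key 1 (Or.inl rfl)
  have k2 := key (-1) (Or.inr rfl)
  rw [hK.frame.eq]
  intro p hp
  simp only [Finset.mem_insert, Finset.mem_singleton] at hp
  rcases hp with rfl | rfl
  · simpa using k2
  · simpa using k1

end RegularAt

/-! ### Norm equivalence on spaces of polynomials -/

/-- On a finite-dimensional space of functions spanned by a family that is linearly independent on
the open set `U`, the `L²(U)` norm controls the coefficients. -/
theorem exists_coeff_bound {ι X : Type*} [Fintype ι] [TopologicalSpace X] [MeasurableSpace X]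
    [OpensMeasurableSpace X] [T2Space X] [SecondCountableTopology X] (μ : Measure X)
    [μ.IsOpenPosMeasure] [IsFiniteMeasureOnCompacts μ]
    {e : ι → X → ℝ} (he : ∀ i, Continuous (e i)) {U S : Set X} (hU : IsOpen U) (hS : IsCompact S)
    (hUS : U ⊆ S) (hind : ∀ c : ι → ℝ, (∀ x ∈ U, ∑ i, c i * e i x = 0) → c = 0) :
    ∃ γ : ℝ, 0 < γ ∧ ∀ c : ι → ℝ, γ * ‖c‖ ^ 2 ≤ ∫ x in U, (∑ i, c i * e i x) ^ 2 ∂μ := by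
  have hint : ∀ i j, IntegrableOn (fun x => e i x * e j x) U μ := fun i j =>
    (((he i).mul (he j)).continuousOn.integrableOn_compact hS).mono_set hUS
  have hN : ∀ c : ι → ℝ, ∫ x in U, (∑ i, c i * e i x) ^ 2 ∂μ
      = ∑ i, ∑ j, c i * c j * ∫ x in U, e i x * e j x ∂μ := by
    intro c
    have : ∀ x, (∑ i, c i * e i x) ^ 2 = ∑ i, ∑ j, c i * c j * (e i x * e j x) := by
      intro x
      rw [sq, Finset.sum_mul_sum]
      exact Finset.sum_congr rfl fun i _ => Finset.sum_congr rfl fun j _ => by ring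
    simp only [this]
    rw [integral_finsetSum _ fun i _ => integrable_finsetSum _ fun j _ => (hint i j).const_mul _]
    refine Finset.sum_congr rfl fun i _ => ?_
    rw [integral_finsetSum _ fun j _ => (hint i j).const_mul _]
    exact Finset.sum_congr rfl fun j _ => integral_const_mul _ _
  have hcont : Continuous fun c : ι → ℝ => ∫ x in U, (∑ i, c i * e i x) ^ 2 ∂μ := by
    simp only [hN]; fun_prop
  have hpos : ∀ c : ι → ℝ, c ≠ 0 → 0 < ∫ x in U, (∑ i, c i * e i x) ^ 2 ∂μ := by
    intro c hc
    refine lt_of_le_of_ne (integral_nonneg fun x => sq_nonneg _) fun h0 => hc (hind c ?_)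
    have hcs : Continuous fun x => ∑ i, c i * e i x := by fun_prop
    have hi : IntegrableOn (fun x => (∑ i, c i * e i x) ^ 2) U μ :=
      ((hcs.pow 2).continuousOn.integrableOn_compact hS).mono_set hUS
    have h1 := (integral_eq_zero_iff_of_nonneg (fun x => sq_nonneg _) hi).1 h0.symm
    have h2 := Measure.eqOn_open_of_ae_eq h1 hU (hcs.pow 2).continuousOn continuousOn_const
    intro x hx
    simpa using h2 hx
  rcases isEmpty_or_nonempty ι with hι | hι
  · refine ⟨1, one_pos, fun c => ?_⟩
    rw [Subsingleton.elim c 0]; simp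
  obtain ⟨c₀, hc₀, hmin⟩ := (isCompact_sphere (0 : ι → ℝ) 1).exists_isMinOn
    (NormedSpace.sphere_nonempty.2 zero_le_one) hcont.continuousOn
  refine ⟨_, hpos c₀ (fun h => by simp [h] at hc₀), fun c => ?_⟩
  by_cases hc : c = 0
  · simp [hc]
  have hcn : 0 < ‖c‖ := norm_pos_iff.2 hc
  have h1 : ‖c‖⁻¹ • c ∈ Metric.sphere (0 : ι → ℝ) 1 := by
    simp [norm_smul, hcn.ne']
  have h2 := hmin h1
  simp only [Set.mem_ofPred_eq] at h2
  have h3 : ∫ x in U, (∑ i, (‖c‖⁻¹ • c) i * e i x) ^ 2 ∂μ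
      = (‖c‖ ^ 2)⁻¹ * ∫ x in U, (∑ i, c i * e i x) ^ 2 ∂μ := by
    rw [← integral_const_mul]
    congr 1
    funext x
    simp only [Pi.smul_apply, smul_eq_mul, mul_assoc]
    rw [← Finset.mul_sum, mul_pow, inv_pow]
  rw [h3, le_inv_mul_iff₀ (by positivity)] at h2
  linarith

theorem coeff_eq_zero_of_interval {N : ℕ} {ε : ℝ} (hε : 0 < ε) {c : Fin N → ℝ}
    (h : ∀ t ∈ Set.Ioo (-ε) ε, ∑ i, c i * t ^ (i : ℕ) = 0) : c = 0 := by
  let p : Polynomial ℝ := ∑ i : Fin N, Polynomial.monomial (i : ℕ) (c i)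
  have hp : p = 0 := by
    refine Polynomial.eq_zero_of_infinite_isRoot p
      ((Set.Ioo_infinite (show -ε < ε by linarith)).mono fun t ht => ?_)
    simpa [p, Polynomial.eval_finsetSum] using h t ht
  funext i
  have := congrArg (fun q => q.coeff (i : ℕ)) hp
  simpa [p, Polynomial.finsetSum_coeff, Polynomial.coeff_monomial, Fin.val_inj] using this

theorem exists_lineCoeff_bound (N : ℕ) {ε : ℝ} (hε : 0 < ε) :
    ∃ γ : ℝ, 0 < γ ∧ ∀ c : Fin N → ℝ,
      γ * ‖c‖ ^ 2 ≤ ∫ t in Set.Ioo (-ε) ε, (∑ i, c i * t ^ (i : ℕ)) ^ 2 :=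
  exists_coeff_bound volume (e := fun (i : Fin N) (t : ℝ) => t ^ (i : ℕ)) (fun i => by fun_prop)
    isOpen_Ioo isCompact_Icc Set.Ioo_subset_Icc_self fun _ hc => coeff_eq_zero_of_interval hε hc

theorem exists_planeCoeff_bound (N : ℕ) {ε : ℝ} (hε : 0 < ε) :
    ∃ γ : ℝ, 0 < γ ∧ ∀ c : Fin N × Fin N → ℝ, γ * ‖c‖ ^ 2 ≤
      ∫ z in Set.Ioo (-ε) ε ×ˢ Set.Ioo (-ε) ε,
        (∑ p, c p * (z.1 ^ (p.1 : ℕ) * z.2 ^ (p.2 : ℕ))) ^ 2 := by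
  refine exists_coeff_bound (volume : Measure (ℝ × ℝ))
    (e := fun (p : Fin N × Fin N) (z : ℝ × ℝ) => z.1 ^ (p.1 : ℕ) * z.2 ^ (p.2 : ℕ))
    (fun i => by fun_prop) (isOpen_Ioo.prod isOpen_Ioo)
    (isCompact_Icc.prod isCompact_Icc) (Set.prod_mono Set.Ioo_subset_Icc_self
    Set.Ioo_subset_Icc_self) fun c hc => ?_
  have h1 : ∀ y ∈ Set.Ioo (-ε) ε, (fun i : Fin N => ∑ j : Fin N, c (i, j) * y ^ (j : ℕ)) = 0 := by
    intro y hy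
    refine coeff_eq_zero_of_interval hε fun t ht => ?_
    rw [← hc (t, y) ⟨ht, hy⟩, Fintype.sum_prod_type]
    refine Finset.sum_congr rfl fun i _ => ?_
    rw [Finset.sum_mul]
    exact Finset.sum_congr rfl fun j _ => by ring
  funext ⟨i, j⟩
  have h2 : (fun j => c (i, j)) = 0 :=
    coeff_eq_zero_of_interval hε fun y hy => congrFun (h1 y hy) i
  exact congrFun h2 j

/-! ### Polynomials in frame coordinates -/

theorem IsPolyFun.exists_lineCoeff {k N : ℕ} (hN : k < N) {F : Plane → ℝ} (hF : IsPolyFun k F)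
    (n m : Plane) (h : ℝ) :
    ∃ c : Fin N → ℝ, ∀ t : ℝ, F (frameMap n m (h * t, 0)) = ∑ i, c i * t ^ (i : ℕ) := by
  obtain ⟨p, hp, rfl⟩ := hF
  let g : Fin 2 → Polynomial ℝ := fun i =>
    Polynomial.C (m i) + Polynomial.C (h * tangent n i) * Polynomial.X
  have hd : (MvPolynomial.aeval g p).natDegree ≤ k * 1 := by
    refine MvPolynomial.aeval_natDegree_le p hp g fun i => ?_
    refine (Polynomial.natDegree_add_le _ _).trans (max_le (by simp) ?_)
    exact (Polynomial.natDegree_C_mul_le _ _).trans Polynomial.natDegree_X_le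
  refine ⟨fun i => (MvPolynomial.aeval g p).coeff i, fun t => ?_⟩
  have h1 : polyFun p (frameMap n m (h * t, 0)) = (MvPolynomial.aeval g p).eval t := by
    rw [polyFun, ← Polynomial.coe_evalRingHom, MvPolynomial.aeval_def, MvPolynomial.eval₂_eq',
      MvPolynomial.eval_eq']
    simp [g, frameMap]
    refine Finset.sum_congr rfl fun d _ => ?_
    ring
  rw [h1, Polynomial.eval_eq_sum_range' (n := N) (by omega), Finset.sum_range]

theorem exists_pow_coeff {k N : ℕ} (hN : k < N) (α β : ℝ) : ∃ a : Fin N → ℝ, ∀ t : ℝ,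
    (α + β * t) ^ k = ∑ i, a i * t ^ (i : ℕ) := by
  let p : Polynomial ℝ := (Polynomial.C α + Polynomial.C β * Polynomial.X) ^ k
  have hd : p.natDegree ≤ k * 1 := by
    refine Polynomial.natDegree_pow_le_of_le k ?_
    refine (Polynomial.natDegree_add_le _ _).trans (max_le (by simp) ?_)
    exact (Polynomial.natDegree_C_mul_le _ _).trans Polynomial.natDegree_X_le
  refine ⟨fun i => p.coeff i, fun t => ?_⟩
  have : (α + β * t) ^ k = p.eval t := by simp [p]
  rw [this, Polynomial.eval_eq_sum_range' (n := N) (by omega), Finset.sum_range]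

/-- The second coordinate vector, used as the normal of an axis-parallel frame. -/
def axisNormal : Plane := !₂[0, 1]

theorem norm_axisNormal : ‖axisNormal‖ = 1 := by
  have : ‖axisNormal‖ ^ 2 = 1 := by rw [norm_sq_eq]; simp [axisNormal]
  exact (pow_eq_one_iff_of_nonneg (norm_nonneg _) two_ne_zero).1 this

theorem IsPolyFun.exists_planeCoeff {k N : ℕ} (hN : k < N) {F : Plane → ℝ} (hF : IsPolyFun k F)
    (m : Plane) (h : ℝ) :
    ∃ c : Fin N × Fin N → ℝ, ∀ z : ℝ × ℝ, F (frameMap axisNormal m (h * z.1, h * z.2))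
      = ∑ p, c p * (z.1 ^ (p.1 : ℕ) * z.2 ^ (p.2 : ℕ)) := by
  obtain ⟨p, hp, rfl⟩ := hF
  have hdeg : ∀ d ∈ p.support, ∀ i, d i ≤ k := by
    intro d hd i
    refine le_trans ?_ ((MvPolynomial.le_totalDegree hd).trans hp)
    by_cases hi : d i = 0
    · simp [hi]
    · exact Finset.single_le_sum (f := fun i => d i) (fun _ _ => Nat.zero_le _)
        (Finsupp.mem_support_iff.2 hi)
  have hex : ∀ (l : ℕ) (α β : ℝ), ∃ a : Fin N → ℝ, l ≤ k → ∀ t : ℝ,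
      (α + β * t) ^ l = ∑ i, a i * t ^ (i : ℕ) := by
    intro l α β
    by_cases hl : l ≤ k
    · obtain ⟨a, ha⟩ := exists_pow_coeff (lt_of_le_of_lt hl hN) α β
      exact ⟨a, fun _ => ha⟩
    · exact ⟨0, fun h => absurd h hl⟩
  choose a ha using hex
  refine ⟨fun q => ∑ d ∈ p.support, p.coeff d * (a (d 0) (m 0) (-h) q.1 * a (d 1) (m 1) h q.2),
    fun z => ?_⟩
  have e0 : frameMap axisNormal m (h * z.1, h * z.2) 0 = m 0 + (-h) * z.1 := by
    simp [frameMap, axisNormal, tangent]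
  have e1 : frameMap axisNormal m (h * z.1, h * z.2) 1 = m 1 + h * z.2 := by
    simp [frameMap, axisNormal, tangent]
  simp only [polyFun, MvPolynomial.eval_eq', Fin.prod_univ_two, Finset.sum_mul]
  rw [Finset.sum_comm]
  refine Finset.sum_congr rfl fun d hd => ?_
  rw [e0, e1, ha _ _ _ (hdeg d hd 0), ha _ _ _ (hdeg d hd 1), Finset.sum_mul_sum,
    Fintype.sum_prod_type, Finset.mul_sum]
  refine Finset.sum_congr rfl fun i _ => ?_
  rw [Finset.mul_sum]
  exact Finset.sum_congr rfl fun j _ => by ring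

/-! ### The test functions -/

/-- A smooth bump centred at the origin of the real line. -/
def unitBump : ContDiffBump (0 : ℝ) where
  rIn := 1 / 2
  rOut := 1
  rIn_pos := by norm_num
  rIn_lt_rOut := by norm_num

/-- A smooth cutoff, equal to `1` on `[-δ/8, δ/8]` and supported in `[-δ/4, δ/4]`. -/
def cutoff (δ t : ℝ) : ℝ := unitBump (4 / δ * t)

section Cutoff

variable {δ : ℝ}

theorem contDiff_cutoff (δ : ℝ) : ContDiff ℝ ∞ (cutoff δ) :=
  unitBump.contDiff.comp (contDiff_const.mul contDiff_id)

theorem cutoff_nonneg (δ t : ℝ) : 0 ≤ cutoff δ t := unitBump.nonneg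

theorem cutoff_eq_one (hδ : 0 < δ) {t : ℝ} (ht : |t| ≤ δ / 8) : cutoff δ t = 1 := by
  refine unitBump.one_of_mem_closedBall ?_
  rw [mem_closedBall_zero_iff, Real.norm_eq_abs, abs_mul, abs_of_pos (by positivity)]
  change 4 / δ * |t| ≤ 1 / 2
  rw [div_mul_eq_mul_div, div_le_iff₀ hδ]; linarith

theorem abs_le_of_cutoff_ne_zero (hδ : 0 < δ) {t : ℝ} (ht : cutoff δ t ≠ 0) : |t| ≤ δ / 4 := by
  by_contra hlt
  push Not at hlt
  refine ht (unitBump.zero_of_le_dist ?_)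
  rw [dist_zero_right, Real.norm_eq_abs, abs_mul, abs_of_pos (by positivity)]
  change 1 ≤ 4 / δ * |t|
  rw [div_mul_eq_mul_div, le_div_iff₀ hδ]; linarith

theorem cutoff_zero (hδ : 0 < δ) : cutoff δ 0 = 1 := cutoff_eq_one hδ (by simp; linarith)

theorem deriv_cutoff_zero (hδ : 0 < δ) : deriv (cutoff δ) 0 = 0 := by
  have : cutoff δ =ᶠ[𝓝 0] fun _ => 1 := by
    filter_upwards [Metric.ball_mem_nhds (0 : ℝ) (by positivity : 0 < δ / 8)] with t ht
    refine cutoff_eq_one hδ ?_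
    rw [mem_ball_zero_iff, Real.norm_eq_abs] at ht
    exact ht.le
  rw [this.deriv_eq]; simp

end Cutoff

/-- Coordinates in the frame at `m` with normal `n`, in units of `h`. -/
def chart (n m : Plane) (h : ℝ) (x : Plane) : ℝ × ℝ :=
  (h⁻¹ * inner ℝ (tangent n) (x - m), h⁻¹ * inner ℝ n (x - m))

theorem contDiff_chart (n m : Plane) (h : ℝ) : ContDiff ℝ ∞ (chart n m h) := by
  have c : ∀ v : Plane, ContDiff ℝ ∞ fun x : Plane => h⁻¹ * inner ℝ v (x - m) := fun v =>
    contDiff_const.mul (contDiff_const.inner ℝ (contDiff_id.sub contDiff_const))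
  exact (c _).prodMk (c _)

theorem chart_frameMap {n : Plane} (hn : ‖n‖ = 1) (m : Plane) {h : ℝ} (z : ℝ × ℝ) :
    chart n m h (frameMap n m z) = (h⁻¹ * z.1, h⁻¹ * z.2) := by
  simp [chart, inner_frameMap hn, inner_tangent_frameMap hn]

/-- A product of cutoffs and a monomial, on the reference configuration. -/
def refMonomial (δ : ℝ) (i j : ℕ) (z : ℝ × ℝ) : ℝ :=
  cutoff δ z.1 * cutoff δ z.2 * (z.1 ^ i * z.2 ^ j)

theorem contDiff_refMonomial (δ : ℝ) (i j : ℕ) : ContDiff ℝ ∞ (refMonomial δ i j) :=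
  (((contDiff_cutoff δ).comp contDiff_fst).mul ((contDiff_cutoff δ).comp contDiff_snd)).mul
    ((contDiff_fst.pow i).mul (contDiff_snd.pow j))

theorem hasCompactSupport_refMonomial {δ : ℝ} (hδ : 0 < δ) (i j : ℕ) :
    HasCompactSupport (refMonomial δ i j) := by
  refine HasCompactSupport.intro (K := Set.Icc (-(δ / 4)) (δ / 4) ×ˢ Set.Icc (-(δ / 4)) (δ / 4))
    (isCompact_Icc.prod isCompact_Icc) fun z hz => ?_
  by_contra hne
  have h1 := left_ne_zero_of_mul hne
  exact hz ⟨abs_le.1 (abs_le_of_cutoff_ne_zero hδ (left_ne_zero_of_mul h1)),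
    abs_le.1 (abs_le_of_cutoff_ne_zero hδ (right_ne_zero_of_mul h1))⟩

/-- The test function with coefficients `c`: a polynomial in frame coordinates, cut off at a
distance comparable to `h` from `m`. -/
def testFun (δ : ℝ) {N : ℕ} (n m : Plane) (h : ℝ) (c : Fin N × Fin N → ℝ) (x : Plane) : ℝ :=
  ∑ p, c p * refMonomial δ p.1 p.2 (chart n m h x)

section TestFun

variable {δ : ℝ} {N : ℕ} {n m : Plane} {h : ℝ}

theorem contDiff_testFun (δ : ℝ) (n m : Plane) (h : ℝ) (c : Fin N × Fin N → ℝ) :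
    ContDiff ℝ ∞ (testFun δ n m h c) :=
  ContDiff.sum fun p _ => contDiff_const.mul
    ((contDiff_refMonomial δ p.1 p.2).comp (contDiff_chart n m h))

theorem testFun_eq (δ : ℝ) (n m : Plane) (h : ℝ) (c : Fin N × Fin N → ℝ) (x : Plane) :
    testFun δ n m h c x = cutoff δ (chart n m h x).1 * cutoff δ (chart n m h x).2 *
      ∑ p, c p * ((chart n m h x).1 ^ (p.1 : ℕ) * (chart n m h x).2 ^ (p.2 : ℕ)) := by
  simp only [testFun, refMonomial, Finset.mul_sum]
  exact Finset.sum_congr rfl fun p _ => by ring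

theorem tsupport_testFun (hδ : 0 < δ) (hn : ‖n‖ = 1) (hh : 0 < h) (c : Fin N × Fin N → ℝ) :
    tsupport (testFun δ n m h c) ⊆ Metric.closedBall m (δ * h / 2) := by
  refine closure_minimal (fun x hx => ?_) Metric.isClosed_closedBall
  rw [Function.mem_support, testFun_eq] at hx
  have h1 := left_ne_zero_of_mul hx
  have ht := abs_le_of_cutoff_ne_zero hδ (left_ne_zero_of_mul h1)
  have hy := abs_le_of_cutoff_ne_zero hδ (right_ne_zero_of_mul h1)
  simp only [chart, abs_mul, abs_of_pos (inv_pos.2 hh)] at ht hy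
  rw [inv_mul_le_iff₀ hh] at ht hy
  rw [Metric.mem_closedBall, dist_eq_norm]
  refine abs_le_of_sq_le_sq' ?_ (by positivity) |>.2
  rw [norm_sub_sq hn]
  have h2 := sq_le_sq' (neg_le_of_abs_le ht) (le_of_abs_le ht)
  have h3 := sq_le_sq' (neg_le_of_abs_le hy) (le_of_abs_le hy)
  nlinarith [sq_nonneg (h * δ)]

theorem hasCompactSupport_testFun (hδ : 0 < δ) (hn : ‖n‖ = 1) (hh : 0 < h)
    (c : Fin N × Fin N → ℝ) : HasCompactSupport (testFun δ n m h c) :=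
  (isCompact_closedBall m _).of_isClosed_subset (isClosed_tsupport _) (tsupport_testFun hδ hn hh c)

theorem hasFDerivAt_chart (n m : Plane) (h : ℝ) (x : Plane) :
    HasFDerivAt (chart n m h)
      ((h⁻¹ • innerSL ℝ (tangent n)).prod (h⁻¹ • innerSL ℝ n)) x := by
  have c : ∀ v : Plane, HasFDerivAt (fun x : Plane => h⁻¹ * inner ℝ v (x - m))
      (h⁻¹ • innerSL ℝ v) x := by
    intro v
    exact ((innerSL ℝ v).hasFDerivAt.comp x ((hasFDerivAt_id x).sub_const m)).const_mul h⁻¹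
  exact (c _).prodMk (c _)

/-- Derivative of the coordinates in a coordinate direction. -/
def chartDir (n : Plane) (h : ℝ) (i : Fin 2) : ℝ × ℝ := (h⁻¹ * tangent n i, h⁻¹ * n i)

theorem pd_comp_chart {g : ℝ × ℝ → ℝ} (hg : ContDiff ℝ ∞ g) (n m : Plane) (h : ℝ) (i : Fin 2) :
    pd i (fun x => g (chart n m h x)) = fun x => fderiv ℝ g (chart n m h x) (chartDir n h i) := by
  funext x
  have h1 := (hg.differentiable (by norm_num) (chart n m h x)).hasFDerivAt.comp x
    (hasFDerivAt_chart n m h x)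
  have h2 : fderiv ℝ (fun x => g (chart n m h x)) x = _ := h1.fderiv
  rw [pd, h2]
  simp only [ContinuousLinearMap.comp_apply]
  congr 1
  simp [chartDir, EuclideanSpace.inner_single_right]

theorem norm_chartDir_le (hn : ‖n‖ = 1) (hh : 0 < h) (i : Fin 2) : ‖chartDir n h i‖ ≤ h⁻¹ := by
  have hc : ∀ v : Plane, ‖v‖ = 1 → ‖h⁻¹ * v i‖ ≤ h⁻¹ := by
    intro v hv
    rw [norm_mul, norm_inv, Real.norm_of_nonneg hh.le]
    have := PiLp.norm_apply_le v i
    rw [hv] at this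
    exact mul_le_of_le_one_right (by positivity) this
  exact max_le (hc _ (by rw [norm_tangent, hn])) (hc _ hn)

theorem exists_norm_bound {E F : Type*} [TopologicalSpace E] [NormedAddCommGroup F] {G : E → F}
    (hG : Continuous G) (hc : HasCompactSupport G) : ∃ B : ℝ, 0 ≤ B ∧ ∀ z, ‖G z‖ ≤ B := by
  obtain ⟨B, hB⟩ := hG.bounded_above_of_compact_support hc
  exact ⟨max B 0, le_max_right _ _, fun z => (hB z).trans (le_max_left _ _)⟩

theorem exists_second_deriv_bound {E : Type*} [NormedAddCommGroup E] [NormedSpace ℝ E] {g : E → ℝ}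
    (hg : ContDiff ℝ ∞ g) (hc : HasCompactSupport g) : ∃ B : ℝ, 0 ≤ B ∧ ∀ z, |g z| ≤ B ∧
      ∀ v w, |fderiv ℝ (fun z => fderiv ℝ g z v) z w| ≤ B * ‖w‖ * ‖v‖ := by
  obtain ⟨B₁, hB₁⟩ := hg.continuous.bounded_above_of_compact_support hc
  have h1 : ContDiff ℝ ∞ (fderiv ℝ g) := hg.fderiv_right (m := ∞) (by norm_num)
  have h2 : ContDiff ℝ ∞ (fderiv ℝ (fderiv ℝ g)) := h1.fderiv_right (m := ∞) (by norm_num)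
  obtain ⟨B₂, hB₂0, hB₂⟩ := exists_norm_bound (F := E →L[ℝ] E →L[ℝ] ℝ) h2.continuous
    ((hc.fderiv ℝ).fderiv ℝ)
  have h0 : 0 ≤ max B₁ B₂ := hB₂0.trans (le_max_right _ _)
  refine ⟨max B₁ B₂, h0, fun z => ⟨(hB₁ z).trans (le_max_left _ _), fun v w => ?_⟩⟩
  have hd : DifferentiableAt ℝ (fderiv ℝ g) z := h1.differentiable (by norm_num) z
  rw [fderiv_clm_apply hd (differentiableAt_const _)]
  simp only [fderiv_fun_const, Pi.zero_apply, ContinuousLinearMap.comp_zero, zero_add,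
    ContinuousLinearMap.flip_apply]
  refine ((fderiv ℝ (fderiv ℝ g) z).le_opNorm₂ w v).trans ?_
  gcongr
  exact (hB₂ z).trans (le_max_right _ _)

theorem abs_pd_pd_chart_le {g : ℝ × ℝ → ℝ} (hg : ContDiff ℝ ∞ g) {C : ℝ} (hC0 : 0 ≤ C)
    (hC : ∀ z v w, |fderiv ℝ (fun z => fderiv ℝ g z v) z w| ≤ C * ‖w‖ * ‖v‖) (hn : ‖n‖ = 1)
    (m : Plane) (hh : 0 < h)
    (i j : Fin 2) (x : Plane) : |pd j (pd i (fun x => g (chart n m h x))) x| ≤ C * (h⁻¹ * h⁻¹) := by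
  have hg' : ContDiff ℝ ∞ (fun z => fderiv ℝ g z (chartDir n h i)) :=
    (hg.fderiv_right (m := ∞) (by norm_num)).clm_apply contDiff_const
  rw [pd_comp_chart hg, pd_comp_chart hg']
  calc _ ≤ _ := hC _ _ _
    _ ≤ C * h⁻¹ * h⁻¹ := by
      gcongr
      · exact norm_chartDir_le hn hh j
      · exact norm_chartDir_le hn hh i
    _ = _ := by ring

end TestFun

/-- Scaling of the test functions: second derivatives cost a factor `h⁻²`. -/
theorem exists_testFun_bound {δ : ℝ} (hδ : 0 < δ) (N : ℕ) : ∃ C : ℝ, 0 < C ∧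
    ∀ (n m : Plane) (h : ℝ) (c : Fin N × Fin N → ℝ), ‖n‖ = 1 → 0 < h →
      (∀ x, |testFun δ n m h c x| ≤ C * ‖c‖) ∧
      ∀ i j x, |pd j (pd i (testFun δ n m h c)) x| ≤ C * ‖c‖ * (h⁻¹ * h⁻¹) := by
  have hb : ∀ p : Fin N × Fin N, ∃ B : ℝ, 0 ≤ B ∧ ∀ z, |refMonomial δ p.1 p.2 z| ≤ B ∧
      ∀ v w, |fderiv ℝ (fun z => fderiv ℝ (refMonomial δ p.1 p.2) z v) z w| ≤ B * ‖w‖ * ‖v‖ := by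
    intro p
    exact exists_second_deriv_bound (contDiff_refMonomial δ p.1 p.2)
      (hasCompactSupport_refMonomial hδ p.1 p.2)
  choose B hB0 hB using hb
  have hS : 0 ≤ ∑ p, B p := Finset.sum_nonneg fun p _ => hB0 p
  refine ⟨∑ p, B p + 1, by linarith, fun n m h c hn hh => ⟨fun x => ?_, fun i j x => ?_⟩⟩
  · calc |testFun δ n m h c x| ≤ ∑ p, |c p * refMonomial δ p.1 p.2 (chart n m h x)| :=
          Finset.abs_sum_le_sum_abs _ _
      _ ≤ ∑ p, ‖c‖ * B p := by
          refine Finset.sum_le_sum fun p _ => ?_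
          rw [abs_mul]
          exact mul_le_mul (norm_le_pi_norm c p) (hB p _).1 (abs_nonneg _) (norm_nonneg _)
      _ = (∑ p, B p) * ‖c‖ := by rw [← Finset.mul_sum, mul_comm]
      _ ≤ _ := by gcongr; linarith
  · have hs : ∀ p : Fin N × Fin N, ContDiff ℝ ∞ fun x => refMonomial δ p.1 p.2 (chart n m h x) :=
      fun p => (contDiff_refMonomial δ p.1 p.2).comp (contDiff_chart n m h)
    have e : ∀ (i : Fin 2) (g : Fin N × Fin N → Plane → ℝ), (∀ p, ContDiff ℝ ∞ (g p)) →
        pd i (fun x => ∑ p, c p * g p x) = fun x => ∑ p, c p * pd i (g p) x := by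
      intro i g hg
      funext x
      rw [pd, fderiv_fun_sum fun p _ =>
        (differentiable_of_smooth (contDiff_const.mul (hg p))) x]
      rw [sum_apply]
      refine Finset.sum_congr rfl fun p _ => ?_
      have := congrFun (pd_const_mul (hg p) (c p) i) x
      exact this
    have e2 : pd j (pd i (testFun δ n m h c)) x = ∑ p, c p *
        pd j (pd i (fun x => refMonomial δ p.1 p.2 (chart n m h x))) x := by
      have : testFun δ n m h c = fun x => ∑ p, c p * refMonomial δ p.1 p.2 (chart n m h x) := rfl
      rw [this, e i _ hs, e j _ fun p => contDiff_pd (hs p) i]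
    rw [e2]
    calc _ ≤ ∑ p, |c p * pd j (pd i (fun x => refMonomial δ p.1 p.2 (chart n m h x))) x| :=
          Finset.abs_sum_le_sum_abs _ _
      _ ≤ ∑ p, ‖c‖ * (B p * (h⁻¹ * h⁻¹)) := by
          refine Finset.sum_le_sum fun p _ => ?_
          rw [abs_mul]
          exact mul_le_mul (norm_le_pi_norm c p)
            (abs_pd_pd_chart_le (contDiff_refMonomial δ p.1 p.2) (hB0 p) (fun z => (hB p z).2) hn m hh i j x)
            (abs_nonneg _) (norm_nonneg _)
      _ = (∑ p, B p) * ‖c‖ * (h⁻¹ * h⁻¹) := by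
          rw [Finset.sum_mul, Finset.sum_mul]; exact Finset.sum_congr rfl fun p _ => by ring
      _ ≤ _ := by gcongr; linarith

/-! ### The residual of a finite element function -/

/-- Cauchy–Schwarz for an integrand dominated by `b |F|` and supported in a set of finite measure. -/
theorem abs_integral_le_of_support {X : Type*} [MeasurableSpace X] {μ : Measure X} {G F : X → ℝ}
    {S : Set X} {b V : ℝ} (hS : MeasurableSet S) (hb : 0 ≤ b) (hF : MemLp F 2 μ)
    (hG : ∀ᵐ x ∂μ, |G x| ≤ b * |F x|) (hG0 : ∀ x, x ∉ S → G x = 0) (hV : 0 ≤ V)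
    (hSV : μ S ≤ ENNReal.ofReal V) : |∫ x, G x ∂μ| ≤ b * (√V * √(∫ x, F x ^ 2 ∂μ)) := by
  have hfin : μ S ≠ ⊤ := ne_top_of_le_ne_top ENNReal.ofReal_ne_top hSV
  have h1 : MemLp (S.indicator fun _ => (1 : ℝ)) 2 μ := memLp_indicator_const 2 hS 1 (Or.inr hfin)
  have hi : Integrable (fun x => S.indicator (fun _ => (1 : ℝ)) x * |F x|) μ :=
    MemLp.integrable_mul (p := 2) (q := 2) h1 hF.norm
  have h2 : |∫ x, G x ∂μ| ≤ ∫ x, b * (S.indicator (fun _ => (1 : ℝ)) x * |F x|) ∂μ := by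
    rw [← Real.norm_eq_abs]
    refine norm_integral_le_of_norm_le (hi.const_mul b) ?_
    filter_upwards [hG] with x hx
    by_cases hxS : x ∈ S
    · simpa [hxS] using hx
    · simp [hxS, hG0 x hxS]
  rw [integral_const_mul] at h2
  refine h2.trans (mul_le_mul_of_nonneg_left ?_ hb)
  have h3 := integral_mul_le_Lp_mul_Lq_of_nonneg (μ := μ) (p := 2) (q := 2)
    Real.HolderConjugate.two_two (f := S.indicator fun _ => (1 : ℝ)) (g := fun x => |F x|)
    (Eventually.of_forall fun x => Set.indicator_nonneg (fun _ _ => zero_le_one) x)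
    (Eventually.of_forall fun x => abs_nonneg _) (by simpa using h1) (by simpa using hF.norm)
  refine h3.trans ?_
  rw [← Real.sqrt_eq_rpow, ← Real.sqrt_eq_rpow]
  have e1 : ∫ x, (S.indicator (fun _ => (1 : ℝ)) x) ^ (2 : ℝ) ∂μ = μ.real S := by
    have : (fun x => (S.indicator (fun _ => (1 : ℝ)) x) ^ (2 : ℝ)) = S.indicator fun _ => 1 := by
      funext x; by_cases hx : x ∈ S <;> simp [hx]
    rw [this, integral_indicator_const _ hS]; simp
  have e2 : ∫ x, |F x| ^ (2 : ℝ) ∂μ = ∫ x, F x ^ 2 ∂μ := by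
    congr 1; funext x; simp
  rw [e1, e2]
  gcongr
  exact ENNReal.toReal_le_of_le_ofReal hV hSV

/-- The area of the unit disc. -/
def discArea : ℝ := (volume : Measure Plane).real (Metric.ball 0 1)

theorem volume_closedBall_eq (x : Plane) {ρ : ℝ} (hρ : 0 ≤ ρ) :
    (volume : Measure Plane) (Metric.closedBall x ρ) = ENNReal.ofReal (ρ ^ 2 * discArea) := by
  rw [Measure.addHaar_closedBall _ _ hρ, ENNReal.ofReal_mul (by positivity), discArea,
    ofReal_measureReal (by exact measure_ball_lt_top.ne)]
  simp

theorem discArea_nonneg : 0 ≤ discArea := measureReal_nonneg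

theorem l2Norm_nonneg (A : Set Plane) (w : Plane → ℝ) : 0 ≤ l2Norm A w := Real.sqrt_nonneg _

theorem abs_setIntegral_le {D : Set Plane} {G F : Plane → ℝ} {b ρ : ℝ} {x₀ : Plane} (hb : 0 ≤ b)
    (hρ : 0 ≤ ρ) (hF : MemLp F 2 (volume.restrict D))
    (hG : ∀ᵐ x ∂volume.restrict D, |G x| ≤ b * |F x|)
    (hG0 : ∀ x, x ∉ Metric.closedBall x₀ ρ → G x = 0) :
    |∫ x in D, G x| ≤ b * (√discArea * ρ * l2Norm D F) := by
  have h := abs_integral_le_of_support (V := ρ ^ 2 * discArea) Metric.isClosed_closedBall.measurableSet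
    hb hF hG hG0 (mul_nonneg (sq_nonneg _) discArea_nonneg)
    ((Measure.restrict_apply_le D _).trans (volume_closedBall_eq x₀ hρ).le)
  rw [Real.sqrt_mul (sq_nonneg ρ), Real.sqrt_sq hρ] at h
  rwa [mul_comm (√discArea)]

namespace Mesh

variable {P : Plate} (T : Mesh P.Ω)

theorem hull_subset_closure {F : Finset Plane} (hF : F ∈ T.complex.faces) :
    hull F ⊆ closure P.Ω := by
  rw [← T.cover]
  exact T.complex.convexHull_subset_space hF

theorem interior_hull_subset {F : Finset Plane} (hF : F ∈ T.complex.faces) :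
    interior (hull F) ⊆ P.Ω := by
  rw [← P.domain.interior_closure]
  exact interior_mono (T.hull_subset_closure hF)

theorem mem_hull_inter {s t : Finset Plane} (hs : s ∈ T.complex.faces) (ht : t ∈ T.complex.faces)
    {x : Plane} (hxs : x ∈ hull s) (hxt : x ∈ hull t) : x ∈ hull (s ∩ t) := by
  have := T.complex.inter_subset_convexHull hs ht ⟨hxs, hxt⟩
  rwa [← Finset.coe_inter] at this

theorem elements_eq_of_interior {K K' : Finset Plane} (hK : K ∈ T.elements) (hK' : K' ∈ T.elements)
    {x : Plane} (hx : x ∈ interior (hull K)) (hx' : x ∈ hull K') : K = K' := by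
  have h := face_eq_of_mem_interior hK.2 Finset.inter_subset_left hx
    (T.mem_hull_inter hK.1 hK'.1 (interior_subset hx) hx')
  exact Finset.eq_of_subset_of_card_le (fun y hy => Finset.mem_of_mem_inter_right (h hy))
    (by rw [hK.2, hK'.2])

theorem exists_element_of_mem {x : Plane} (hx : x ∈ closure P.Ω) : ∃ K ∈ T.elements, x ∈ hull K := by
  rw [← T.cover, Geometry.SimplicialComplex.mem_space_iff] at hx
  obtain ⟨s, hs, hxs⟩ := hx
  obtain ⟨t, ht, hst, hc⟩ := T.pure s hs
  exact ⟨t, ⟨ht, hc⟩, hull_mono hst hxs⟩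

theorem finite_elements : T.elements.Finite := T.finite.subset fun _ h => h.1

end Mesh

theorem interior_hull_ae_eq (K : Finset Plane) :
    (interior (hull K) : Set Plane) =ᵐ[volume] hull K := by
  refine interior_ae_eq_of_null_frontier ?_
  exact (convex_convexHull ℝ (K : Set Plane)).addHaar_frontier volume

theorem restrict_hull_eq (K : Finset Plane) :
    (volume : Measure Plane).restrict (hull K) = volume.restrict (interior (hull K)) :=
  (Measure.restrict_congr_set (interior_hull_ae_eq K)).symm

theorem Mesh.restrict_hull_le {P : Plate} (T : Mesh P.Ω) {K : Finset Plane} (hK : K ∈ T.elements) :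
    (volume : Measure Plane).restrict (hull K) ≤ volume.restrict P.Ω := by
  rw [restrict_hull_eq]
  exact Measure.restrict_mono (T.interior_hull_subset hK.1) le_rfl

/-- On each triangle, the weak Hessian of a finite element function is the Hessian of its
polynomial. -/
theorem IsFEFunction.hessian_ae {P : Plate} {T : Mesh P.Ω} {k : ℕ} {v : H2Function P.Ω}
    {q : Finset Plane → MvPolynomial (Fin 2) ℝ} (hv : IsFEFunction P T k v q) {K : Finset Plane}
    (hK : K ∈ T.elements) :
    ∀ᵐ x ∂volume.restrict (hull K), v.hessian x = hessianAt (polyFun (q K)) x := by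
  rw [restrict_hull_eq]
  have hsub := T.interior_hull_subset hK.1
  have hp := contDiff_polyFun (q K)
  have h0 : ∀ᵐ x ∂volume.restrict (interior (hull K)), v.val x = polyFun (q K) x :=
    (ae_restrict_iff' isOpen_interior.measurableSet).2 (Eventually.of_forall (hv.eq K hK))
  have h1 : ∀ i, ∀ᵐ x ∂volume.restrict (interior (hull K)), v.grad i x = pd i (polyFun (q K)) x :=
    fun i => (v.isH1.weak i).ae_eq_pd P.domain.isOpen isOpen_interior hsub hp h0 (v.isH1.memLp_grad i)
  have h2 : ∀ i j, ∀ᵐ x ∂volume.restrict (interior (hull K)),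
      v.hess i j x = pd j (pd i (polyFun (q K))) x := fun i j =>
    ((v.isH1_grad i).weak j).ae_eq_pd P.domain.isOpen isOpen_interior hsub (contDiff_pd hp i) (h1 i)
      ((v.isH1_grad i).memLp_grad j)
  have h3 := ae_all_iff.2 fun i => ae_all_iff.2 (h2 i)
  filter_upwards [h3] with x hx
  ext i j
  exact hx i j

/-- A function that vanishes outside the patch `𝒦` is integrated triangle by triangle. -/
theorem Mesh.setIntegral_eq_sum {P : Plate} (T : Mesh P.Ω) {𝒦 : Finset (Finset Plane)}
    (h𝒦 : ∀ K ∈ 𝒦, K ∈ T.elements) {G : Plane → ℝ} (hG : IntegrableOn G P.Ω)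
    (h0 : ∀ x ∈ P.Ω, G x ≠ 0 → ∃ K ∈ 𝒦, x ∈ hull K) :
    ∫ x in P.Ω, G x = ∑ K ∈ 𝒦, ∫ x in hull K, G x := by
  have hsub : (⋃ K ∈ 𝒦, interior (hull K)) ⊆ P.Ω :=
    Set.iUnion₂_subset fun K hK => T.interior_hull_subset (h𝒦 K hK).1
  have hnull : (volume : Measure Plane) (⋃ K ∈ 𝒦, frontier (hull K)) = 0 :=
    (measure_biUnion_null_iff 𝒦.countable_toSet).2 fun K _ =>
      (convex_convexHull ℝ (K : Set Plane)).addHaar_frontier volume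
  have h1 : ∫ x in P.Ω, G x = ∫ x in ⋃ K ∈ 𝒦, interior (hull K), G x := by
    refine setIntegral_eq_of_subset_of_ae_sdiff_eq_zero
      P.domain.isOpen.measurableSet.nullMeasurableSet hsub ?_
    filter_upwards [measure_eq_zero_iff_ae_notMem.1 hnull] with x hx hxΩ
    by_contra hne
    obtain ⟨K, hK, hxK⟩ := h0 x hxΩ.1 hne
    refine hx (Set.mem_biUnion hK ?_)
    rw [(isCompact_hull K).isClosed.frontier_eq]
    exact ⟨hxK, fun h => hxΩ.2 (Set.mem_biUnion hK h)⟩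
  rw [h1, integral_biUnion_finset _ (fun K _ => isOpen_interior.measurableSet)]
  · exact Finset.sum_congr rfl fun K _ => setIntegral_congr_set (interior_hull_ae_eq K)
  · intro K hK K' hK' hne
    refine Set.disjoint_left.2 fun x hx hx' => hne ?_
    exact T.elements_eq_of_interior (h𝒦 K hK) (h𝒦 K' hK') hx (interior_subset hx')
  · exact fun K hK => hG.mono_set (T.interior_hull_subset (h𝒦 K hK).1)

/-- The contraction `M(H) : κ(H')`. -/
def contraction (m : Material) (H H' : Matrix (Fin 2) (Fin 2) ℝ) : ℝ :=
  ∑ i, ∑ j, momentOfHessian m H i j * curvature H' i j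

theorem contraction_sub (m : Material) (H₁ H₂ H' : Matrix (Fin 2) (Fin 2) ℝ) :
    contraction m (H₁ - H₂) H' = contraction m H₁ H' - contraction m H₂ H' := by
  simp only [contraction, Fin.sum_univ_two, momentOfHessian_apply, Matrix.sub_apply]
  ring

theorem abs_contraction_le (m : Material) {H H' : Matrix (Fin 2) (Fin 2) ℝ} {s b : ℝ}
    (hs : ∀ i j, |H i j| ≤ s) (hb : ∀ i j, |H' i j| ≤ b) :
    |contraction m H H'| ≤ 4 * |m.momentCoeff| * (1 + 2 * |m.traceCoeff|) * s * b := by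
  have hs0 : 0 ≤ s := (abs_nonneg _).trans (hs 0 0)
  have hb0 : 0 ≤ b := (abs_nonneg _).trans (hb 0 0)
  have hκ : ∀ i j, |curvature H' i j| ≤ b := by
    intro i j
    rw [curvature_apply, abs_neg, abs_mul]
    have := abs_add_le (H' i j) (H' j i)
    rw [abs_of_pos (by norm_num : (0 : ℝ) < 1 / 2)]
    linarith [hb i j, hb j i]
  have hM : ∀ i j, |momentOfHessian m H i j| ≤ |m.momentCoeff| * (1 + 2 * |m.traceCoeff|) * s := by
    intro i j
    rw [momentOfHessian_apply, abs_mul, abs_neg,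
      show |m.momentCoeff| * (1 + 2 * |m.traceCoeff|) * s
        = |m.momentCoeff| * ((1 + 2 * |m.traceCoeff|) * s) by ring]
    refine mul_le_mul_of_nonneg_left ?_ (abs_nonneg _)
    have h1 := abs_add_le (H i j) (H j i)
    have h2 := abs_add_le (H 0 0) (H 1 1)
    have h3 : |m.traceCoeff * (H 0 0 + H 1 1) * (if i = j then (1 : ℝ) else 0)|
        ≤ |m.traceCoeff| * (2 * s) := by
      rw [abs_mul, abs_mul]
      have h4 : |(if i = j then (1 : ℝ) else 0)| ≤ 1 := by split_ifs <;> simp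
      calc _ ≤ |m.traceCoeff| * |H 0 0 + H 1 1| * 1 := by gcongr
        _ ≤ _ := by rw [mul_one]; gcongr; linarith [hs 0 0, hs 1 1]
    calc _ ≤ |1 / 2 * (H i j + H j i)|
          + |m.traceCoeff * (H 0 0 + H 1 1) * (if i = j then (1 : ℝ) else 0)| := abs_add_le _ _
      _ ≤ s + |m.traceCoeff| * (2 * s) := by
        refine add_le_add ?_ h3
        rw [abs_mul, abs_of_pos (by norm_num : (0 : ℝ) < 1 / 2)]
        linarith [hs i j, hs j i]
      _ = _ := by ring
  calc |contraction m H H'| ≤ ∑ i, ∑ j, |momentOfHessian m H i j * curvature H' i j| :=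
        (Finset.abs_sum_le_sum_abs _ _).trans
          (Finset.sum_le_sum fun i _ => Finset.abs_sum_le_sum_abs _ _)
    _ ≤ ∑ _i : Fin 2, ∑ _j : Fin 2, |m.momentCoeff| * (1 + 2 * |m.traceCoeff|) * s * b := by
        refine Finset.sum_le_sum fun i _ => Finset.sum_le_sum fun j _ => ?_
        rw [abs_mul]
        exact mul_le_mul (hM i j) (hκ i j) (abs_nonneg _) ((abs_nonneg _).trans (hM i j))
    _ = _ := by simp only [Fin.sum_univ_two]; ring

/-- The integrand of the squared `H²` distance. -/
def h2Density {Ω : Set Plane} (u v : H2Function Ω) (x : Plane) : ℝ :=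
  (u.val x - v.val x) ^ 2 + ∑ i, (u.grad i x - v.grad i x) ^ 2
    + ∑ i, ∑ j, (u.hess i j x - v.hess i j x) ^ 2

theorem h2Density_nonneg {Ω : Set Plane} (u v : H2Function Ω) (x : Plane) : 0 ≤ h2Density u v x := by
  unfold h2Density; positivity

theorem abs_hess_sub_le {Ω : Set Plane} (u v : H2Function Ω) (x : Plane) (i j : Fin 2) :
    |(u.hessian x - v.hessian x) i j| ≤ √(h2Density u v x) := by
  refine Real.abs_le_sqrt ?_
  have h1 : (u.hess i j x - v.hess i j x) ^ 2 ≤ ∑ j, (u.hess i j x - v.hess i j x) ^ 2 :=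
    Finset.single_le_sum (f := fun j => (u.hess i j x - v.hess i j x) ^ 2)
      (fun _ _ => sq_nonneg _) (Finset.mem_univ j)
  have h2 : ∑ j, (u.hess i j x - v.hess i j x) ^ 2 ≤ ∑ i, ∑ j, (u.hess i j x - v.hess i j x) ^ 2 :=
    Finset.single_le_sum (f := fun i => ∑ j, (u.hess i j x - v.hess i j x) ^ 2)
      (fun _ _ => Finset.sum_nonneg fun _ _ => sq_nonneg _) (Finset.mem_univ i)
  have h3 : 0 ≤ (u.val x - v.val x) ^ 2 + ∑ i, (u.grad i x - v.grad i x) ^ 2 := by positivity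
  change (u.hess i j x - v.hess i j x) ^ 2 ≤ _
  unfold h2Density
  linarith

theorem integrableOn_h2Density {Ω : Set Plane} (u v : H2Function Ω) :
    IntegrableOn (h2Density u v) Ω := by
  refine Integrable.add (Integrable.add ?_ ?_) ?_
  · exact (u.isH1.memLp.sub v.isH1.memLp).integrable_sq
  · exact integrable_finsetSum _ fun i _ =>
      ((u.isH1.memLp_grad i).sub (v.isH1.memLp_grad i)).integrable_sq
  · exact integrable_finsetSum _ fun i _ => integrable_finsetSum _ fun j _ =>
      (((u.isH1_grad i).memLp_grad j).sub ((v.isH1_grad i).memLp_grad j)).integrable_sq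

theorem memLp_sqrt_h2Density {Ω D : Set Plane} (u v : H2Function Ω)
    (hD : (volume : Measure Plane).restrict D ≤ volume.restrict Ω) :
    MemLp (fun x => √(h2Density u v x)) 2 (volume.restrict D) := by
  have hi : Integrable (h2Density u v) (volume.restrict D) :=
    Integrable.mono_measure (integrableOn_h2Density u v) hD
  rw [memLp_two_iff_integrable_sq (Real.continuous_sqrt.comp_aestronglyMeasurable hi.1)]
  refine hi.congr (Eventually.of_forall fun x => ?_)
  exact (Real.sq_sqrt (h2Density_nonneg u v x)).symm

theorem h2Dist_eq {Ω : Set Plane} (A : Set Plane) (u v : H2Function Ω) :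
    h2Dist A u v = l2Norm A (fun x => √(h2Density u v x)) := by
  rw [l2Norm, h2Dist]
  congr 2
  funext x
  rw [Real.sq_sqrt (h2Density_nonneg u v x)]
  rfl

theorem continuous_hessianAt {w : Plane → ℝ} (hw : ContDiff ℝ ∞ w) (i j : Fin 2) :
    Continuous fun x => hessianAt w x i j := (contDiff_pd (contDiff_pd hw i) j).continuous

theorem hessianAt_eq_zero {w : Plane → ℝ} {x : Plane} (hx : x ∉ tsupport w) : hessianAt w x = 0 := by
  ext i j
  exact pd_eq_zero_of_notMem_tsupport (fun h => hx (tsupport_pd_subset w i h)) j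

theorem contraction_zero (m : Material) (H : Matrix (Fin 2) (Fin 2) ℝ) : contraction m H 0 = 0 := by
  simp [contraction, curvature]

theorem integrableOn_contraction (m : Material) {Ω D : Set Plane} (u : H2Function Ω)
    {w : Plane → ℝ} (hw : ContDiff ℝ ∞ w) (hc : HasCompactSupport w)
    (hD : (volume : Measure Plane).restrict D ≤ volume.restrict Ω) :
    IntegrableOn (fun x => contraction m (u.hessian x) (hessianAt w x)) D := by
  have hu : ∀ i j, MemLp (fun x => u.hessian x i j) 2 (volume.restrict D) := fun i j =>
    ((u.isH1_grad i).memLp_grad j).mono_measure hD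
  have hM : ∀ i j, MemLp (fun x => momentOfHessian m (u.hessian x) i j) 2 (volume.restrict D) := by
    intro i j
    simp only [momentOfHessian_apply]
    exact ((((hu i j).add (hu j i)).const_mul _).add
      ((((hu 0 0).add (hu 1 1)).const_mul _).mul_const _)).const_mul _
  have hκ : ∀ i j, MemLp (fun x => curvature (hessianAt w x) i j) 2 (volume.restrict D) := by
    intro i j
    have h1 : Continuous fun x => curvature (hessianAt w x) i j := by
      simp only [curvature_apply]
      exact (continuous_const.mul ((continuous_hessianAt hw i j).add (continuous_hessianAt hw j i))).neg
    refine (h1.memLp_of_hasCompactSupport (HasCompactSupport.intro hc fun x hx => ?_)).restrict D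
    rw [hessianAt_eq_zero hx]; simp [curvature]
  exact integrable_finsetSum _ fun i _ => integrable_finsetSum _ fun j _ =>
    MemLp.integrable_mul (p := 2) (q := 2) (hM i j) (hκ i j)

/-- The weak formulation, tested with a smooth function `w` that meets only the triangles of the
patch `𝒦` and vanishes at the point load. -/
theorem IsWeakSolution.residual_eq {m : Material} {P : Plate} {L : Load} {u : H2Function P.Ω}
    (hu : IsWeakSolution m P L u) (hL : L.Admissible P.Ω) {T : Mesh P.Ω} {k : ℕ}
    {v : H2Function P.Ω} {q : Finset Plane → MvPolynomial (Fin 2) ℝ} (hv : IsFEFunction P T k v q)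
    {𝒦 : Finset (Finset Plane)} (h𝒦 : ∀ K ∈ 𝒦, K ∈ T.elements)
    {w : Plane → ℝ} (hw : ContDiff ℝ ∞ w) (hc : HasCompactSupport w)
    (hV : MemV P (smoothH2 P.Ω hw hc)) (hsupp : ∀ x ∈ P.Ω, x ∈ tsupport w → ∃ K ∈ 𝒦, x ∈ hull K)
    (hx₀ : L.F * w L.x₀ = 0) :
    ∑ K ∈ 𝒦, ((∫ x in hull K, energyDensity m (polyFun (q K)) w x)
        - ∫ x in hull K, plateOp m (polyFun (q K)) x * w x) - ∫ x in L.S, L.g x * w x ∂μH[1]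
      = ∑ K ∈ 𝒦, ((∫ x in hull K, (L.f x - plateOp m (polyFun (q K)) x) * w x)
        - ∫ x in hull K, contraction m (u.hessian x - v.hessian x) (hessianAt w x)) := by
  have h1 := hu.eq _ hV
  have hf : MemLp L.f 2 (volume.restrict P.Ω) := hL.memLp_f
  have hwL : MemLp w 2 (volume : Measure Plane) := hw.continuous.memLp_of_hasCompactSupport hc
  have hfw : IntegrableOn (fun x => L.f x * w x) P.Ω :=
    MemLp.integrable_mul (p := 2) (q := 2) hf (hwL.restrict P.Ω)
  have e1 : bilin m u (smoothH2 P.Ω hw hc)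
      = ∑ K ∈ 𝒦, ∫ x in hull K, contraction m (u.hessian x) (hessianAt w x) := by
    refine T.setIntegral_eq_sum h𝒦 (integrableOn_contraction m u hw hc le_rfl) fun x hx hne => ?_
    refine hsupp x hx (by_contra fun h => hne ?_)
    change contraction m (u.hessian x) (hessianAt w x) = 0
    rw [hessianAt_eq_zero h, contraction_zero]
  have e2 : ∫ x in P.Ω, L.f x * w x = ∑ K ∈ 𝒦, ∫ x in hull K, L.f x * w x := by
    refine T.setIntegral_eq_sum h𝒦 hfw fun x hx hne => ?_
    refine hsupp x hx (by_contra fun h => hne ?_)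
    rw [image_eq_zero_of_notMem_tsupport h, mul_zero]
  have e3 : L.functional (smoothH2 P.Ω hw hc)
      = (∫ x in P.Ω, L.f x * w x) + (∫ x in L.S, L.g x * w x ∂μH[1]) + L.F * w L.x₀ := rfl
  rw [e1, e3, e2, hx₀, add_zero] at h1
  have e4 : ∀ K ∈ 𝒦, (∫ x in hull K, energyDensity m (polyFun (q K)) w x)
        - ∫ x in hull K, plateOp m (polyFun (q K)) x * w x
      = ((∫ x in hull K, (L.f x - plateOp m (polyFun (q K)) x) * w x)
        - ∫ x in hull K, contraction m (u.hessian x - v.hessian x) (hessianAt w x))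
        + ((∫ x in hull K, contraction m (u.hessian x) (hessianAt w x))
          - ∫ x in hull K, L.f x * w x) := by
    intro K hK
    have hle := T.restrict_hull_le (h𝒦 K hK)
    have a1 : ∫ x in hull K, energyDensity m (polyFun (q K)) w x
        = ∫ x in hull K, contraction m (v.hessian x) (hessianAt w x) := by
      refine integral_congr_ae ?_
      filter_upwards [hv.hessian_ae (h𝒦 K hK)] with x hx
      rw [hx]; rfl
    have a2 : ∫ x in hull K, contraction m (u.hessian x - v.hessian x) (hessianAt w x)
        = (∫ x in hull K, contraction m (u.hessian x) (hessianAt w x))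
          - ∫ x in hull K, contraction m (v.hessian x) (hessianAt w x) := by
      simp only [contraction_sub]
      exact integral_sub (integrableOn_contraction m u hw hc hle)
        (integrableOn_contraction m v hw hc hle)
    have a3 : ∫ x in hull K, (L.f x - plateOp m (polyFun (q K)) x) * w x
        = (∫ x in hull K, L.f x * w x) - ∫ x in hull K, plateOp m (polyFun (q K)) x * w x := by
      simp only [sub_mul]
      exact integral_sub (Integrable.mono_measure hfw hle)
        (integrableOn_mul_smooth (contDiff_plateOp m (contDiff_polyFun _)) hw hc _)
    rw [a1, a2, a3]; ring
  rw [Finset.sum_congr rfl e4, Finset.sum_add_distrib, Finset.sum_sub_distrib (f := fun K =>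
    ∫ x in hull K, contraction m (u.hessian x) (hessianAt w x)), h1]
  ring

theorem memLp_sub_load {P : Plate} {L : Load} (hL : L.Admissible P.Ω)
    {T : Mesh P.Ω} {K : Finset Plane} (hK : K ∈ T.elements) {p : Plane → ℝ} (hp : Continuous p) :
    MemLp (fun x => p x - L.f x) 2 (volume.restrict (hull K)) := by
  refine MemLp.sub ?_ (hL.memLp_f.mono_measure (T.restrict_hull_le hK))
  have : IsFiniteMeasure ((volume : Measure Plane).restrict (hull K)) :=
    isFiniteMeasure_restrict.2 (isCompact_hull K).measure_lt_top.ne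
  obtain ⟨B, hB⟩ := (isCompact_hull K).exists_bound_of_continuousOn hp.continuousOn
  refine MemLp.of_bound hp.aestronglyMeasurable B ?_
  exact (ae_restrict_iff' (measurableSet_hull K)).2 (Eventually.of_forall hB)

/-- The constant in the estimate of the energy of a test function. -/
def energyConst (m : Material) : ℝ := 4 * |m.momentCoeff| * (1 + 2 * |m.traceCoeff|)

theorem energyConst_nonneg (m : Material) : 0 ≤ energyConst m := by unfold energyConst; positivity

theorem abs_setIntegral_contraction_le (m : Material) {Ω D : Set Plane} (u v : H2Function Ω)
    (hD : MeasurableSet D) (hle : (volume : Measure Plane).restrict D ≤ volume.restrict Ω)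
    {w : Plane → ℝ} {o : Plane} {ρ b₂ : ℝ} (hρ : 0 ≤ ρ) (hb₂ : 0 ≤ b₂)
    (hball : tsupport w ⊆ Metric.closedBall o ρ) (hw₂ : ∀ x ∈ D, ∀ i j, |hessianAt w x i j| ≤ b₂) :
    |∫ x in D, contraction m (u.hessian x - v.hessian x) (hessianAt w x)|
      ≤ (energyConst m * b₂) * (√discArea * ρ * h2Dist D u v) := by
  rw [h2Dist_eq]
  refine abs_setIntegral_le (mul_nonneg (energyConst_nonneg m) hb₂) hρ
    (memLp_sqrt_h2Density u v hle) ?_ (x₀ := o) fun x hx => ?_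
  · refine (ae_restrict_iff' hD).2 (Eventually.of_forall fun x hx => ?_)
    refine (abs_contraction_le m (abs_hess_sub_le u v x) (hw₂ x hx)).trans_eq ?_
    rw [abs_of_nonneg (Real.sqrt_nonneg _), energyConst]; ring
  · rw [hessianAt_eq_zero fun h => hx (hball h), contraction_zero]

/-- The residual tested with `w` is bounded by the element residuals and the `H²` distance. -/
theorem IsWeakSolution.abs_residual_le {m : Material} {P : Plate} {L : Load} {u : H2Function P.Ω}
    (hu : IsWeakSolution m P L u) (hL : L.Admissible P.Ω) {T : Mesh P.Ω} {k : ℕ}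
    {v : H2Function P.Ω} {q : Finset Plane → MvPolynomial (Fin 2) ℝ} (hv : IsFEFunction P T k v q)
    {𝒦 : Finset (Finset Plane)} (h𝒦 : ∀ K ∈ 𝒦, K ∈ T.elements)
    {w : Plane → ℝ} (hw : ContDiff ℝ ∞ w) (hc : HasCompactSupport w)
    (hV : MemV P (smoothH2 P.Ω hw hc)) (hsupp : ∀ x ∈ P.Ω, x ∈ tsupport w → ∃ K ∈ 𝒦, x ∈ hull K)
    (hx₀ : L.F * w L.x₀ = 0) {o : Plane} {ρ b₀ b₂ : ℝ} (hρ : 0 ≤ ρ) (hb₀ : 0 ≤ b₀) (hb₂ : 0 ≤ b₂)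
    (hball : tsupport w ⊆ Metric.closedBall o ρ) (hw₀ : ∀ K ∈ 𝒦, ∀ x ∈ hull K, |w x| ≤ b₀)
    (hw₂ : ∀ K ∈ 𝒦, ∀ x ∈ hull K, ∀ i j, |hessianAt w x i j| ≤ b₂) :
    |∑ K ∈ 𝒦, ((∫ x in hull K, energyDensity m (polyFun (q K)) w x)
        - ∫ x in hull K, plateOp m (polyFun (q K)) x * w x) - ∫ x in L.S, L.g x * w x ∂μH[1]|
      ≤ √discArea * ρ * ∑ K ∈ 𝒦,
        (b₀ * l2Norm (hull K) (fun x => plateOp m (polyFun (q K)) x - L.f x)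
          + energyConst m * b₂ * h2Dist (hull K) u v) := by
  rw [hu.residual_eq hL hv h𝒦 hw hc hV hsupp hx₀, Finset.mul_sum]
  refine (Finset.abs_sum_le_sum_abs _ _).trans (Finset.sum_le_sum fun K hK => ?_)
  rw [sub_eq_add_neg]
  refine (abs_add_le _ _).trans ?_
  rw [abs_neg]
  have hle := T.restrict_hull_le (h𝒦 K hK)
  have r1 : |∫ x in hull K, (L.f x - plateOp m (polyFun (q K)) x) * w x|
      ≤ b₀ * (√discArea * ρ * l2Norm (hull K) (fun x => plateOp m (polyFun (q K)) x - L.f x)) := by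
    refine abs_setIntegral_le hb₀ hρ (memLp_sub_load hL (h𝒦 K hK)
      (contDiff_plateOp m (contDiff_polyFun _)).continuous) ?_ (x₀ := o) fun x hx => ?_
    · refine (ae_restrict_iff' (measurableSet_hull K)).2 (Eventually.of_forall fun x hx => ?_)
      rw [abs_mul, abs_sub_comm, mul_comm]
      exact mul_le_mul_of_nonneg_right (hw₀ K hK x hx) (abs_nonneg _)
    · rw [image_eq_zero_of_notMem_tsupport fun h => hx (hball h), mul_zero]
  have r2 : |∫ x in hull K, contraction m (u.hessian x - v.hessian x) (hessianAt w x)|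
      ≤ (energyConst m * b₂) * (√discArea * ρ * h2Dist (hull K) u v) :=
    abs_setIntegral_contraction_le m u v (measurableSet_hull K) hle hρ hb₂ hball (hw₂ K hK)
  calc _ ≤ _ := add_le_add r1 r2
    _ = _ := by ring

/-! ### Localised test functions -/

section Load

variable {P : Plate} {L : Load} {T : Mesh P.Ω} {𝒦 : Finset (Finset Plane)} {E : Finset Plane}
  {w : Plane → ℝ}

/-- The point load does not see a test function supported away from the nodes. -/
theorem Mesh.Fits.point_eq_zero (hfit : T.Fits L) (hL : L.Admissible P.Ω) (hE : 2 ≤ E.card)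
    (h𝒦 : ∀ K ∈ 𝒦, K ∈ T.elements)
    (hsupp : ∀ x ∈ closure P.Ω, x ∈ tsupport w → ∃ K ∈ 𝒦, x ∈ hull K)
    (hface : ∀ K ∈ 𝒦, ∀ x ∈ tsupport w, ∀ F ⊆ K, x ∈ hull F → E ⊆ F) :
    L.F * w L.x₀ = 0 := by
  by_contra hne
  have hx : L.x₀ ∈ tsupport w := subset_tsupport w (right_ne_zero_of_mul hne)
  obtain ⟨K, hK, hxK⟩ := hsupp _ (subset_closure hL.x₀_mem) hx
  have hv : {L.x₀} ∈ T.complex.faces := hfit.node (left_ne_zero_of_mul hne)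
  have h1 := T.mem_hull_inter (h𝒦 K hK).1 hv hxK (by simp [hull])
  have h2 := hface K hK _ hx _ Finset.inter_subset_left h1
  have h3 := Finset.card_le_card (h2.trans Finset.inter_subset_right)
  rw [Finset.card_singleton] at h3
  omega

/-- The line load acts on a test function only along `E`, if the support of the test function meets
no face of the triangles except those containing `E`. -/
theorem Mesh.Fits.mem_lineEdges (hfit : T.Fits L) (hL : L.Admissible P.Ω) (hE : 2 ≤ E.card)
    (h𝒦 : ∀ K ∈ 𝒦, K ∈ T.elements)
    (hsupp : ∀ x ∈ closure P.Ω, x ∈ tsupport w → ∃ K ∈ 𝒦, x ∈ hull K)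
    (hface : ∀ K ∈ 𝒦, ∀ x ∈ tsupport w, ∀ F ⊆ K, x ∈ hull F → E ⊆ F) {x : Plane} (hx : x ∈ L.S)
    (hw : w x ≠ 0) : E ∈ T.lineEdges L.S ∧ x ∈ hull E := by
  have hxs : x ∈ tsupport w := subset_tsupport w hw
  obtain ⟨K, hK, hxK⟩ := hsupp x (hL.S_subset hx) hxs
  rw [hfit.line] at hx
  obtain ⟨E', hE', hxE'⟩ := Set.mem_iUnion₂.1 hx
  have h1 := T.mem_hull_inter (h𝒦 K hK).1 hE'.1.1.1 hxK hxE'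
  have h2 := (hface K hK _ hxs _ Finset.inter_subset_left h1).trans Finset.inter_subset_right
  have h3 : E = E' := Finset.eq_of_subset_of_card_le h2 (by rw [hE'.1.1.2]; exact hE)
  rw [h3]
  exact ⟨hE', hxE'⟩

theorem Mesh.Fits.measurableSet (hfit : T.Fits L) : MeasurableSet L.S := by
  rw [hfit.line]
  refine Set.Finite.measurableSet_biUnion ?_ fun E _ => measurableSet_hull E
  exact T.finite.subset fun E hE => hE.1.1.1

theorem Mesh.Fits.setIntegral_line (hfit : T.Fits L) (hL : L.Admissible P.Ω) (hE : 2 ≤ E.card)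
    (h𝒦 : ∀ K ∈ 𝒦, K ∈ T.elements)
    (hsupp : ∀ x ∈ closure P.Ω, x ∈ tsupport w → ∃ K ∈ 𝒦, x ∈ hull K)
    (hface : ∀ K ∈ 𝒦, ∀ x ∈ tsupport w, ∀ F ⊆ K, x ∈ hull F → E ⊆ F)
    (hES : E ∈ T.lineEdges L.S) :
    ∫ x in L.S, L.g x * w x ∂μH[1] = ∫ x in hull E, L.g x * w x ∂μH[1] := by
  refine setIntegral_eq_of_subset_of_forall_sdiff_eq_zero hfit.measurableSet hES.2 fun x hx => ?_
  by_contra hne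
  exact hx.2 (hfit.mem_lineEdges hL hE h𝒦 hsupp hface hx.1 (right_ne_zero_of_mul hne)).2

theorem Mesh.Fits.setIntegral_line_eq_zero (hfit : T.Fits L) (hL : L.Admissible P.Ω)
    (hE : 2 ≤ E.card) (h𝒦 : ∀ K ∈ 𝒦, K ∈ T.elements)
    (hsupp : ∀ x ∈ closure P.Ω, x ∈ tsupport w → ∃ K ∈ 𝒦, x ∈ hull K)
    (hface : ∀ K ∈ 𝒦, ∀ x ∈ tsupport w, ∀ F ⊆ K, x ∈ hull F → E ⊆ F)
    (hES : E ∉ T.lineEdges L.S) :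
    ∫ x in L.S, L.g x * w x ∂μH[1] = 0 := by
  refine setIntegral_eq_zero_of_forall_eq_zero fun x hx => ?_
  by_contra hne
  exact hES (hfit.mem_lineEdges hL hE h𝒦 hsupp hface hx (right_ne_zero_of_mul hne)).1

end Load

/-- On the triangles of the patch `𝒦`, the function `w` agrees with an admissible smooth test
function that vanishes on the rest of the domain and is supported in a disc around `m`. -/
def HasLocalTest (P : Plate) (𝒦 : Finset (Finset Plane)) (m : Plane) (ρ : ℝ) (w : Plane → ℝ) : Prop :=
  ∃ (W : Plane → ℝ) (hW : ContDiff ℝ ∞ W) (hc : HasCompactSupport W), MemV P (smoothH2 P.Ω hW hc) ∧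
    tsupport W ⊆ Metric.closedBall m ρ ∧ (∀ K ∈ 𝒦, ∀ x ∈ hull K, W =ᶠ[𝓝 x] w) ∧
    ∀ x ∈ closure P.Ω, x ∈ tsupport W → ∃ K ∈ 𝒦, x ∈ hull K

theorem memV_smoothH2_of_subset (P : Plate) {w : Plane → ℝ} (hw : ContDiff ℝ ∞ w)
    (hc : HasCompactSupport w) (hΩ : tsupport w ⊆ P.Ω) : MemV P (smoothH2 P.Ω hw hc) := by
  have hdis : ∀ x ∈ frontier P.Ω, x ∉ tsupport w := fun x hx h => by
    rw [P.domain.isOpen.frontier_eq] at hx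
    exact hx.2 (hΩ h)
  refine memV_smoothH2 P hw hc ?_ ?_
  · refine Set.finite_empty.subset fun x hx => ?_
    refine hdis x ?_ (subset_tsupport w hx.2)
    rw [← P.boundary]
    exact Or.inl hx.1
  · refine Set.finite_empty.subset fun x hx => hdis x ?_ hx.2
    rw [← P.boundary]
    exact Or.inl (Or.inl hx.1)

theorem hasLocalTest_of_subset {P : Plate} {𝒦 : Finset (Finset Plane)} {m : Plane} {ρ : ℝ}
    {w : Plane → ℝ} (hw : ContDiff ℝ ∞ w) (hwρ : tsupport w ⊆ Metric.closedBall m ρ)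
    (hΩ : Metric.closedBall m ρ ⊆ P.Ω) (h𝒦 : ∀ x ∈ Metric.closedBall m ρ, ∃ K ∈ 𝒦, x ∈ hull K) :
    HasLocalTest P 𝒦 m ρ w := by
  have hc : HasCompactSupport w :=
    (isCompact_closedBall m ρ).of_isClosed_subset (isClosed_tsupport w) hwρ
  exact ⟨w, hw, hc, memV_smoothH2_of_subset P hw hc (hwρ.trans hΩ), hwρ,
    fun _ _ _ _ => EventuallyEq.rfl, fun x _ hx => h𝒦 x (hwρ hx)⟩

theorem hessianAt_congr {v w : Plane → ℝ} {x : Plane} (h : v =ᶠ[𝓝 x] w) :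
    hessianAt v x = hessianAt w x := by
  ext i j
  exact (pd_congr (pd_congr h i) j).eq_of_nhds

/-! ### Residuals on edges -/

/-- Green's formula on a triangle, for a test function supported near the midpoint of an edge. -/
theorem RegularAt.green (m : Material) {κ : ℝ} {K E : Finset Plane} {n o : Plane} {h : ℝ}
    (hK : RegularAt κ K E n o h) {q w : Plane → ℝ} (hq : ContDiff ℝ ∞ q) (hw : ContDiff ℝ ∞ w)
    (hsupp : tsupport w ⊆ Metric.closedBall o (discRadius κ * h / 2)) :
    (∫ x in hull K, energyDensity m q w x) - ∫ x in hull K, plateOp m q x * w x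
      = ∫ x in hull E, (Vn m n q x * w x - Mnn m n q x * fderiv ℝ w x n) ∂μH[1] := by
  have hc : HasCompactSupport w :=
    (isCompact_closedBall o _).of_isClosed_subset (isClosed_tsupport w) hsupp
  have hn := hK.frame.norm
  have hh := hK.frame.pos
  have hδ := discRadius_pos κ
  have hball : ∀ x ∈ tsupport w, ‖x - o‖ ≤ discRadius κ * h / 2 := fun x hx => by
    have := hsupp hx
    rwa [Metric.mem_closedBall, dist_eq_norm] at this
  have hmem : ∀ x ∈ halfPlane n o, x ∈ tsupport w → x ∈ hull K := fun x hx hxw =>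
    hK.mem_hull ((hball x hxw).trans (by nlinarith [mul_pos hδ hh])) hx
  have h1 := green_halfPlane m hn o hq hw hc
  rw [setIntegral_eq_halfPlane hK.hull_subset (fun x hx hne => hmem x hx (by_contra fun h => hne ?_)),
    setIntegral_eq_halfPlane hK.hull_subset (fun x hx hne => hmem x hx (by_contra fun h => hne ?_))]
    at h1
  · rw [h1, hK.frame.setIntegral_eq, lineIntegral, add_sub_cancel_left]
    refine (setIntegral_eq_integral_of_forall_compl_eq_zero fun t ht => ?_).symm
    have hnot : frameMap n o (t, 0) ∉ tsupport w := fun hx => ht ?_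
    · rw [image_eq_zero_of_notMem_tsupport hnot, fderiv_of_notMem_tsupport ℝ hnot]; simp
    · have h2 := (RegularAt.abs_coords_le hn (hball _ hx)).1
      rw [inner_tangent_frameMap hn] at h2
      have h3 : discRadius κ * h / 2 ≤ h / 2 := by nlinarith [discRadius_le κ]
      exact abs_le.1 (h2.trans h3)
  · rw [image_eq_zero_of_notMem_tsupport h, mul_zero]
  · change contraction m (hessianAt q x) (hessianAt w x) = 0
    rw [hessianAt_eq_zero h, contraction_zero]

/-- `𝒦` is a nonempty set of triangles with the common edge `E`, on which they have the outer normals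
`ν`; the normal `n` fixes an orientation of the edge. -/
structure EdgePatch {P : Plate} (T : Mesh P.Ω) (κ : ℝ) (E : Finset Plane) (n m : Plane) (h : ℝ)
    (𝒦 : Finset (Finset Plane)) (ν : Finset Plane → Plane) : Prop where
  frame : EdgeFrame E n m h
  mem : ∀ K ∈ 𝒦, K ∈ T.elements
  regular : ∀ K ∈ 𝒦, RegularAt κ K E (ν K) m h
  nonempty : 𝒦.Nonempty

theorem EdgeFrame.card_eq {E : Finset Plane} {n m : Plane} {h : ℝ} (hE : EdgeFrame E n m h) :
    E.card = 2 := by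
  rw [hE.eq, Finset.card_pair]
  intro he
  have := congrArg (fun x => inner ℝ (tangent n) (x - m)) he
  simp [inner_smul_right, norm_tangent, hE.norm] at this
  linarith [hE.pos]

/-- The part of the line load seen by a test function near the edge `E`. -/
def lineLoad {Ω : Set Plane} (T : Mesh Ω) (L : Load) (E : Finset Plane) (x : Plane) : ℝ :=
  open Classical in if E ∈ T.lineEdges L.S then L.g x else 0

theorem integrableOn_edge {E : Finset Plane} {n m : Plane} {h : ℝ} (hE : EdgeFrame E n m h)
    {F : Plane → ℝ} (hF : Continuous F) : IntegrableOn F (hull E) μH[1] := by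
  have hfin : (μH[1] : Measure Plane) (hull E) ≠ ⊤ := by
    rw [hE.hausdorffMeasure_hull]; exact ENNReal.ofReal_ne_top
  exact hF.continuousOn.integrableOn_of_subset_isCompact (isCompact_hull E) (measurableSet_hull E)
    subset_rfl hfin

/-- `V` and `M` are the sums, over the triangles `𝒦` adjacent to an edge with normal `n`, of the
effective shear forces and of the normal moments that work on the deflection and on its normal
derivative: the boundary terms of Green's formulas on the triangles add up to `V w - M ∂ₙw`. -/
def IsEdgeForce (m : Material) (q : Finset Plane → MvPolynomial (Fin 2) ℝ) (n : Plane)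
    (𝒦 : Finset (Finset Plane)) (ν : Finset Plane → Plane) (V M : Plane → ℝ) : Prop :=
  ∀ (t : ℝ) (l : Plane →L[ℝ] ℝ) (x : Plane), ∑ K ∈ 𝒦, (Vn m (ν K) (polyFun (q K)) x * t
      - Mnn m (ν K) (polyFun (q K)) x * l (ν K)) = V x * t - M x * l n

/-- The edge forces, tested with a function supported near the edge, are controlled by the element
residuals and by the error on the adjacent triangles. -/
theorem EdgePatch.abs_residual_le {m : Material} {P : Plate} {L : Load} {u : H2Function P.Ω}
    (hu : IsWeakSolution m P L u) (hL : L.Admissible P.Ω) {T : Mesh P.Ω} (hfit : T.Fits L) {k : ℕ}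
    {v : H2Function P.Ω} {q : Finset Plane → MvPolynomial (Fin 2) ℝ} (hv : IsFEFunction P T k v q)
    {κ : ℝ} {E : Finset Plane} {n o : Plane} {h : ℝ} {𝒦 : Finset (Finset Plane)}
    {ν : Finset Plane → Plane} (hp : EdgePatch T κ E n o h 𝒦 ν) {w : Plane → ℝ}
    (hw : HasLocalTest P 𝒦 o (discRadius κ * h / 2) w) {V M : Plane → ℝ}
    (hVM : IsEdgeForce m q n 𝒦 ν V M) {b₀ b₂ : ℝ} (hw₀ : ∀ x, |w x| ≤ b₀) (hw₂ : ∀ x i j, |hessianAt w x i j| ≤ b₂) :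
    |∫ x in hull E, (V x * w x - M x * fderiv ℝ w x n) ∂μH[1]
        - ∫ x in hull E, lineLoad T L E x * w x ∂μH[1]|
      ≤ √discArea * h * (b₀ * ∑ K ∈ 𝒦, l2Norm (hull K) (fun x => plateOp m (polyFun (q K)) x - L.f x)
          + energyConst m * b₂ * ∑ K ∈ 𝒦, h2Dist (hull K) u v) := by
  obtain ⟨W, hW, hc, hV, hball, heq, hsupp⟩ := hw
  have hδ := discRadius_pos κ
  have hh := hp.frame.pos
  have hb₀ : 0 ≤ b₀ := (abs_nonneg _).trans (hw₀ 0)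
  have hb₂ : 0 ≤ b₂ := (abs_nonneg _).trans (hw₂ 0 0 0)
  have hcard : 2 ≤ E.card := hp.frame.card_eq.ge
  have hface : ∀ K ∈ 𝒦, ∀ x ∈ tsupport W, ∀ F ⊆ K, x ∈ hull F → E ⊆ F := by
    intro K hK x hx F hF hxF
    refine (hp.regular K hK).edge_subset_face (x := x) ?_ hF hxF
    have := hball hx
    rw [Metric.mem_closedBall, dist_eq_norm] at this
    nlinarith [mul_pos hδ hh]
  have h1 := hu.abs_residual_le hL hv hp.mem hW hc hV (fun x hx => hsupp x (subset_closure hx))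
    (hfit.point_eq_zero hL hcard hp.mem hsupp hface) (ρ := discRadius κ * h / 2) (by positivity)
    hb₀ hb₂ hball
    (fun K hK x hx => by rw [(heq K hK x hx).eq_of_nhds]; exact hw₀ x)
    (fun K hK x hx => by rw [hessianAt_congr (heq K hK x hx)]; exact hw₂ x)
  obtain ⟨K₀, hK₀⟩ := hp.nonempty
  have hEW : ∀ x ∈ hull E, W =ᶠ[𝓝 x] w := fun x hx =>
    heq K₀ hK₀ x (hull_mono (hp.regular K₀ hK₀).sub hx)
  have e1 : ∑ K ∈ 𝒦, ((∫ x in hull K, energyDensity m (polyFun (q K)) W x)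
        - ∫ x in hull K, plateOp m (polyFun (q K)) x * W x)
      = ∫ x in hull E, (V x * w x - M x * fderiv ℝ w x n) ∂μH[1] := by
    rw [Finset.sum_congr rfl fun K hK => (hp.regular K hK).green m (contDiff_polyFun (q K)) hW hball,
      ← integral_finsetSum]
    · refine setIntegral_congr_fun (measurableSet_hull E) fun x hx => ?_
      beta_reduce
      rw [hVM, (hEW x hx).eq_of_nhds, (hEW x hx).fderiv_eq]
    · intro K _
      have hqK : IsPolyFun _ (polyFun (q K)) := ⟨q K, le_rfl, rfl⟩
      have c1 := (hqK.vn m (ν K)).smooth.continuous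
      have c2 := (hqK.mnn m (ν K)).smooth.continuous
      have c3 : Continuous fun x => fderiv ℝ W x (ν K) :=
        (hW.continuous_fderiv (by norm_num)).clm_apply continuous_const
      exact integrableOn_edge hp.frame ((c1.mul hW.continuous).sub (c2.mul c3))
  have e2 : ∫ x in L.S, L.g x * W x ∂μH[1] = ∫ x in hull E, lineLoad T L E x * w x ∂μH[1] := by
    by_cases hES : E ∈ T.lineEdges L.S
    · rw [hfit.setIntegral_line hL hcard hp.mem hsupp hface hES]
      refine setIntegral_congr_fun (measurableSet_hull E) fun x hx => ?_
      simp only [lineLoad, if_pos hES, (hEW x hx).eq_of_nhds]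
    · rw [hfit.setIntegral_line_eq_zero hL hcard hp.mem hsupp hface hES]
      simp [lineLoad, if_neg hES]
  rw [e1, e2] at h1
  refine h1.trans ?_
  have hR : 0 ≤ ∑ K ∈ 𝒦, (b₀ * l2Norm (hull K) (fun x => plateOp m (polyFun (q K)) x - L.f x)
      + energyConst m * b₂ * h2Dist (hull K) u v) := by
    refine Finset.sum_nonneg fun K _ => add_nonneg (mul_nonneg hb₀ (l2Norm_nonneg _ _))
      (mul_nonneg (mul_nonneg (energyConst_nonneg m) hb₂) ?_)
    rw [h2Dist_eq]; exact l2Norm_nonneg _ _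
  rw [Finset.sum_add_distrib, ← Finset.mul_sum, ← Finset.mul_sum] at hR ⊢
  refine mul_le_mul_of_nonneg_right (mul_le_mul_of_nonneg_left ?_ (Real.sqrt_nonneg _)) hR
  nlinarith [discRadius_le κ]

/-! ### Test functions along an edge -/

/-- The coefficients `c`, placed in the column of the monomials `t ^ i * y ^ j₀`. -/
def column {N : ℕ} (j₀ : Fin N) (c : Fin N → ℝ) (p : Fin N × Fin N) : ℝ :=
  if p.2 = j₀ then c p.1 else 0

theorem norm_column_le {N : ℕ} (j₀ : Fin N) (c : Fin N → ℝ) : ‖column j₀ c‖ ≤ ‖c‖ := by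
  refine (pi_norm_le_iff_of_nonneg (norm_nonneg c)).2 fun p => ?_
  unfold column
  split_ifs
  · exact norm_le_pi_norm c p.1
  · simp

theorem testFun_column {N : ℕ} (δ : ℝ) {n : Plane} (hn : ‖n‖ = 1) (o : Plane) {h : ℝ} (hh : 0 < h)
    (j₀ : Fin N) (c : Fin N → ℝ) (t s : ℝ) :
    testFun δ n o h (column j₀ c) (frameMap n o (h * t, s))
      = (cutoff δ t * ∑ i, c i * t ^ (i : ℕ))
        * (cutoff δ (h⁻¹ * s) * (h⁻¹ * s) ^ (j₀ : ℕ)) := by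
  rw [testFun_eq, chart_frameMap hn, Fintype.sum_prod_type]
  simp only [column, ite_mul, zero_mul, Finset.sum_ite_eq', Finset.mem_univ, if_true]
  rw [inv_mul_cancel_left₀ hh.ne', Finset.mul_sum, Finset.mul_sum, Finset.sum_mul]
  exact Finset.sum_congr rfl fun i _ => by ring

theorem hasDerivAt_frameMap_normal {w : Plane → ℝ} (hw : ContDiff ℝ ∞ w) (n o : Plane) (t : ℝ) :
    HasDerivAt (fun s => w (frameMap n o (t, s))) (fderiv ℝ w (frameMap n o (t, 0)) n) 0 := by
  have h1 : HasDerivAt (fun s : ℝ => frameMap n o (t, s)) n 0 := by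
    have := ((hasDerivAt_id (0 : ℝ)).smul_const n).const_add (o + t • tangent n)
    simpa [frameMap] using this
  have h2 := (hw.differentiable (by norm_num) (frameMap n o (t, 0))).hasFDerivAt
  exact h2.comp_hasDerivAt (0 : ℝ) h1

theorem fderiv_testFun_column {N : ℕ} (δ : ℝ) {n : Plane} (hn : ‖n‖ = 1) (o : Plane) {h : ℝ}
    (hh : 0 < h) (j₀ : Fin N) (c : Fin N → ℝ) {φ' : ℝ}
    (hφ : HasDerivAt (fun y => cutoff δ y * y ^ (j₀ : ℕ)) φ' 0) (t : ℝ) :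
    fderiv ℝ (testFun δ n o h (column j₀ c)) (frameMap n o (h * t, 0)) n
      = (cutoff δ t * ∑ i, c i * t ^ (i : ℕ)) * (φ' * h⁻¹) := by
  have h1 := hasDerivAt_frameMap_normal (contDiff_testFun δ n o h (column j₀ c)) n o (h * t)
  have h2 : HasDerivAt (fun s : ℝ => cutoff δ (h⁻¹ * s) * (h⁻¹ * s) ^ (j₀ : ℕ)) (φ' * h⁻¹) 0 := by
    have h3 : HasDerivAt (fun s : ℝ => h⁻¹ * s) h⁻¹ 0 := by
      simpa using (hasDerivAt_id (0 : ℝ)).const_mul h⁻¹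
    have h4 : HasDerivAt (fun y => cutoff δ y * y ^ (j₀ : ℕ)) φ' (h⁻¹ * 0) := by rwa [mul_zero]
    exact h4.comp (0 : ℝ) h3
  refine h1.unique ?_
  simp only [testFun_column δ hn o hh]
  exact h2.const_mul _

theorem hasDerivAt_cutoff_zero {δ : ℝ} (hδ : 0 < δ) : HasDerivAt (cutoff δ) 0 0 := by
  have := ((contDiff_cutoff δ).differentiable (by norm_num) 0).hasDerivAt
  rwa [deriv_cutoff_zero hδ] at this

/-! ### Scaling on an edge -/

section EdgeScaling

variable {E : Finset Plane} {n o : Plane} {h : ℝ}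

theorem EdgeFrame.setIntegral_scaled (hE : EdgeFrame E n o h) (F : Plane → ℝ) :
    ∫ x in hull E, F x ∂μH[1]
      = h * ∫ t in Set.Icc (-(1 / 2) : ℝ) (1 / 2), F (frameMap n o (h * t, 0)) := by
  have hh := hE.pos
  rw [hE.setIntegral_eq, integral_Icc_eq_integral_Ioc, integral_Icc_eq_integral_Ioc,
    ← intervalIntegral.integral_of_le (by linarith), ← intervalIntegral.integral_of_le (by norm_num),
    intervalIntegral.mul_integral_comp_mul_left (f := fun t => F (frameMap n o (t, 0)))]
  congr 1 <;> ring

theorem EdgeFrame.edgeNorm_le (hE : EdgeFrame E n o h) {N : ℕ} {J : Plane → ℝ} {c : Fin N → ℝ}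
    (hJ : ∀ t : ℝ, J (frameMap n o (h * t, 0)) = ∑ i, c i * t ^ (i : ℕ)) :
    edgeNorm E J ≤ N * ‖c‖ * √h := by
  have hh := hE.pos
  have hpt : ∀ t ∈ Set.Icc (-(1 / 2) : ℝ) (1 / 2), |∑ i, c i * t ^ (i : ℕ)| ≤ N * ‖c‖ := by
    intro t ht
    refine (Finset.abs_sum_le_sum_abs _ _).trans ?_
    refine (Finset.sum_le_card_nsmul _ _ ‖c‖ fun i _ => ?_).trans (by simp)
    have ht1 : |t| ≤ 1 := (abs_le.2 ht).trans (by norm_num)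
    rw [abs_mul, abs_pow, ← Real.norm_eq_abs (c i)]
    calc ‖c i‖ * |t| ^ (i : ℕ) ≤ ‖c‖ * 1 :=
          mul_le_mul (norm_le_pi_norm c i) (pow_le_one₀ (abs_nonneg t) ht1) (by positivity)
            (norm_nonneg c)
      _ = ‖c‖ := mul_one _
  rw [edgeNorm, hE.setIntegral_scaled]
  simp only [hJ]
  refine Real.sqrt_le_iff.2 ⟨by positivity, ?_⟩
  rw [mul_pow, Real.sq_sqrt hh.le, mul_comm]
  refine mul_le_mul_of_nonneg_right ?_ hh.le
  have h1 : ∫ _ in Set.Icc (-(1 / 2) : ℝ) (1 / 2), (N * ‖c‖) ^ 2 = (N * ‖c‖) ^ 2 := by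
    rw [setIntegral_const, measureReal_def, Real.volume_Icc]
    norm_num
  rw [← h1]
  refine setIntegral_mono_on ?_ ?_ measurableSet_Icc fun t ht => ?_
  · exact (by fun_prop : Continuous fun t : ℝ => (∑ i, c i * t ^ (i : ℕ)) ^ 2).integrableOn_Icc
  · exact continuous_const.integrableOn_Icc
  · exact sq_le_sq' (abs_le.1 (hpt t ht)).1 (abs_le.1 (hpt t ht)).2

/-- A polynomial on an edge is controlled by its integral against its own product with the cut-off
function. -/
theorem exists_edge_bound {δ : ℝ} (hδ : 0 < δ) (hδ1 : δ ≤ 1) (N : ℕ) : ∃ C : ℝ, 0 < C ∧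
    ∀ {E : Finset Plane} {n o : Plane} {h : ℝ}, EdgeFrame E n o h → ∀ {J θ : Plane → ℝ}
      {c : Fin N → ℝ}, (∀ t : ℝ, J (frameMap n o (h * t, 0)) = ∑ i, c i * t ^ (i : ℕ)) →
      (∀ t : ℝ, θ (frameMap n o (h * t, 0)) = cutoff δ t * ∑ i, c i * t ^ (i : ℕ)) →
      ∀ {Y : ℝ}, 0 ≤ Y → |∫ x in hull E, J x * θ x ∂μH[1]| ≤ ‖c‖ * Y → √h * edgeNorm E J ≤ C * Y := by
  obtain ⟨γ, hγ, hlow⟩ := exists_lineCoeff_bound N (ε := δ / 8) (by positivity)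
  refine ⟨(N + 1) / γ, by positivity, fun {E n o h} hE {J θ c} hJ hθ {Y} hY0 hY => ?_⟩
  have hh := hE.pos
  have hcont : Continuous fun t : ℝ => (∑ i, c i * t ^ (i : ℕ)) := by fun_prop
  have hηc : Continuous (cutoff δ) := (contDiff_cutoff δ).continuous
  have h1 : γ * ‖c‖ ^ 2 * h ≤ ∫ x in hull E, J x * θ x ∂μH[1] := by
    rw [hE.setIntegral_scaled, mul_comm]
    refine mul_le_mul_of_nonneg_left ((hlow c).trans ?_) hh.le
    have h2 : ∫ t in Set.Ioo (-(δ / 8)) (δ / 8), (∑ i, c i * t ^ (i : ℕ)) ^ 2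
        = ∫ t in Set.Ioo (-(δ / 8)) (δ / 8),
          J (frameMap n o (h * t, 0)) * θ (frameMap n o (h * t, 0)) := by
      refine setIntegral_congr_fun measurableSet_Ioo fun t ht => ?_
      rw [hJ, hθ, cutoff_eq_one hδ (abs_le.2 ⟨ht.1.le, ht.2.le⟩)]
      ring
    rw [h2]
    refine setIntegral_mono_set ?_ ?_ (LE.le.eventuallyLE fun t ht =>
      ⟨by linarith [ht.1], by linarith [ht.2]⟩)
    · simp only [hJ, hθ]
      exact (hcont.mul (hηc.mul hcont)).integrableOn_Icc
    · refine Eventually.of_forall fun t => ?_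
      simp only [hJ, hθ, Pi.zero_apply]
      have := cutoff_nonneg δ t
      nlinarith [mul_nonneg this (sq_nonneg (∑ i, c i * t ^ (i : ℕ)))]
  have h3 : γ * ‖c‖ ^ 2 * h ≤ ‖c‖ * Y := h1.trans ((le_abs_self _).trans hY)
  have h4 := hE.edgeNorm_le hJ
  have h5 : √h * edgeNorm E J ≤ N * (‖c‖ * h) := by
    calc √h * edgeNorm E J ≤ √h * (N * ‖c‖ * √h) := by gcongr
      _ = N * ‖c‖ * (√h * √h) := by ring
      _ = N * (‖c‖ * h) := by rw [Real.mul_self_sqrt hh.le]; ring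
  have hc0 := norm_nonneg c
  rcases hc0.eq_or_lt with hc | hc
  · rw [← hc, zero_mul, mul_zero] at h5
    exact h5.trans (by positivity)
  · have h6 : γ * (‖c‖ * h) ≤ Y := by
      refine le_of_mul_le_mul_left ?_ hc
      linarith
    have h7 : ‖c‖ * h ≤ Y / γ := by rw [le_div_iff₀ hγ]; linarith
    have h8 : 0 ≤ ‖c‖ * h := by positivity
    calc √h * edgeNorm E J ≤ N * (‖c‖ * h) := h5
      _ ≤ (N + 1) * (‖c‖ * h) := by nlinarith
      _ ≤ (N + 1) * (Y / γ) := by gcongr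
      _ = (N + 1) / γ * Y := by ring

end EdgeScaling

/-! ### Square integrable functions on an edge -/

theorem sqrt_integral_sq_eq {X : Type*} [MeasurableSpace X] {μ : Measure X} {f : X → ℝ}
    (hf : MemLp f 2 μ) : √(∫ x, f x ^ 2 ∂μ) = (eLpNorm f 2 μ).toReal := by
  rw [hf.eLpNorm_eq_integral_rpow_norm (by norm_num) (by norm_num), ENNReal.toReal_ofReal (by positivity),
    Real.sqrt_eq_rpow]
  norm_num

theorem sqrt_integral_add_sq_le {X : Type*} [MeasurableSpace X] {μ : Measure X} {f g : X → ℝ}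
    (hf : MemLp f 2 μ) (hg : MemLp g 2 μ) :
    √(∫ x, (f x + g x) ^ 2 ∂μ) ≤ √(∫ x, f x ^ 2 ∂μ) + √(∫ x, g x ^ 2 ∂μ) := by
  have h1 := sqrt_integral_sq_eq (hf.add hg)
  simp only [Pi.add_apply] at h1
  rw [h1, sqrt_integral_sq_eq hf, sqrt_integral_sq_eq hg,
    ← ENNReal.toReal_add hf.eLpNorm_ne_top hg.eLpNorm_ne_top]
  exact ENNReal.toReal_mono (ENNReal.add_ne_top.2 ⟨hf.eLpNorm_ne_top, hg.eLpNorm_ne_top⟩)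
    (eLpNorm_add_le hf.1 hg.1 (by norm_num))

theorem edgeNorm_nonneg (E : Finset Plane) (w : Plane → ℝ) : 0 ≤ edgeNorm E w := Real.sqrt_nonneg _

theorem memLp_edge {E : Finset Plane} {n o : Plane} {h : ℝ} (hE : EdgeFrame E n o h) {F : Plane → ℝ}
    (hF : Continuous F) : MemLp F 2 (μH[1].restrict (hull E)) := by
  rw [memLp_two_iff_integrable_sq hF.aestronglyMeasurable]
  exact integrableOn_edge hE (hF.pow 2)

theorem memLp_lineLoad {Ω : Set Plane} (T : Mesh Ω) {L : Load} (hL : L.Admissible Ω)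
    (E : Finset Plane) : MemLp (lineLoad T L E) 2 (μH[1].restrict (hull E)) := by
  by_cases hE : E ∈ T.lineEdges L.S
  · have : lineLoad T L E = L.g := by ext x; simp [lineLoad, hE]
    rw [this]
    exact hL.memLp_g.mono_measure (Measure.restrict_mono_set _ hE.2)
  · have : lineLoad T L E = 0 := by ext x; simp [lineLoad, hE]
    rw [this]
    exact MemLp.zero

theorem abs_edgeIntegral_le {E : Finset Plane} {n o : Plane} {h : ℝ} (hE : EdgeFrame E n o h)
    {F w : Plane → ℝ} (hF : MemLp F 2 (μH[1].restrict (hull E))) {b : ℝ} (hb : 0 ≤ b)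
    (hw : ∀ x, |w x| ≤ b) :
    |∫ x in hull E, F x * w x ∂μH[1]| ≤ b * (√h * edgeNorm E F) := by
  refine abs_integral_le_of_support (S := Set.univ) MeasurableSet.univ hb hF
    (Eventually.of_forall fun x => ?_) (fun x hx => absurd (Set.mem_univ x) hx) hE.pos.le ?_
  · rw [abs_mul, mul_comm]
    exact mul_le_mul_of_nonneg_right (hw x) (abs_nonneg _)
  · rw [Measure.restrict_apply_univ, hE.hausdorffMeasure_hull]

/-! ### Estimates on edges -/

/-- Effective shear forces on an edge: they are tested with functions whose normal derivative
vanishes on the edge. The polynomial `G` is an arbitrary approximation of the line load. -/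
theorem exists_shear_bound (m : Material) (κ : ℝ) (k r : ℕ) : ∃ C : ℝ, 0 < C ∧
    ∀ {P : Plate} {L : Load} {u : H2Function P.Ω}, IsWeakSolution m P L u → L.Admissible P.Ω →
    ∀ {T : Mesh P.Ω}, T.Fits L → ∀ {v : H2Function P.Ω} {q : Finset Plane → MvPolynomial (Fin 2) ℝ},
      IsFEFunction P T k v q →
    ∀ {E : Finset Plane} {n o : Plane} {h : ℝ} {𝒦 : Finset (Finset Plane)}
      {ν : Finset Plane → Plane}, EdgePatch T κ E n o h 𝒦 ν →
      (∀ w : Plane → ℝ, ContDiff ℝ ∞ w → tsupport w ⊆ Metric.closedBall o (discRadius κ * h / 2) →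
        HasLocalTest P 𝒦 o (discRadius κ * h / 2) w) →
    ∀ {V M G : Plane → ℝ}, IsEdgeForce m q n 𝒦 ν V M → IsPolyFun k V → IsPolyFun r G →
      h ^ (3 / 2 : ℝ) * edgeNorm E (fun x => V x - G x)
        ≤ C * (h ^ 2 * ∑ K ∈ 𝒦, l2Norm (hull K) (fun x => plateOp m (polyFun (q K)) x - L.f x)
          + ∑ K ∈ 𝒦, h2Dist (hull K) u v
          + h ^ (3 / 2 : ℝ) * edgeNorm E (fun x => lineLoad T L E x - G x)) := by
  have hδ := discRadius_pos κ
  obtain ⟨B, hB, hbd⟩ := exists_testFun_bound hδ (max k r + 1)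
  obtain ⟨A, hA, hscale⟩ := exists_edge_bound hδ ((discRadius_le κ).trans (by norm_num))
    (max k r + 1)
  obtain ⟨e, he⟩ : ∃ e, e = energyConst m := ⟨_, rfl⟩
  have he0 : 0 ≤ e := he ▸ energyConst_nonneg m
  refine ⟨A * (B * (√discArea * (1 + e) + 1)), by positivity, ?_⟩
  intro P L u hu hL T hfit v q hv E n o h 𝒦 ν hp hloc V M G hVM hV hG
  have hE := hp.frame
  have hh := hE.pos
  have hn := hE.norm
  obtain ⟨c, hc⟩ := ((hV.mono (le_max_left k r)).sub (hG.mono (le_max_right k r))).exists_lineCoeff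
    (Nat.lt_succ_self _) n o h
  -- monomials that do not depend on the normal coordinate
  set j₀ : Fin (max k r + 1) := 0
  set w := testFun (discRadius κ) n o h (column j₀ c) with hw
  have hws := contDiff_testFun (discRadius κ) n o h (column j₀ c)
  obtain ⟨hw₀, hw₂⟩ := hbd n o h (column j₀ c) hn hh
  have hcol := norm_column_le j₀ c
  have hw₀' : ∀ x, |w x| ≤ B * ‖c‖ := fun x => (hw₀ x).trans (by gcongr)
  have hres := hp.abs_residual_le hu hL hfit hv
    (hloc w hws (tsupport_testFun hδ hn hh _)) hVM hw₀'
    (b₂ := B * ‖c‖ * (h⁻¹ * h⁻¹))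
    (fun x i j => (hw₂ i j x).trans (by gcongr))
  have hval : ∀ t : ℝ, w (frameMap n o (h * t, 0)) = cutoff (discRadius κ) t * ∑ i, c i * t ^ (i : ℕ) := by
    intro t
    rw [hw, testFun_column _ hn o hh]
    simp [j₀, cutoff_zero hδ]
  have hder : ∀ x ∈ hull E, fderiv ℝ w x n = 0 := by
    intro x hx
    obtain ⟨t, -, rfl⟩ := (hE.mem_hull_iff x).1 hx
    have h0 : HasDerivAt (fun y => cutoff (discRadius κ) y * y ^ (j₀ : ℕ)) 0 0 := by
      simpa [j₀] using hasDerivAt_cutoff_zero hδ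
    have := fderiv_testFun_column (discRadius κ) hn o hh j₀ c h0 (h⁻¹ * t)
    rw [mul_inv_cancel_left₀ hh.ne'] at this
    rw [hw, this]; ring
  set R := ∑ K ∈ 𝒦, l2Norm (hull K) (fun x => plateOp m (polyFun (q K)) x - L.f x)
  set D := ∑ K ∈ 𝒦, h2Dist (hull K) u v
  set gn := edgeNorm E (fun x => lineLoad T L E x - G x) with hgn_def
  have hR : 0 ≤ R := Finset.sum_nonneg fun K _ => l2Norm_nonneg _ _
  have hD : 0 ≤ D := Finset.sum_nonneg fun K _ => by rw [h2Dist_eq]; exact l2Norm_nonneg _ _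
  have hgn : 0 ≤ gn := edgeNorm_nonneg _ _
  have hmem : MemLp (fun x => lineLoad T L E x - G x) 2 (μH[1].restrict (hull E)) :=
    (memLp_lineLoad T hL E).sub (memLp_edge hE hG.smooth.continuous)
  have hg := abs_edgeIntegral_le hE hmem (by positivity : 0 ≤ B * ‖c‖) hw₀'
  have hwm : MemLp w 2 (μH[1].restrict (hull E)) := memLp_edge hE hws.continuous
  have hsplit : ∫ x in hull E, (V x - G x) * w x ∂μH[1]
      = (∫ x in hull E, (V x * w x - M x * fderiv ℝ w x n) ∂μH[1]
          - ∫ x in hull E, lineLoad T L E x * w x ∂μH[1])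
        + ∫ x in hull E, (lineLoad T L E x - G x) * w x ∂μH[1] := by
    have e1 : ∫ x in hull E, (V x * w x - M x * fderiv ℝ w x n) ∂μH[1]
        = ∫ x in hull E, V x * w x ∂μH[1] :=
      setIntegral_congr_fun (measurableSet_hull E) fun x hx => by
        rw [hder x hx]; ring
    have i1 : Integrable (fun x => V x * w x) (μH[1].restrict (hull E)) :=
      (memLp_edge hE hV.smooth.continuous).integrable_mul hwm
    have i2 : Integrable (fun x => lineLoad T L E x * w x) (μH[1].restrict (hull E)) :=
      (memLp_lineLoad T hL E).integrable_mul hwm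
    have i3 : Integrable (fun x => (lineLoad T L E x - G x) * w x) (μH[1].restrict (hull E)) :=
      hmem.integrable_mul hwm
    have i4 : Integrable (fun x => V x * w x - lineLoad T L E x * w x) (μH[1].restrict (hull E)) :=
      i1.sub i2
    rw [e1, ← integral_sub i1 i2, ← integral_add i4 i3]
    exact integral_congr_ae (Eventually.of_forall fun x => by ring)
  have hY : |∫ x in hull E, (V x - G x) * w x ∂μH[1]|
      ≤ ‖c‖ * (B * (√discArea * (h * R + e * (h⁻¹ * D)) + √h * gn)) := by
    rw [hsplit]
    refine (abs_add_le _ _).trans ((add_le_add hres hg).trans (le_of_eq ?_))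
    rw [← he, ← hgn_def]
    field_simp
  have hfin := hscale hE hc hval (by positivity) hY
  have h32 : h ^ (3 / 2 : ℝ) = h * √h := by
    rw [show (3 / 2 : ℝ) = 1 + 1 / 2 by norm_num, Real.rpow_add hh, Real.rpow_one, Real.sqrt_eq_rpow]
  have hs : 0 ≤ √discArea := Real.sqrt_nonneg _
  have hgoal : √discArea * (h ^ 2 * R + e * D) + h * √h * gn
      ≤ (√discArea * (1 + e) + 1) * (h ^ 2 * R + D + h * √h * gn) := by
    have x1 : 0 ≤ h ^ 2 * R := by positivity
    have x2 : 0 ≤ h * √h * gn := by positivity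
    have x3 : 0 ≤ √discArea * (1 + e) := by positivity
    have x4 : √discArea * (h ^ 2 * R + e * D) ≤ √discArea * (1 + e) * (h ^ 2 * R + D) := by
      rw [mul_assoc]
      refine mul_le_mul_of_nonneg_left ?_ hs
      nlinarith [mul_nonneg he0 x1]
    nlinarith [mul_nonneg x3 x2]
  calc h ^ (3 / 2 : ℝ) * edgeNorm E (fun x => V x - G x)
      = h * (√h * edgeNorm E (fun x => V x - G x)) := by rw [h32]; ring
    _ ≤ h * (A * (B * (√discArea * (h * R + e * (h⁻¹ * D)) + √h * gn))) := by gcongr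
    _ = A * (B * (√discArea * (h ^ 2 * R + e * D) + h * √h * gn)) := by field_simp
    _ ≤ A * (B * ((√discArea * (1 + e) + 1) * (h ^ 2 * R + D + h * √h * gn))) := by gcongr
    _ = A * (B * (√discArea * (1 + e) + 1)) * (h ^ 2 * R + D + h ^ (3 / 2 : ℝ) * gn) := by
      rw [h32]; ring

/-- Normal moments on an edge: they are tested with functions that vanish on the edge. No other test
functions are admissible on a simply supported edge. -/
theorem exists_moment_bound (m : Material) (κ : ℝ) (k : ℕ) : ∃ C : ℝ, 0 < C ∧
    ∀ {P : Plate} {L : Load} {u : H2Function P.Ω}, IsWeakSolution m P L u → L.Admissible P.Ω →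
    ∀ {T : Mesh P.Ω}, T.Fits L → ∀ {v : H2Function P.Ω} {q : Finset Plane → MvPolynomial (Fin 2) ℝ},
      IsFEFunction P T k v q →
    ∀ {E : Finset Plane} {n o : Plane} {h : ℝ} {𝒦 : Finset (Finset Plane)}
      {ν : Finset Plane → Plane}, EdgePatch T κ E n o h 𝒦 ν →
      (∀ w : Plane → ℝ, ContDiff ℝ ∞ w → tsupport w ⊆ Metric.closedBall o (discRadius κ * h / 2) →
        (∀ x ∈ hull E, w x = 0) → HasLocalTest P 𝒦 o (discRadius κ * h / 2) w) →
    ∀ {V M : Plane → ℝ}, IsEdgeForce m q n 𝒦 ν V M → IsPolyFun k M →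
      h ^ (1 / 2 : ℝ) * edgeNorm E M
        ≤ C * (h ^ 2 * ∑ K ∈ 𝒦, l2Norm (hull K) (fun x => plateOp m (polyFun (q K)) x - L.f x)
          + ∑ K ∈ 𝒦, h2Dist (hull K) u v) := by
  have hδ := discRadius_pos κ
  obtain ⟨B, hB, hbd⟩ := exists_testFun_bound hδ (k + 2)
  obtain ⟨A, hA, hscale⟩ := exists_edge_bound hδ ((discRadius_le κ).trans (by norm_num)) (k + 2)
  obtain ⟨e, he⟩ : ∃ e, e = energyConst m := ⟨_, rfl⟩
  have he0 : 0 ≤ e := he ▸ energyConst_nonneg m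
  refine ⟨A * (B * (√discArea * (1 + e) + 1)), by positivity, ?_⟩
  intro P L u hu hL T hfit v q hv E n o h 𝒦 ν hp hloc V M hVM hM
  have hE := hp.frame
  have hh := hE.pos
  have hn := hE.norm
  obtain ⟨c, hc⟩ := hM.exists_lineCoeff (by omega : k < k + 2) n o h
  -- monomials linear in the normal coordinate; they exist because `k + 2 ≥ 2`
  set j₀ : Fin (k + 2) := 1
  set w := testFun (discRadius κ) n o h (column j₀ c) with hw
  have hws := contDiff_testFun (discRadius κ) n o h (column j₀ c)
  obtain ⟨hw₀, hw₂⟩ := hbd n o h (column j₀ c) hn hh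
  have hcol := norm_column_le j₀ c
  have hzero : ∀ x ∈ hull E, w x = 0 := by
    intro x hx
    obtain ⟨t, -, rfl⟩ := (hE.mem_hull_iff x).1 hx
    have := testFun_column (discRadius κ) hn o hh j₀ c (h⁻¹ * t) 0
    rw [mul_inv_cancel_left₀ hh.ne'] at this
    rw [hw, this]
    simp [j₀]
  have hres := hp.abs_residual_le hu hL hfit hv
    (hloc w hws (tsupport_testFun hδ hn hh _) hzero) hVM (b₀ := B * ‖c‖)
    (b₂ := B * ‖c‖ * (h⁻¹ * h⁻¹)) (fun x => (hw₀ x).trans (by gcongr))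
    (fun x i j => (hw₂ i j x).trans (by gcongr))
  have hder : ∀ t : ℝ, h * fderiv ℝ w (frameMap n o (h * t, 0)) n
      = cutoff (discRadius κ) t * ∑ i, c i * t ^ (i : ℕ) := by
    intro t
    have h0 : HasDerivAt (fun y => cutoff (discRadius κ) y * y ^ (j₀ : ℕ)) 1 0 := by
      have := (hasDerivAt_cutoff_zero hδ).mul (hasDerivAt_id (0 : ℝ))
      simpa [j₀, cutoff_zero hδ, Pi.mul_def] using this
    rw [hw, fderiv_testFun_column (discRadius κ) hn o hh j₀ c h0 t]
    field_simp
  set R := ∑ K ∈ 𝒦, l2Norm (hull K) (fun x => plateOp m (polyFun (q K)) x - L.f x)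
  set D := ∑ K ∈ 𝒦, h2Dist (hull K) u v
  have hR : 0 ≤ R := Finset.sum_nonneg fun K _ => l2Norm_nonneg _ _
  have hD : 0 ≤ D := Finset.sum_nonneg fun K _ => by rw [h2Dist_eq]; exact l2Norm_nonneg _ _
  have e1 : ∫ x in hull E, lineLoad T L E x * w x ∂μH[1] = 0 :=
    setIntegral_eq_zero_of_forall_eq_zero fun x hx => by rw [hzero x hx, mul_zero]
  have e2 : ∫ x in hull E, M x * (h * fderiv ℝ w x n) ∂μH[1]
      = -(h * ∫ x in hull E, (V x * w x - M x * fderiv ℝ w x n) ∂μH[1]) := by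
    rw [← integral_const_mul, ← integral_neg]
    refine setIntegral_congr_fun (measurableSet_hull E) fun x hx => ?_
    change M x * (h * fderiv ℝ w x n) = -(h * (V x * w x - M x * fderiv ℝ w x n))
    rw [hzero x hx]; ring
  rw [e1, sub_zero] at hres
  have hY : |∫ x in hull E, M x * (h * fderiv ℝ w x n) ∂μH[1]|
      ≤ ‖c‖ * (B * (√discArea * (h ^ 2 * R + e * D))) := by
    rw [e2, abs_neg, abs_mul, abs_of_pos hh]
    refine (mul_le_mul_of_nonneg_left hres hh.le).trans (le_of_eq ?_)
    rw [← he]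
    field_simp
  have hfin := hscale hE hc (θ := fun x => h * fderiv ℝ w x n) hder (by positivity) hY
  rw [← Real.sqrt_eq_rpow]
  refine hfin.trans ?_
  have hs : 0 ≤ √discArea := Real.sqrt_nonneg _
  have x1 : 0 ≤ h ^ 2 * R := by positivity
  have x4 : √discArea * (h ^ 2 * R + e * D) ≤ √discArea * (1 + e) * (h ^ 2 * R + D) := by
    rw [mul_assoc]
    refine mul_le_mul_of_nonneg_left ?_ hs
    nlinarith [mul_nonneg he0 x1]
  have x5 : √discArea * (h ^ 2 * R + e * D) ≤ (√discArea * (1 + e) + 1) * (h ^ 2 * R + D) := by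
    nlinarith
  calc A * (B * (√discArea * (h ^ 2 * R + e * D)))
      ≤ A * (B * ((√discArea * (1 + e) + 1) * (h ^ 2 * R + D))) := by gcongr
    _ = A * (B * (√discArea * (1 + e) + 1)) * (h ^ 2 * R + D) := by ring

/-! ### Estimates on triangles -/

theorem integral_scaled (m : Plane) {R : ℝ} (hR : 0 < R) (F : Plane → ℝ) :
    ∫ x, F x = R ^ 2 * ∫ z : ℝ × ℝ, F (frameMap axisNormal m (R * z.1, R * z.2)) := by
  have h := Measure.integral_comp_smul_of_nonneg (volume : Measure (ℝ × ℝ))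
    (fun z => F (frameMap axisNormal m z)) R (hR := hR.le)
  have h1 : ∀ z : ℝ × ℝ, R • z = (R * z.1, R * z.2) := fun z => rfl
  simp only [h1, Module.finrank_prod, Module.finrank_self, smul_eq_mul, one_add_one_eq_two] at h
  rw [h, mul_inv_cancel_left₀ (by positivity), integral_frameMap norm_axisNormal]

/-- The coefficients of a polynomial are controlled by its integral against its own product with
the cut-off function. -/
theorem exists_plane_bound (N : ℕ) : ∃ γ : ℝ, 0 < γ ∧ ∀ (o : Plane) {R : ℝ}, 0 < R →
    ∀ {p : Plane → ℝ} {c : Fin N × Fin N → ℝ},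
      (∀ z : ℝ × ℝ, p (frameMap axisNormal o (R * z.1, R * z.2))
        = ∑ i, c i * (z.1 ^ (i.1 : ℕ) * z.2 ^ (i.2 : ℕ))) →
      γ * ‖c‖ ^ 2 * R ^ 2 ≤ ∫ x, p x * testFun 1 axisNormal o R c x := by
  obtain ⟨γ, hγ, hlow⟩ := exists_planeCoeff_bound N (ε := 1 / 8) (by norm_num)
  refine ⟨γ, hγ, fun o R hR p c hp => ?_⟩
  have hval : ∀ z : ℝ × ℝ, p (frameMap axisNormal o (R * z.1, R * z.2))
      * testFun 1 axisNormal o R c (frameMap axisNormal o (R * z.1, R * z.2))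
      = cutoff 1 z.1 * cutoff 1 z.2 * (∑ i, c i * (z.1 ^ (i.1 : ℕ) * z.2 ^ (i.2 : ℕ))) ^ 2 := by
    intro z
    rw [testFun_eq, chart_frameMap norm_axisNormal, hp]
    simp only [inv_mul_cancel_left₀ hR.ne']
    ring
  have hc1 : Continuous fun z : ℝ × ℝ => cutoff 1 z.1 * cutoff 1 z.2 :=
    ((contDiff_cutoff 1).continuous.comp continuous_fst).mul
      ((contDiff_cutoff 1).continuous.comp continuous_snd)
  have hc2 : Continuous fun z : ℝ × ℝ => cutoff 1 z.1 * cutoff 1 z.2 *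
      (∑ i, c i * (z.1 ^ (i.1 : ℕ) * z.2 ^ (i.2 : ℕ))) ^ 2 := hc1.mul (by fun_prop)
  have hsupp : HasCompactSupport fun z : ℝ × ℝ => cutoff 1 z.1 * cutoff 1 z.2 *
      (∑ i, c i * (z.1 ^ (i.1 : ℕ) * z.2 ^ (i.2 : ℕ))) ^ 2 := by
    refine HasCompactSupport.intro (isCompact_Icc.prod isCompact_Icc)
      (K := Set.Icc (-(1 / 4) : ℝ) (1 / 4) ×ˢ Set.Icc (-(1 / 4) : ℝ) (1 / 4)) fun z hz => ?_
    by_contra hne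
    have h1 := left_ne_zero_of_mul hne
    exact hz ⟨abs_le.1 (abs_le_of_cutoff_ne_zero one_pos (left_ne_zero_of_mul h1)),
      abs_le.1 (abs_le_of_cutoff_ne_zero one_pos (right_ne_zero_of_mul h1))⟩
  rw [integral_scaled o hR, mul_comm]
  refine mul_le_mul_of_nonneg_left ((hlow c).trans ?_) (by positivity)
  simp only [hval]
  have hms : MeasurableSet (Set.Ioo (-(1 / 8) : ℝ) (1 / 8) ×ˢ Set.Ioo (-(1 / 8) : ℝ) (1 / 8)) :=
    measurableSet_Ioo.prod measurableSet_Ioo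
  have h2 : ∫ z in Set.Ioo (-(1 / 8) : ℝ) (1 / 8) ×ˢ Set.Ioo (-(1 / 8) : ℝ) (1 / 8),
        (∑ i, c i * (z.1 ^ (i.1 : ℕ) * z.2 ^ (i.2 : ℕ))) ^ 2
      = ∫ z in Set.Ioo (-(1 / 8) : ℝ) (1 / 8) ×ˢ Set.Ioo (-(1 / 8) : ℝ) (1 / 8),
        cutoff 1 z.1 * cutoff 1 z.2 * (∑ i, c i * (z.1 ^ (i.1 : ℕ) * z.2 ^ (i.2 : ℕ))) ^ 2 := by
    refine setIntegral_congr_fun hms fun z hz => ?_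
    rw [cutoff_eq_one one_pos (abs_le.2 ⟨hz.1.1.le, hz.1.2.le⟩),
      cutoff_eq_one one_pos (abs_le.2 ⟨hz.2.1.le, hz.2.2.le⟩)]
    ring
  rw [h2]
  exact setIntegral_le_integral (hc2.integrable_of_hasCompactSupport hsupp)
    (Eventually.of_forall fun z => mul_nonneg
      (mul_nonneg (cutoff_nonneg _ _) (cutoff_nonneg _ _)) (sq_nonneg _))

theorem l2Norm_le_of_abs_le {D : Set Plane} {p : Plane → ℝ} {B s : ℝ}
    {o : Plane} (hB : 0 ≤ B) (hs : 0 ≤ s) (hDs : D ⊆ Metric.closedBall o s)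
    (hp : ∀ x ∈ D, |p x| ≤ B) : l2Norm D p ≤ B * (√discArea * s) := by
  refine Real.sqrt_le_iff.2 ⟨by positivity, ?_⟩
  have hv : (volume : Measure Plane) D ≤ ENNReal.ofReal (s ^ 2 * discArea) :=
    (measure_mono hDs).trans (volume_closedBall_eq o hs).le
  have h1 := norm_setIntegral_le_of_norm_le_const (f := fun x => p x ^ 2) (C := B ^ 2)
    (hv.trans_lt ENNReal.ofReal_lt_top) fun x hx => by
      rw [Real.norm_eq_abs, abs_pow]
      exact pow_le_pow_left₀ (abs_nonneg _) (hp x hx) 2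
  have h2 : (volume : Measure Plane).real D ≤ s ^ 2 * discArea :=
    ENNReal.toReal_le_of_le_ofReal (mul_nonneg (sq_nonneg s) discArea_nonneg) hv
  rw [mul_pow, mul_pow, Real.sq_sqrt discArea_nonneg]
  calc _ ≤ _ := (le_abs_self _).trans h1
    _ ≤ B ^ 2 * (s ^ 2 * discArea) := by gcongr
    _ = _ := by ring

theorem abs_planePoly_le {N : ℕ} (c : Fin N × Fin N → ℝ) {a : ℝ} (ha : 1 ≤ a) {z : ℝ × ℝ}
    (h1 : |z.1| ≤ a) (h2 : |z.2| ≤ a) :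
    |∑ i, c i * (z.1 ^ (i.1 : ℕ) * z.2 ^ (i.2 : ℕ))| ≤ N * N * (a ^ N * a ^ N) * ‖c‖ := by
  refine (Finset.abs_sum_le_sum_abs _ _).trans ?_
  refine (Finset.sum_le_card_nsmul _ _ (a ^ N * a ^ N * ‖c‖) fun i _ => ?_).trans ?_
  · have hpow : ∀ {t : ℝ}, |t| ≤ a → ∀ j : Fin N, |t ^ (j : ℕ)| ≤ a ^ N := fun ht j => by
      rw [abs_pow]
      exact (pow_le_pow_left₀ (abs_nonneg _) ht _).trans (pow_le_pow_right₀ ha j.2.le)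
    rw [abs_mul, abs_mul, mul_comm, ← Real.norm_eq_abs (c i)]
    exact mul_le_mul (mul_le_mul (hpow h1 _) (hpow h2 _) (abs_nonneg _) (by positivity))
      (norm_le_pi_norm c i) (norm_nonneg _) (by positivity)
  · simp only [Finset.card_univ, Fintype.card_prod, Fintype.card_fin, nsmul_eq_mul]
    push_cast
    exact le_of_eq (by ring)

/-- The element residual, tested with a function supported in the interior of the triangle. -/
theorem IsWeakSolution.element_eq {m : Material} {P : Plate} {L : Load} {u : H2Function P.Ω}
    (hu : IsWeakSolution m P L u) (hL : L.Admissible P.Ω) {T : Mesh P.Ω} (hfit : T.Fits L) {k : ℕ}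
    {v : H2Function P.Ω} {q : Finset Plane → MvPolynomial (Fin 2) ℝ} (hv : IsFEFunction P T k v q)
    {K : Finset Plane} (hK : K ∈ T.elements) {w : Plane → ℝ} (hw : ContDiff ℝ ∞ w)
    (hc : HasCompactSupport w) (hsupp : tsupport w ⊆ interior (hull K)) :
    ∫ x in hull K, (L.f x - plateOp m (polyFun (q K)) x) * w x
      = ∫ x in hull K, contraction m (u.hessian x - v.hessian x) (hessianAt w x) := by
  have hmem : ∀ K' ∈ ({K} : Finset (Finset Plane)), K' ∈ T.elements := by simpa using hK
  have hface : ∀ K' ∈ ({K} : Finset (Finset Plane)), ∀ x ∈ tsupport w, ∀ F ⊆ K', x ∈ hull F →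
      K ⊆ F := by
    intro K' hK' x hx F hF hxF
    rw [Finset.mem_singleton] at hK'
    subst hK'
    exact face_eq_of_mem_interior hK.2 hF (hsupp hx) hxF
  have hin : ∀ x ∈ closure P.Ω, x ∈ tsupport w → ∃ K' ∈ ({K} : Finset (Finset Plane)), x ∈ hull K' :=
    fun x _ hx => ⟨K, by simp, interior_subset (hsupp hx)⟩
  have hcard : 2 ≤ K.card := by rw [hK.2]; norm_num
  have h1 := hu.residual_eq hL hv hmem hw hc
    (memV_smoothH2_of_subset P hw hc (hsupp.trans (T.interior_hull_subset hK.1)))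
    (fun x hx => hin x (subset_closure hx)) (hfit.point_eq_zero hL hcard hmem hin hface)
  have hline : K ∉ T.lineEdges L.S := fun h => by
    have := h.1.1.2
    rw [hK.2] at this
    norm_num at this
  rw [hfit.setIntegral_line_eq_zero hL hcard hmem hin hface hline, Finset.sum_singleton,
    Finset.sum_singleton, green_compactSupport m (contDiff_polyFun _) hw hc
    (hsupp.trans interior_subset)] at h1
  linarith

theorem exists_scaled_coords {o x : Plane} {R s : ℝ} (hR : 0 < R) (hx : ‖x - o‖ ≤ s) :
    ∃ z : ℝ × ℝ, x = frameMap axisNormal o (R * z.1, R * z.2) ∧ |z.1| ≤ s / R ∧ |z.2| ≤ s / R := by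
  obtain ⟨h1, h2⟩ := RegularAt.abs_coords_le norm_axisNormal hx
  refine ⟨(R⁻¹ * inner ℝ (tangent axisNormal) (x - o), R⁻¹ * inner ℝ axisNormal (x - o)), ?_, ?_, ?_⟩
  · rw [mul_inv_cancel_left₀ hR.ne', mul_inv_cancel_left₀ hR.ne', frameMap_inner norm_axisNormal]
  · rw [abs_mul, abs_of_pos (inv_pos.2 hR), div_eq_inv_mul]
    exact mul_le_mul_of_nonneg_left h1 (inv_pos.2 hR).le
  · rw [abs_mul, abs_of_pos (inv_pos.2 hR), div_eq_inv_mul]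
    exact mul_le_mul_of_nonneg_left h2 (inv_pos.2 hR).le

theorem l2Norm_add_le {D : Set Plane} {f g : Plane → ℝ} (hf : MemLp f 2 (volume.restrict D))
    (hg : MemLp g 2 (volume.restrict D)) :
    l2Norm D (fun x => f x + g x) ≤ l2Norm D f + l2Norm D g := sqrt_integral_add_sq_le hf hg

set_option maxHeartbeats 800000 in
/-- Element residuals are controlled by the error and the oscillation of the load. -/
theorem exists_element_bound (m : Material) (κ : ℝ) (k : ℕ) : ∃ C : ℝ, 0 < C ∧
    ∀ {P : Plate} {L : Load} {u : H2Function P.Ω}, IsWeakSolution m P L u → L.Admissible P.Ω →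
    ∀ {T : Mesh P.Ω}, T.ShapeRegular κ → T.Fits L →
    ∀ {v : H2Function P.Ω} {q : Finset Plane → MvPolynomial (Fin 2) ℝ}, IsFEFunction P T k v q →
    ∀ {fh : Finset Plane → MvPolynomial (Fin 2) ℝ}, (∀ K ∈ T.elements, (fh K).totalDegree ≤ k) →
    ∀ K ∈ T.elements,
      size K ^ 2 * l2Norm (hull K) (fun x => plateOp m (polyFun (q K)) x - L.f x)
        ≤ C * (h2Dist (hull K) u v + oscElem L.f fh K) := by
  obtain ⟨B, hB, hbd⟩ := exists_testFun_bound one_pos (k + 1)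
  obtain ⟨γ, hγ, hlow⟩ := exists_plane_bound (k + 1)
  obtain ⟨e, he⟩ : ∃ e, e = energyConst m := ⟨_, rfl⟩
  have he0 : 0 ≤ e := he ▸ energyConst_nonneg m
  set a : ℝ := max 1 (2 * κ) with ha_def
  have ha1 : 1 ≤ a := le_max_left _ _
  have ha0 : 0 < a := by linarith
  obtain ⟨A, hA⟩ : ∃ A, A = √discArea := ⟨_, rfl⟩
  have hA0 : 0 ≤ A := hA ▸ Real.sqrt_nonneg _
  set Q : ℝ := ((k + 1 : ℕ) : ℝ) * (k + 1 : ℕ) * (a ^ (k + 1) * a ^ (k + 1)) with hQ_def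
  have hQ0 : 0 ≤ Q := by positivity
  set G : ℝ := Q * A * a * (B * A / γ) with hG_def
  have hG0 : 0 ≤ G := by positivity
  refine ⟨G * (1 + e * a ^ 2) + 1, by positivity, ?_⟩
  intro P L u hu hL T hreg hfit v q hv fh hfh K hK
  obtain ⟨o, R, hR, hball, hdiam⟩ := hreg K hK
  have hsize : size K ≤ a * R := by
    calc size K ≤ κ * (2 * R) := hdiam
      _ = 2 * κ * R := by ring
      _ ≤ a * R := by gcongr; exact le_max_right _ _
  have hs0 := size_nonneg K
  set p : Plane → ℝ := fun x => plateOp m (polyFun (q K)) x - polyFun (fh K) x with hp_def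
  have hqK : IsPolyFun k (polyFun (q K)) := ⟨q K, hv.degree K hK, rfl⟩
  have hfK : IsPolyFun k (polyFun (fh K)) := ⟨fh K, hfh K hK, rfl⟩
  have hpK : IsPolyFun k p := (hqK.plateOp m).sub hfK
  obtain ⟨c, hc⟩ := hpK.exists_planeCoeff (Nat.lt_succ_self k) o R
  set w := testFun 1 axisNormal o R c with hw_def
  have hws : ContDiff ℝ ∞ w := contDiff_testFun 1 axisNormal o R c
  have hwc : HasCompactSupport w := hasCompactSupport_testFun one_pos norm_axisNormal hR c
  have hwb : tsupport w ⊆ Metric.closedBall o (1 * R / 2) :=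
    tsupport_testFun one_pos norm_axisNormal hR c
  have hwR : tsupport w ⊆ Metric.closedBall o R :=
    hwb.trans (Metric.closedBall_subset_closedBall (by linarith))
  have hwi : tsupport w ⊆ interior (hull K) := by
    refine hwb.trans ((Metric.closedBall_subset_ball
      (by linarith : 1 * R / 2 < R)).trans ?_)
    exact interior_maximal (Metric.ball_subset_closedBall.trans hball) Metric.isOpen_ball
  obtain ⟨hw₀, hw₂⟩ := hbd axisNormal o R c norm_axisNormal hR
  have hle := T.restrict_hull_le hK
  have ho : o ∈ hull K := hball (Metric.mem_closedBall_self hR.le)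
  have hf : MemLp L.f 2 (volume.restrict (hull K)) := hL.memLp_f.mono_measure hle
  have hAq : MemLp (fun x => plateOp m (polyFun (q K)) x - L.f x) 2 (volume.restrict (hull K)) :=
    memLp_sub_load hL hK (contDiff_plateOp m (contDiff_polyFun _)).continuous
  have hfd : MemLp (fun x => L.f x - polyFun (fh K) x) 2 (volume.restrict (hull K)) := by
    have := (memLp_sub_load hL hK (contDiff_polyFun (fh K)).continuous).neg
    refine (congrArg (fun f => MemLp f 2 (volume.restrict (hull K))) ?_).mp this
    funext x; simp
  obtain ⟨D, hD_def⟩ : ∃ D, D = h2Dist (hull K) u v := ⟨_, rfl⟩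
  have hD : 0 ≤ D := by rw [hD_def, h2Dist_eq]; exact l2Norm_nonneg _ _
  set F := l2Norm (hull K) (fun x => L.f x - polyFun (fh K) x) with hF_def
  have hF : 0 ≤ F := l2Norm_nonneg _ _
  have hB0 : 0 ≤ B * ‖c‖ := by positivity
  -- the upper bound for the tested residual
  have e1 := hu.element_eq hL hfit hv hK hws hwc hwi
  have b1 := abs_setIntegral_contraction_le m u v (measurableSet_hull K) hle hR.le
    (by positivity : 0 ≤ B * ‖c‖ * (R⁻¹ * R⁻¹)) hwR (fun x _ i j => hw₂ i j x)
  have b2 : |∫ x in hull K, (L.f x - polyFun (fh K) x) * w x| ≤ B * ‖c‖ * (A * R * F) := by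
    rw [hA]
    refine abs_setIntegral_le hB0 hR.le hfd (Eventually.of_forall fun x => ?_) (x₀ := o)
      fun x hx => ?_
    · rw [abs_mul, mul_comm]
      exact mul_le_mul_of_nonneg_right (hw₀ x) (abs_nonneg _)
    · rw [image_eq_zero_of_notMem_tsupport fun h => hx (hwR h), mul_zero]
  rw [← he, ← e1, ← hA, ← hD_def] at b1
  have hwm : MemLp w 2 (volume.restrict (hull K)) :=
    ((hws.continuous.memLp_of_hasCompactSupport hwc) : MemLp w 2 volume).mono_measure
      Measure.restrict_le_self
  have i1 : Integrable (fun x => (L.f x - polyFun (fh K) x) * w x) (volume.restrict (hull K)) :=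
    hfd.integrable_mul hwm
  have i2 : Integrable (fun x => (L.f x - plateOp m (polyFun (q K)) x) * w x)
      (volume.restrict (hull K)) := by
    have := (hAq.integrable_mul hwm).neg
    refine (congrArg (fun f => Integrable f (volume.restrict (hull K))) ?_).mp this
    funext x; simp only [Pi.neg_apply, Pi.mul_apply]; ring
  have e2 : ∫ x, p x * w x = (∫ x in hull K, (L.f x - polyFun (fh K) x) * w x)
      - ∫ x in hull K, (L.f x - plateOp m (polyFun (q K)) x) * w x := by
    rw [← integral_sub i1 i2, ← setIntegral_eq_integral_of_forall_compl_eq_zero (s := hull K)]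
    · refine integral_congr_ae (Eventually.of_forall fun x => ?_)
      simp only [hp_def]; ring
    · intro x hx
      rw [image_eq_zero_of_notMem_tsupport fun h => hx (interior_subset (hwi h)), mul_zero]
  have h1 := hlow o hR hc
  have h2 : γ * ‖c‖ ^ 2 * R ^ 2 ≤ ‖c‖ * (B * A * (R * F + e * (R⁻¹ * D))) := by
    refine h1.trans ?_
    rw [e2]
    refine (le_abs_self _).trans ((abs_sub _ _).trans ((add_le_add b2 b1).trans (le_of_eq ?_)))
    field_simp
  -- hence the coefficients are bounded
  have h3 : ‖c‖ * R ≤ B * A / γ * (F + e * (R⁻¹ * (R⁻¹ * D))) := by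
    rcases (norm_nonneg c).eq_or_lt with h0 | h0
    · rw [← h0, zero_mul]; positivity
    · have h4 : γ * (‖c‖ * R) ≤ B * A * (F + e * (R⁻¹ * (R⁻¹ * D))) := by
        refine le_of_mul_le_mul_left ?_ (mul_pos h0 hR)
        calc ‖c‖ * R * (γ * (‖c‖ * R)) = γ * ‖c‖ ^ 2 * R ^ 2 := by ring
          _ ≤ _ := h2
          _ = _ := by field_simp
      rw [div_mul_eq_mul_div, le_div_iff₀ hγ]
      linarith
  have h5 : l2Norm (hull K) p ≤ Q * ‖c‖ * (A * size K) := by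
    rw [hA]
    refine l2Norm_le_of_abs_le (o := o) (by positivity) hs0 (fun x hx => ?_) fun x hx => ?_
    · rw [Metric.mem_closedBall, dist_eq_norm]
      exact dist_le_size hx ho
    · obtain ⟨z, hz, hz1, hz2⟩ := exists_scaled_coords hR (dist_le_size hx ho)
      have hsR : size K / R ≤ a := (div_le_iff₀ hR).2 hsize
      rw [hz, hc]
      exact abs_planePoly_le c ha1 (hz1.trans hsR) (hz2.trans hsR)
  have h6 : l2Norm (hull K) p ≤ G * (F + e * (R⁻¹ * (R⁻¹ * D))) := by
    calc l2Norm (hull K) p ≤ Q * ‖c‖ * (A * size K) := h5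
      _ ≤ Q * ‖c‖ * (A * (a * R)) := by gcongr
      _ = Q * A * a * (‖c‖ * R) := by ring
      _ ≤ Q * A * a * (B * A / γ * (F + e * (R⁻¹ * (R⁻¹ * D)))) := by gcongr
      _ = _ := by rw [hG_def]; ring
  have h7 : l2Norm (hull K) (fun x => plateOp m (polyFun (q K)) x - L.f x) ≤ l2Norm (hull K) p + F := by
    have hpm : MemLp p 2 (volume.restrict (hull K)) := by
      refine (congrArg (fun f => MemLp f 2 (volume.restrict (hull K))) ?_).mp (hAq.add hfd)
      funext x; simp [hp_def]
    have hneg : MemLp (fun x => -(L.f x - polyFun (fh K) x)) 2 (volume.restrict (hull K)) := hfd.neg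
    have := l2Norm_add_le hpm hneg
    have e3 : l2Norm (hull K) (fun x => -(L.f x - polyFun (fh K) x)) = F := by
      simp only [hF_def, l2Norm, neg_sq]
    rw [e3] at this
    refine le_trans (le_of_eq ?_) this
    congr 1
    funext x; simp only [hp_def]; ring
  have h8 : size K ^ 2 * (R⁻¹ * (R⁻¹ * D)) ≤ a ^ 2 * D := by
    calc size K ^ 2 * (R⁻¹ * (R⁻¹ * D)) ≤ (a * R) ^ 2 * (R⁻¹ * (R⁻¹ * D)) := by gcongr
      _ = a ^ 2 * D := by field_simp
  have h9 : 0 ≤ size K ^ 2 * F := by positivity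
  have h10 : 0 ≤ e * a ^ 2 := by positivity
  rw [← hD_def, oscElem, ← hF_def]
  calc size K ^ 2 * l2Norm (hull K) (fun x => plateOp m (polyFun (q K)) x - L.f x)
      ≤ size K ^ 2 * (G * (F + e * (R⁻¹ * (R⁻¹ * D))) + F) := by gcongr; linarith
    _ = G * (size K ^ 2 * F + e * (size K ^ 2 * (R⁻¹ * (R⁻¹ * D)))) + size K ^ 2 * F := by ring
    _ ≤ G * (size K ^ 2 * F + e * (a ^ 2 * D)) + size K ^ 2 * F := by gcongr
    _ ≤ G * ((1 + e * a ^ 2) * (D + size K ^ 2 * F)) + size K ^ 2 * F := by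
      gcongr
      nlinarith [mul_nonneg h10 h9]
    _ ≤ _ := by nlinarith

/-! ### The triangles adjacent to an edge -/

namespace EdgeFrame

variable {E : Finset Plane} {n o : Plane} {h : ℝ}

theorem eq_or_eq_neg (hE : EdgeFrame E n o h) {ν : Plane} (hν : ‖ν‖ = 1)
    (ho : ∀ a ∈ E, ∀ b ∈ E, inner ℝ ν (b - a) = 0) : ν = n ∨ ν = -n := by
  have h1 := ho _ hE.left_mem _ hE.right_mem
  rw [show (o + (h / 2) • tangent n) - (o + (-(h / 2)) • tangent n) = h • tangent n by module,
    inner_smul_right] at h1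
  have h2 : inner ℝ ν (tangent n) = 0 := (mul_eq_zero.1 h1).resolve_left hE.pos.ne'
  have h3 := frameMap_inner hE.norm 0 ν
  rw [sub_zero, real_inner_comm, h2, frameMap, zero_smul, add_zero, zero_add] at h3
  dsimp only at h3
  have h4 : |inner ℝ n ν| = 1 := by
    have := congrArg (fun x : Plane => ‖x‖) h3
    rwa [norm_smul, hE.norm, mul_one, hν, Real.norm_eq_abs] at this
  rcases (abs_eq zero_le_one).1 h4 with h5 | h5
  · left; rw [← h3, h5, one_smul]
  · right; rw [← h3, h5, neg_one_smul]

theorem inner_sub_mem (hE : EdgeFrame E n o h) {a : Plane} (ha : a ∈ E) (x : Plane) :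
    inner ℝ n (x - a) = inner ℝ n (x - o) := by
  have h1 := hE.inner_eq_zero (subset_convexHull ℝ (E : Set Plane) ha)
  have : x - a = (x - o) - (a - o) := by abel
  rw [this, inner_sub_right, h1, sub_zero]

/-- A triangle with edge `E` lies on one of the two sides of the edge. -/
theorem regularAt_or (hE : EdgeFrame E n o h) {P : Plate} {T : Mesh P.Ω} {κ : ℝ}
    (hreg : T.ShapeRegular κ) {K : Finset Plane} (hK : K ∈ T.patch E) :
    RegularAt κ K E n o h ∨ RegularAt κ K E (-n) o h := by
  have hc : K.card = E.card + 1 := by rw [hK.1.2, hE.card_eq]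
  obtain ⟨z, -, hz⟩ := Finset.exists_eq_insert_iff.2 ⟨hK.2, hc.symm⟩
  have hcase : ∀ {ν : Plane}, EdgeFrame E ν o h → inner ℝ ν (z - o) ≤ 0 → RegularAt κ K E ν o h := by
    intro ν hν hzν
    refine ⟨hν, hK.2, hK.1.2, fun a ha x hx => ?_, hreg K hK.1⟩
    rw [hν.inner_sub_mem ha]
    rw [← hz, Finset.mem_insert] at hx
    rcases hx with rfl | hx
    · exact hzν
    · exact (hν.inner_eq_zero (subset_convexHull ℝ (E : Set Plane) hx)).le
  rcases le_total (inner ℝ n (z - o)) 0 with h0 | h0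
  · exact Or.inl (hcase hE h0)
  · exact Or.inr (hcase hE.neg (by rw [inner_neg_left]; linarith))

end EdgeFrame

theorem Mesh.exists_edgeFrame {P : Plate} {T : Mesh P.Ω} {E K : Finset Plane} (hE : E ∈ T.edges)
    {n : Plane} (hn : IsOuterNormal K E n) : ∃ o h, EdgeFrame E n o h :=
  EdgeFrame.exists_of_orthogonal hE.2 hn.norm hn.orthogonal

theorem IsOuterNormal.regularAt {P : Plate} {T : Mesh P.Ω} {κ : ℝ} (hreg : T.ShapeRegular κ)
    {E K : Finset Plane} (hK : K ∈ T.patch E) {n o : Plane} {h : ℝ} (hn : IsOuterNormal K E n)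
    (hE : EdgeFrame E n o h) : RegularAt κ K E n o h :=
  ⟨hE, hK.2, hK.1.2, hn.outward, hreg K hK.1⟩

section Sides

variable {P : Plate} {T : Mesh P.Ω} {κ : ℝ} {E K K' : Finset Plane} {n o : Plane} {h : ℝ}

theorem RegularAt.eq_of_same_side (hr : RegularAt κ K E n o h) (hr' : RegularAt κ K' E n o h)
    (hK : K ∈ T.elements) (hK' : K' ∈ T.elements) : K = K' := by
  have hδ := discRadius_pos κ
  have hh := hr.frame.pos
  have hn := hr.frame.norm
  have e0 : frameMap n o (0, -(discRadius κ * h / 2)) - o = (-(discRadius κ * h / 2)) • n := by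
    simp [frameMap]
  have e1 : inner ℝ n (frameMap n o (0, -(discRadius κ * h / 2)) - o) < 0 := by
    rw [inner_frameMap hn]
    simp only [Left.neg_neg_iff]; positivity
  have e2 : ‖frameMap n o (0, -(discRadius κ * h / 2)) - o‖ < discRadius κ * h := by
    rw [e0, norm_smul, hn, mul_one, Real.norm_eq_abs, abs_neg, abs_of_pos (by positivity)]
    linarith [mul_pos hδ hh]
  exact T.elements_eq_of_interior hK hK' (hr.mem_interior e2 e1) (hr'.mem_hull e2.le e1.le)

theorem RegularAt.closedBall_subset (hr : RegularAt κ K E n o h) (hr' : RegularAt κ K' E (-n) o h)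
    {x : Plane} (hx : ‖x - o‖ ≤ discRadius κ * h) : x ∈ hull K ∨ x ∈ hull K' := by
  rcases le_total (inner ℝ n (x - o)) 0 with h0 | h0
  · exact Or.inl (hr.mem_hull hx h0)
  · refine Or.inr (hr'.mem_hull hx ?_)
    change inner ℝ (-n) (x - o) ≤ 0
    rw [inner_neg_left]; linarith

theorem RegularAt.ball_subset_domain (hr : RegularAt κ K E n o h)
    (hr' : RegularAt κ K' E (-n) o h) (hK : K ∈ T.elements) (hK' : K' ∈ T.elements) :
    Metric.ball o (discRadius κ * h) ⊆ P.Ω := by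
  rw [← P.domain.interior_closure]
  refine interior_maximal (fun x hx => ?_) Metric.isOpen_ball
  rw [Metric.mem_ball, dist_eq_norm] at hx
  rcases hr.closedBall_subset hr' hx.le with h1 | h1
  · exact T.hull_subset_closure hK.1 h1
  · exact T.hull_subset_closure hK'.1 h1

/-- On an edge between two triangles, the edge forces are the jumps. -/
theorem RegularAt.interior_edgePatch (hr : RegularAt κ K E n o h)
    (hr' : RegularAt κ K' E (-n) o h) (hK : K ∈ T.elements) (hK' : K' ∈ T.elements)
    (hne : K ≠ K') (m : Material) (q : Finset Plane → MvPolynomial (Fin 2) ℝ) :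
    ∃ ν : Finset Plane → Plane, EdgePatch T κ E n o h {K, K'} ν ∧
      IsEdgeForce m q n {K, K'} ν (jumpV m n (-n) (polyFun (q K)) (polyFun (q K')))
        (jumpM m n (-n) (polyFun (q K)) (polyFun (q K'))) ∧
      ∀ w : Plane → ℝ, ContDiff ℝ ∞ w → tsupport w ⊆ Metric.closedBall o (discRadius κ * h / 2) →
        HasLocalTest P {K, K'} o (discRadius κ * h / 2) w := by
  classical
  have hpos := mul_pos (discRadius_pos κ) hr.frame.pos
  have hν : (if K' = K then n else -n) = -n := if_neg hne.symm
  refine ⟨fun X => if X = K then n else -n, ⟨hr.frame, ?_, ?_, by simp⟩, ?_, ?_⟩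
  · intro X hX
    rcases Finset.mem_insert.1 hX with rfl | hX
    · exact hK
    · rw [Finset.mem_singleton.1 hX]; exact hK'
  · intro X hX
    rcases Finset.mem_insert.1 hX with rfl | hX
    · simpa using hr
    · rw [Finset.mem_singleton.1 hX, hν]; exact hr'
  · intro t l x
    rw [Finset.sum_pair hne]
    simp only [if_true, hν, jumpV, jumpM, map_neg]
    ring
  · intro w hw hsupp
    refine hasLocalTest_of_subset hw hsupp ?_ fun x hx => ?_
    · exact (Metric.closedBall_subset_ball (by linarith)).trans
        (hr.ball_subset_domain hr' hK hK')
    · rw [Metric.mem_closedBall, dist_eq_norm] at hx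
      rcases hr.closedBall_subset hr' (by linarith) with h1 | h1
      · exact ⟨K, by simp, h1⟩
      · exact ⟨K', by simp, h1⟩

/-- An edge on the boundary belongs to only one triangle. -/
theorem RegularAt.patch_eq_of_frontier (hr : RegularAt κ K E n o h) (hreg : T.ShapeRegular κ)
    (hK : K ∈ T.elements) (hfr : hull E ⊆ frontier P.Ω) {K'' : Finset Plane}
    (hK'' : K'' ∈ T.patch E) : K'' = K := by
  rcases hr.frame.regularAt_or hreg hK'' with h1 | h1
  · exact (hr.eq_of_same_side h1 hK hK''.1).symm
  · have h2 := hr.ball_subset_domain h1 hK hK''.1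
      (Metric.mem_ball_self (mul_pos (discRadius_pos κ) hr.frame.pos))
    have h3 := hfr hr.frame.mid_mem
    rw [P.domain.isOpen.frontier_eq] at h3
    exact absurd h2 h3.2

/-- Smooth cut-off between two disjoint closed sets. -/
theorem exists_smooth_separation {s t : Set Plane} (hs : IsClosed s) (ht : IsClosed t)
    (hd : Disjoint s t) : ∃ χ : Plane → ℝ, ContDiff ℝ ∞ χ ∧ (∀ x ∈ s, χ =ᶠ[𝓝 x] 0) ∧
      (∀ x ∈ t, χ =ᶠ[𝓝 x] 1) ∧ ∀ x, χ x ∈ Set.Icc 0 1 := by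
  obtain ⟨f, h0, h1, hf⟩ := exists_contMDiffMap_zero_one_nhds_of_isClosed
    (modelWithCornersSelf ℝ Plane) (n := ⊤) hs ht hd
  exact ⟨f, f.contMDiff.contDiff, fun x hx => h0.filter_mono (nhds_le_nhdsSet hx),
    fun x hx => h1.filter_mono (nhds_le_nhdsSet hx), hf⟩

/-- Near a boundary edge, a smooth function is cut off from the other triangles, which may come
arbitrarily close to the edge from the outer side; it is admissible if it satisfies the boundary
conditions on the edge itself. -/
theorem RegularAt.boundary_hasLocalTest (hr : RegularAt κ K E n o h) (hreg : T.ShapeRegular κ)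
    (hK : K ∈ T.elements) (hfr : hull E ⊆ frontier P.Ω) {w : Plane → ℝ} (hw : ContDiff ℝ ∞ w)
    (hsupp : tsupport w ⊆ Metric.closedBall o (discRadius κ * h / 2))
    (h0 : ((P.Γc ∪ P.Γs) ∩ hull E ∩ {x | w x ≠ 0}).Finite) (h1 : (P.Γc ∩ hull E).Finite) :
    HasLocalTest P {K} o (discRadius κ * h / 2) w := by
  have hh := hr.frame.pos
  have hδ := discRadius_pos κ
  have hpos := mul_pos hδ hh
  set ρ := discRadius κ * h / 2 with hρ
  set others : Set Plane := ⋃ K'' ∈ T.elements \ {K}, hull K'' with hothers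
  have hs : IsClosed others :=
    (T.finite_elements.subset Set.sdiff_subset).isClosed_biUnion fun K'' _ => (isCompact_hull K'').isClosed
  have ht : IsClosed (hull K ∩ Metric.closedBall o ρ) :=
    (isCompact_hull K).isClosed.inter Metric.isClosed_closedBall
  have hd : Disjoint others (hull K ∩ Metric.closedBall o ρ) := by
    refine Set.disjoint_left.2 fun x hx hxK => ?_
    obtain ⟨K'', hK'', hxK''⟩ := Set.mem_iUnion₂.1 hx
    have hxo := hxK.2
    rw [Metric.mem_closedBall, dist_eq_norm] at hxo
    have h2 := T.mem_hull_inter hK.1 hK''.1.1 hxK.1 hxK''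
    have h3 := (hr.edge_subset_face (by linarith) Finset.inter_subset_left h2).trans
      Finset.inter_subset_right
    exact hK''.2 (hr.patch_eq_of_frontier hreg hK hfr ⟨hK''.1, h3⟩)
  obtain ⟨χ, hχ, hχ0, hχ1, -⟩ := exists_smooth_separation hs ht hd
  have hWs : ContDiff ℝ ∞ fun x => χ x * w x := hχ.mul hw
  have hWt : tsupport (fun x => χ x * w x) ⊆ tsupport w := tsupport_mul_subset_right
  have hWc : HasCompactSupport fun x => χ x * w x :=
    (isCompact_closedBall o ρ).of_isClosed_subset (isClosed_tsupport _) (hWt.trans hsupp)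
  have hin : ∀ x ∈ closure P.Ω, x ∈ tsupport (fun x => χ x * w x) → x ∈ hull K := by
    intro x hx hxW
    obtain ⟨K'', hK'', hxK''⟩ := T.exists_element_of_mem hx
    by_cases he : K'' = K
    · rwa [← he]
    · have hx0 := hχ0 x (Set.mem_biUnion ⟨hK'', he⟩ hxK'')
      refine absurd hxW (notMem_tsupport_iff_eventuallyEq.2 ?_)
      filter_upwards [hx0] with y hy
      rw [hy]; simp
  -- on the boundary, the test function only lives on the edge
  have hedge : ∀ x ∈ frontier P.Ω, x ∈ tsupport (fun x => χ x * w x) → x ∈ hull E := by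
    intro x hx hxW
    have hxK := hin x (frontier_subset_closure hx) hxW
    have hxo := hsupp (hWt hxW)
    rw [Metric.mem_closedBall, dist_eq_norm] at hxo
    refine hr.frame.mem_hull_of_norm_le (hxo.trans ?_) ?_
    · rw [hρ]; nlinarith [discRadius_le κ]
    · by_contra hne
      have hlt := lt_of_le_of_ne (hr.hull_subset hxK) hne
      have := T.interior_hull_subset hK.1 (hr.mem_interior (by linarith) hlt)
      rw [P.domain.isOpen.frontier_eq] at hx
      exact hx.2 this
  have hΓ : P.Γc ∪ P.Γs ⊆ frontier P.Ω := by
    rw [← P.boundary]; exact Set.subset_union_left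
  refine ⟨_, hWs, hWc, memV_smoothH2 P hWs hWc ?_ ?_, hWt.trans hsupp, ?_, ?_⟩
  · refine h0.subset fun x hx => ⟨⟨hx.1, hedge x (hΓ hx.1) (subset_tsupport _ hx.2)⟩, ?_⟩
    exact right_ne_zero_of_mul hx.2
  · exact h1.subset fun x hx => ⟨hx.1, hedge x (hΓ (Or.inl hx.1)) hx.2⟩
  · intro X hX x hx
    rw [Finset.mem_singleton.1 hX] at hx
    by_cases hxo : x ∈ Metric.closedBall o ρ
    · filter_upwards [hχ1 x ⟨hx, hxo⟩] with y hy
      rw [hy]; simp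
    · have := notMem_tsupport_iff_eventuallyEq.1 fun h => hxo (hsupp h)
      filter_upwards [this] with y hy
      rw [hy]; simp
  · exact fun x hx hxW => ⟨K, by simp, hin x hx hxW⟩

theorem RegularAt.boundary_edgePatch (hr : RegularAt κ K E n o h) (hK : K ∈ T.elements) :
    EdgePatch T κ E n o h {K} (fun _ => n) :=
  ⟨hr.frame, by simpa using hK, by simpa using hr, by simp⟩

theorem isEdgeForce_singleton (m : Material) (q : Finset Plane → MvPolynomial (Fin 2) ℝ) (n : Plane)
    (K : Finset Plane) :
    IsEdgeForce m q n {K} (fun _ => n) (Vn m n (polyFun (q K))) (Mnn m n (polyFun (q K))) :=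
  fun _ _ _ => Finset.sum_singleton _ _

end Sides

/-! ### Sums over the patch of an edge -/

section Patch

variable {P : Plate} (T : Mesh P.Ω) {E K : Finset Plane}

theorem Mesh.finite_patch (E : Finset Plane) : (T.patch E).Finite :=
  T.finite_elements.subset fun _ h => h.1

theorem h2Dist_nonneg {Ω : Set Plane} (A : Set Plane) (u v : H2Function Ω) : 0 ≤ h2Dist A u v :=
  Real.sqrt_nonneg _

theorem oscElem_nonneg (f : Plane → ℝ) (fh : Finset Plane → MvPolynomial (Fin 2) ℝ)
    (K : Finset Plane) : 0 ≤ oscElem f fh K := mul_nonneg (sq_nonneg _) (l2Norm_nonneg _ _)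

theorem Mesh.oscPatch_nonneg (f : Plane → ℝ) (fh : Finset Plane → MvPolynomial (Fin 2) ℝ) :
    0 ≤ oscPatch T f fh E := 
    finsum_nonneg fun K => finsum_nonneg fun _ => oscElem_nonneg f fh K

theorem Mesh.sum_oscElem_le (f : Plane → ℝ) (fh : Finset Plane → MvPolynomial (Fin 2) ℝ)
    {𝒦 : Finset (Finset Plane)} (h𝒦 : ∀ K ∈ 𝒦, K ∈ T.patch E) :
    ∑ K ∈ 𝒦, oscElem f fh K ≤ oscPatch T f fh E := by
  rw [oscPatch, finsum_mem_eq_finite_toFinset_sum _ (T.finite_patch E)]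
  exact Finset.sum_le_sum_of_subset_of_nonneg
    (fun K hK => (T.finite_patch E).mem_toFinset.2 (h𝒦 K hK)) fun K _ _ => oscElem_nonneg f fh K

theorem Mesh.h2Dist_hull_le (u v : H2Function P.Ω) (hK : K ∈ T.patch E) :
    h2Dist (hull K) u v ≤ h2Dist (T.omega E) u v := by
  refine Real.sqrt_le_sqrt (setIntegral_mono_set ?_ ?_ ?_)
  · refine (integrableOn_finite_biUnion (T.finite_patch E)).2 fun K' hK' => ?_
    exact Integrable.mono_measure (integrableOn_h2Density u v) (T.restrict_hull_le hK'.1)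
  · exact Eventually.of_forall fun x => h2Density_nonneg u v x
  · exact LE.le.eventuallyLE (Set.subset_biUnion_of_mem (u := fun K => hull K) hK)

/-- The right-hand sides of the estimates on edges, in terms of the error and the oscillation. -/
theorem Mesh.sum_residual_le (u v : H2Function P.Ω) {f : Plane → ℝ}
    {fh : Finset Plane → MvPolynomial (Fin 2) ℝ} {p : Finset Plane → Plane → ℝ} {C : ℝ} (hC : 0 ≤ C)
    (hp : ∀ K ∈ T.elements,
      size K ^ 2 * l2Norm (hull K) (p K) ≤ C * (h2Dist (hull K) u v + oscElem f fh K))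
    {𝒦 : Finset (Finset Plane)} (h𝒦 : ∀ K ∈ 𝒦, K ∈ T.patch E) (hcard : 𝒦.card ≤ 2) :
    size E ^ 2 * ∑ K ∈ 𝒦, l2Norm (hull K) (p K) + ∑ K ∈ 𝒦, h2Dist (hull K) u v
      ≤ 2 * (C + 1) * (h2Dist (T.omega E) u v + oscPatch T f fh E) := by
  have h1 : size E ^ 2 * ∑ K ∈ 𝒦, l2Norm (hull K) (p K)
      ≤ ∑ K ∈ 𝒦, C * (h2Dist (hull K) u v + oscElem f fh K) := by
    rw [Finset.mul_sum]
    refine Finset.sum_le_sum fun K hK => ?_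
    refine (mul_le_mul_of_nonneg_right ?_ (l2Norm_nonneg _ _)).trans (hp K (h𝒦 K hK).1)
    exact pow_le_pow_left₀ (size_nonneg E) (size_mono (h𝒦 K hK).2) 2
  have h2 : ∑ K ∈ 𝒦, h2Dist (hull K) u v ≤ 2 * h2Dist (T.omega E) u v := by
    refine (Finset.sum_le_card_nsmul _ _ _ fun K hK => T.h2Dist_hull_le u v (h𝒦 K hK)).trans ?_
    rw [nsmul_eq_mul]
    refine mul_le_mul_of_nonneg_right ?_ (h2Dist_nonneg _ _ _)
    exact_mod_cast hcard
  have h3 := T.sum_oscElem_le f fh h𝒦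
  have h4 := T.oscPatch_nonneg (E := E) f fh
  rw [← Finset.mul_sum, Finset.sum_add_distrib] at h1
  nlinarith [mul_le_mul_of_nonneg_left h2 hC, mul_le_mul_of_nonneg_left h3 hC, mul_nonneg hC h4]

end Patch

/-! ### Estimates for jumps and boundary forces -/

section Bounds

variable {P : Plate} {L : Load} {T : Mesh P.Ω}

theorem Mesh.notMem_lineEdges_of_frontier {κ : ℝ} (hreg : T.ShapeRegular κ) {E K : Finset Plane}
    {n o : Plane} {h : ℝ} (hr : RegularAt κ K E n o h) (hK : K ∈ T.elements)
    (hfr : hull E ⊆ frontier P.Ω) (S : Set Plane) : E ∉ T.lineEdges S := by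
  rintro ⟨⟨-, K₁, hK₁, K₂, hK₂, hne⟩, -⟩
  exact hne ((hr.patch_eq_of_frontier hreg hK hfr hK₁).trans
    (hr.patch_eq_of_frontier hreg hK hfr hK₂).symm)

theorem lineLoad_of_notMem {E : Finset Plane} (hE : E ∉ T.lineEdges L.S) :
    lineLoad T L E = fun _ => 0 := by
  funext x; simp [lineLoad, hE]

theorem lineLoad_of_mem {E : Finset Plane} (hE : E ∈ T.lineEdges L.S) : lineLoad T L E = L.g := by
  funext x; simp [lineLoad, hE]

theorem isPolyFun_zero (r : ℕ) : IsPolyFun r (fun _ : Plane => (0 : ℝ)) :=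
  ⟨0, by simp, by funext x; simp [polyFun]⟩

theorem edgeNorm_zero (E : Finset Plane) : edgeNorm E (fun _ => (0 : ℝ)) = 0 := by simp [edgeNorm]

theorem edgeNorm_sub_le {E : Finset Plane} {n o : Plane} {h : ℝ} (hE : EdgeFrame E n o h)
    {V G g : Plane → ℝ} (hV : Continuous V) (hG : Continuous G)
    (hg : MemLp (fun x => g x - G x) 2 (μH[1].restrict (hull E))) :
    edgeNorm E (fun x => V x - g x)
      ≤ edgeNorm E (fun x => V x - G x) + edgeNorm E (fun x => g x - G x) := by
  have hneg : MemLp (fun x => -(g x - G x)) 2 (μH[1].restrict (hull E)) := hg.neg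
  have h1 := sqrt_integral_add_sq_le (memLp_edge hE (hV.sub hG)) hneg
  simp only [neg_sq, Pi.sub_apply] at h1
  refine le_trans (le_of_eq ?_) h1
  rw [edgeNorm]
  congr 3
  funext x
  ring

theorem IsOuterNormal.interior_frame {κ : ℝ} (hreg : T.ShapeRegular κ) {E K K' : Finset Plane}
    (hE : E ∈ T.edges) (hK : K ∈ T.patch E) (hK' : K' ∈ T.patch E) (hne : K ≠ K') {n n' : Plane}
    (hn : IsOuterNormal K E n) (hn' : IsOuterNormal K' E n') :
    n' = -n ∧ ∃ o, RegularAt κ K E n o (size E) ∧ RegularAt κ K' E (-n) o (size E) := by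
  obtain ⟨o, h, hf⟩ := T.exists_edgeFrame hE hn
  obtain rfl := hf.size_eq
  have hr := hn.regularAt hreg hK hf
  have hneg : n' = -n := by
    refine (hf.eq_or_eq_neg hn'.norm hn'.orthogonal).resolve_left ?_
    rintro rfl
    exact hne (hr.eq_of_same_side (hn'.regularAt hreg hK' hf) hK.1 hK'.1)
  subst hneg
  exact ⟨rfl, o, hr, hn'.regularAt hreg hK' hf.neg⟩

end Bounds

end Kirchhoff

end

theorem theorem3p2 (m : Kirchhoff.Material) (κ : ℝ) (k r : ℕ) :
    ∃ C : ℝ, 0 < C ∧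
    ∀ (P : Kirchhoff.Plate) (L : Kirchhoff.Load), L.Admissible P.Ω →
    ∀ u : Kirchhoff.H2Function P.Ω, Kirchhoff.IsWeakSolution m P L u →
    ∀ T : Kirchhoff.Mesh P.Ω, T.ShapeRegular κ → T.Fits L →
    ∀ fh gh : Finset Kirchhoff.Plane → MvPolynomial (Fin 2) ℝ,
      (∀ K ∈ T.elements, (fh K).totalDegree ≤ k) →
      (∀ E ∈ T.lineEdges L.S, (gh E).totalDegree ≤ r) →
    ∀ (v : Kirchhoff.H2Function P.Ω) (q : Finset Kirchhoff.Plane → MvPolynomial (Fin 2) ℝ),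
      Kirchhoff.IsFEFunction P T k v q →
    -- element residuals
    (∀ K ∈ T.elements,
      Kirchhoff.size K ^ 2 *
          Kirchhoff.l2Norm (Kirchhoff.hull K)
            (fun x => Kirchhoff.plateOp m (Kirchhoff.polyFun (q K)) x - L.f x)
        ≤ C * (Kirchhoff.h2Dist (Kirchhoff.hull K) u v + Kirchhoff.oscElem L.f fh K)) ∧
    -- normal moment jumps on interior edges
    (∀ E ∈ T.interiorEdges, ∀ K ∈ T.patch E, ∀ K' ∈ T.patch E, K ≠ K' →
      ∀ n n' : Kirchhoff.Plane, Kirchhoff.IsOuterNormal K E n → Kirchhoff.IsOuterNormal K' E n' →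
      Kirchhoff.size E ^ (1 / 2 : ℝ) *
          Kirchhoff.edgeNorm E
            (Kirchhoff.jumpM m n n' (Kirchhoff.polyFun (q K)) (Kirchhoff.polyFun (q K')))
        ≤ C * (Kirchhoff.h2Dist (T.omega E) u v + Kirchhoff.oscPatch T L.f fh E)) ∧
    -- effective shear jumps on interior edges without line load
    (∀ E ∈ T.interiorEdges \ T.lineEdges L.S, ∀ K ∈ T.patch E, ∀ K' ∈ T.patch E, K ≠ K' →
      ∀ n n' : Kirchhoff.Plane, Kirchhoff.IsOuterNormal K E n → Kirchhoff.IsOuterNormal K' E n' →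
      Kirchhoff.size E ^ (3 / 2 : ℝ) *
          Kirchhoff.edgeNorm E
            (Kirchhoff.jumpV m n n' (Kirchhoff.polyFun (q K)) (Kirchhoff.polyFun (q K')))
        ≤ C * (Kirchhoff.h2Dist (T.omega E) u v + Kirchhoff.oscPatch T L.f fh E)) ∧
    -- effective shear jumps on edges carrying the line load
    (∀ E ∈ T.lineEdges L.S, ∀ K ∈ T.patch E, ∀ K' ∈ T.patch E, K ≠ K' →
      ∀ n n' : Kirchhoff.Plane, Kirchhoff.IsOuterNormal K E n → Kirchhoff.IsOuterNormal K' E n' →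
      Kirchhoff.size E ^ (3 / 2 : ℝ) *
          Kirchhoff.edgeNorm E (fun x =>
            Kirchhoff.jumpV m n n' (Kirchhoff.polyFun (q K)) (Kirchhoff.polyFun (q K')) x - L.g x)
        ≤ C * (Kirchhoff.h2Dist (T.omega E) u v + Kirchhoff.oscPatch T L.f fh E
            + Kirchhoff.oscEdge L.g gh E)) ∧
    -- normal moments on free and simply supported edges
    (∀ E ∈ T.edgesOn P.Γf ∪ T.edgesOn P.Γs, ∀ K ∈ T.patch E,
      ∀ n : Kirchhoff.Plane, Kirchhoff.IsOuterNormal K E n →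
      Kirchhoff.size E ^ (1 / 2 : ℝ) *
          Kirchhoff.edgeNorm E (Kirchhoff.Mnn m n (Kirchhoff.polyFun (q K)))
        ≤ C * (Kirchhoff.h2Dist (T.omega E) u v + Kirchhoff.oscPatch T L.f fh E)) ∧
    -- effective shear forces on free edges
    (∀ E ∈ T.edgesOn P.Γf, ∀ K ∈ T.patch E,
      ∀ n : Kirchhoff.Plane, Kirchhoff.IsOuterNormal K E n →
      Kirchhoff.size E ^ (3 / 2 : ℝ) *
          Kirchhoff.edgeNorm E (Kirchhoff.Vn m n (Kirchhoff.polyFun (q K)))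
        ≤ C * (Kirchhoff.h2Dist (T.omega E) u v + Kirchhoff.oscPatch T L.f fh E)) := by
  obtain ⟨C₀, hC₀, hel⟩ := Kirchhoff.exists_element_bound m κ k
  obtain ⟨C₁, hC₁, hmom⟩ := Kirchhoff.exists_moment_bound m κ k
  obtain ⟨C₂, hC₂, hshe⟩ := Kirchhoff.exists_shear_bound m κ k r
  refine ⟨C₀ + (C₁ + C₂) * (2 * (C₀ + 1)) + C₂ + 1, by positivity, ?_⟩
  intro P L hL u hu T hreg hfit fh gh hfh hgh v q hv
  have hres := hel hu hL hreg hfit hv hfh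
  have hpoly : ∀ K ∈ T.elements, Kirchhoff.IsPolyFun k (Kirchhoff.polyFun (q K)) :=
    fun K hK => ⟨q K, hv.degree K hK, rfl⟩
  have hH : ∀ A, 0 ≤ Kirchhoff.h2Dist A u v := fun A => Kirchhoff.h2Dist_nonneg A u v
  have hO : ∀ E, 0 ≤ Kirchhoff.oscPatch T L.f fh E := fun E => T.oscPatch_nonneg L.f fh
  have hmono : ∀ {a b X : ℝ}, 0 ≤ X → a ≤ b → a * X ≤ b * X :=
    fun hX hab => mul_le_mul_of_nonneg_right hab hX
  -- the constants of the estimates on edges are absorbed; `Z` is the oscillation of the line load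
  have hM : ∀ {E : Finset Kirchhoff.Plane} {Y X : ℝ}, Y ≤ C₁ * X →
      X ≤ 2 * (C₀ + 1) * (Kirchhoff.h2Dist (T.omega E) u v + Kirchhoff.oscPatch T L.f fh E) →
      Y ≤ (C₀ + (C₁ + C₂) * (2 * (C₀ + 1)) + C₂ + 1)
        * (Kirchhoff.h2Dist (T.omega E) u v + Kirchhoff.oscPatch T L.f fh E) := by
    intro E Y X hY hX
    refine hY.trans ((mul_le_mul_of_nonneg_left hX hC₁.le).trans ?_)
    rw [← mul_assoc]
    refine hmono (add_nonneg (hH _) (hO E)) ?_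
    nlinarith [mul_pos hC₂ hC₀]
  have hV : ∀ {E : Finset Kirchhoff.Plane} {Y X Z : ℝ}, Y ≤ C₂ * (X + Z) → 0 ≤ Z →
      X ≤ 2 * (C₀ + 1) * (Kirchhoff.h2Dist (T.omega E) u v + Kirchhoff.oscPatch T L.f fh E) →
      Y + Z ≤ (C₀ + (C₁ + C₂) * (2 * (C₀ + 1)) + C₂ + 1)
        * (Kirchhoff.h2Dist (T.omega E) u v + Kirchhoff.oscPatch T L.f fh E + Z) := by
    intro E Y X Z hY hZ hX
    have h0 := add_nonneg (hH (T.omega E)) (hO E)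
    calc Y + Z ≤ C₂ * (2 * (C₀ + 1) * (Kirchhoff.h2Dist (T.omega E) u v
            + Kirchhoff.oscPatch T L.f fh E) + Z) + Z := by
          have := mul_le_mul_of_nonneg_left hX hC₂.le
          linarith
      _ = C₂ * (2 * (C₀ + 1)) * (Kirchhoff.h2Dist (T.omega E) u v
            + Kirchhoff.oscPatch T L.f fh E) + (C₂ + 1) * Z := by ring
      _ ≤ (C₀ + (C₁ + C₂) * (2 * (C₀ + 1)) + C₂ + 1) * (Kirchhoff.h2Dist (T.omega E) u v
            + Kirchhoff.oscPatch T L.f fh E)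
          + (C₀ + (C₁ + C₂) * (2 * (C₀ + 1)) + C₂ + 1) * Z :=
        add_le_add (hmono h0 (by nlinarith [mul_pos hC₁ hC₀]))
          (hmono hZ (by nlinarith [mul_pos hC₁ hC₀, mul_pos hC₂ hC₀]))
      _ = _ := by ring
  refine ⟨fun K hK => (hres K hK).trans (hmono (add_nonneg (hH _)
    (Kirchhoff.oscElem_nonneg _ _ _)) ?_), ?_, ?_, ?_, ?_, ?_⟩
  · nlinarith [mul_pos hC₁ hC₀, mul_pos hC₂ hC₀]
  · intro E hE K hK K' hK' hne n n' hn hn'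
    obtain ⟨rfl, o, hr, hr'⟩ := hn.interior_frame hreg hE.1 hK hK' hne hn'
    obtain ⟨ν, hp, hVM, hloc⟩ := hr.interior_edgePatch hr' hK.1 hK'.1 hne m q
    refine hM (hmom hu hL hfit hv hp (fun w hw hs _ => hloc w hw hs) hVM
      (((hpoly K hK.1).mnn m n).sub ((hpoly K' hK'.1).mnn m (-n)))) ?_
    exact T.sum_residual_le u v hC₀.le hres (by simp [hK, hK']) Finset.card_le_two
  · intro E hE K hK K' hK' hne n n' hn hn'
    obtain ⟨rfl, o, hr, hr'⟩ := hn.interior_frame hreg hE.1.1 hK hK' hne hn'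
    obtain ⟨ν, hp, hVM, hloc⟩ := hr.interior_edgePatch hr' hK.1 hK'.1 hne m q
    have h1 := hshe hu hL hfit hv hp hloc hVM
      (((hpoly K hK.1).vn m n).add ((hpoly K' hK'.1).vn m (-n))) (Kirchhoff.isPolyFun_zero r)
    simp only [sub_zero, Kirchhoff.lineLoad_of_notMem hE.2, Kirchhoff.edgeNorm_zero, mul_zero] at h1
    have h2 := hV h1 le_rfl
      (T.sum_residual_le u v hC₀.le hres (by simp [hK, hK']) Finset.card_le_two)
    rwa [add_zero, add_zero] at h2
  · intro E hE K hK K' hK' hne n n' hn hn'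
    obtain ⟨rfl, o, hr, hr'⟩ := hn.interior_frame hreg hE.1.1 hK hK' hne hn'
    obtain ⟨ν, hp, hVM, hloc⟩ := hr.interior_edgePatch hr' hK.1 hK'.1 hne m q
    have hVp := ((hpoly K hK.1).vn m n).add ((hpoly K' hK'.1).vn m (-n))
    have hGp : Kirchhoff.IsPolyFun r (Kirchhoff.polyFun (gh E)) := ⟨gh E, hgh E hE, rfl⟩
    have h1 := hshe hu hL hfit hv hp hloc hVM hVp hGp
    rw [Kirchhoff.lineLoad_of_mem hE] at h1
    have hgm : MemLp (fun x => L.g x - Kirchhoff.polyFun (gh E) x) 2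
        (Measure.restrict μH[1] (Kirchhoff.hull E)) :=
      (hL.memLp_g.mono_measure (Measure.restrict_mono_set _ hE.2)).sub
        (Kirchhoff.memLp_edge hp.frame hGp.smooth.continuous)
    have h2 := hV h1 (mul_nonneg (Real.rpow_nonneg (Kirchhoff.size_nonneg E) _)
        (Kirchhoff.edgeNorm_nonneg _ _))
      (T.sum_residual_le u v hC₀.le hres (by simp [hK, hK']) Finset.card_le_two)
    refine le_trans ?_ h2
    rw [← mul_add]
    refine mul_le_mul_of_nonneg_left ?_ (Real.rpow_nonneg (Kirchhoff.size_nonneg E) _)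
    exact Kirchhoff.edgeNorm_sub_le hp.frame hVp.smooth.continuous hGp.smooth.continuous hgm
  · intro E hE K hK n hn
    have hfr : Kirchhoff.hull E ⊆ frontier P.Ω := by
      rw [← P.boundary]
      rcases hE with h | h
      · exact fun x hx => Or.inr (h.2 hx)
      · exact fun x hx => Or.inl (Or.inr (h.2 hx))
    obtain ⟨o, h, hf⟩ := T.exists_edgeFrame (hE.elim (fun h => h.1) (fun h => h.1)) hn
    obtain rfl := hf.size_eq
    have hr := hn.regularAt hreg hK hf
    refine hM (hmom hu hL hfit hv (hr.boundary_edgePatch hK.1) (fun w hw hs h0 => ?_)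
      (Kirchhoff.isEdgeForce_singleton m q n K) ((hpoly K hK.1).mnn m n)) ?_
    · refine hr.boundary_hasLocalTest hreg hK.1 hfr hw hs ?_ ?_
      · exact Set.finite_empty.subset fun x hx => hx.2 (h0 x hx.1.2)
      · rcases hE with h | h
        · exact P.finite_cf.subset fun x hx => ⟨hx.1, h.2 hx.2⟩
        · exact P.finite_cs.subset fun x hx => ⟨hx.1, h.2 hx.2⟩
    · exact T.sum_residual_le u v hC₀.le hres (by simp [hK]) (by simp)
  · intro E hE K hK n hn
    have hfr : Kirchhoff.hull E ⊆ frontier P.Ω := by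
      rw [← P.boundary]
      exact fun x hx => Or.inr (hE.2 hx)
    obtain ⟨o, h, hf⟩ := T.exists_edgeFrame hE.1 hn
    obtain rfl := hf.size_eq
    have hr := hn.regularAt hreg hK hf
    have h1 := hshe hu hL hfit hv (hr.boundary_edgePatch hK.1) (fun w hw hs => by
        refine hr.boundary_hasLocalTest hreg hK.1 hfr hw hs ?_ ?_
        · refine (P.finite_cf.union P.finite_sf).subset fun x hx => ?_
          exact hx.1.1.imp (fun h => ⟨h, hE.2 hx.1.2⟩) fun h => ⟨h, hE.2 hx.1.2⟩
        · exact P.finite_cf.subset fun x hx => ⟨hx.1, hE.2 hx.2⟩)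
      (Kirchhoff.isEdgeForce_singleton m q n K) ((hpoly K hK.1).vn m n) (Kirchhoff.isPolyFun_zero r)
    simp only [sub_zero, Kirchhoff.lineLoad_of_notMem
      (Kirchhoff.Mesh.notMem_lineEdges_of_frontier hreg hr hK.1 hfr L.S),
      Kirchhoff.edgeNorm_zero, mul_zero] at h1
    have h2 := hV h1 le_rfl (T.sum_residual_le u v hC₀.le hres (by simp [hK]) (by simp))
    rwa [add_zero, add_zero] at h2
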